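/- **Setting.** All spaces are over $\mathbb K\in\{\mathbb R,\mathbb C\}$. A *Banach function space* $E$ over a $\sigma$-finite measure space $(\Omega,\mu)$ is a Banach space $E\subseteq L^0(\Omega)$ such that (i) $f\in E$, $g\in L^0(\Omega)$, $|g|\le|f|$ a.e. imply $g\in E$ and $\|g\|_E\le\|f\|_E$; (ii) every measurable set of positive measure contains a measurable subset $F$ of positive measure with $\mathbf 1_F\in E$. It has the *Fatou property* if $0\le f_n\le f_{n+1}$ in $E$ with $\sup_n\|f_n\|_E<\infty$ implies $f=\sup_nf_n\in E$ and $\|f\|_E=\sup_n\|f_n\|_E$, and an *absolutely continuous norm* if $\|f\mathbf 1_{A_n}\|_E\to0$ for every $f\in E$ and every decreasing sequence of measurable sets $A_n$ with $\mathbf 1_{A_n}\to0$ a.e. The Köthe dual $E'=\{g\in L^0(\Omega): fg\in L^1(\Omega)\ \forall f\in E\}$ carries the norm $\|g\|_{E'}=\sup\{\int_\Omega|fg|\,d\mu:\|f\|_E\le1\}$. For $1\le q\le\infty$, $E(\ell^q)$ is the space of sequences $(f_j)_{j\in\mathbb Z}$ in $L^0(\Omega)$ with $\|(f_j)_j\|_{E(\ell^q)}:=\big\|\big(\sum_j|f_j|^q\big)^{1/q}\big\|_E<\infty$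 (with the supremum $\sup_j|f_j|$ if $q=\infty$). A *structured Banach space* $\mathcal X=(X,J,E)$ consists here of a Banach space $X$, a Banach function space $E$ and an isometric linear surjection $J:X\to E$. If the norm of $E$ is absolutely continuous, then $\mathcal X'=(X',(J^{-1})',E')$, where $(J^{-1})'\varphi$, $\varphi\in X'$, is identified with the function $g\in E'$ such that $\varphi(J^{-1}f)=\int_\Omega fg\,d\mu$ for all $f\in E$. For an interpolation couple $(\mathcal X_0,\mathcal X_1)$ of such spaces (i.e. $X_0,X_1$ embed continuously into a common Hausdorff topological vector space), $\theta\in(0,1)$ and $q\in[1,\infty]$, the space $(\mathcal X_0,\mathcal X_1)_{\theta,\ell^q}$ consists of all $x\in X_0+X_1$ with $$\|x\|_{\theta,\ell^q}:=\inf\sum_{\nu=0}^1\Big\|\big(2^{(\nu-\theta)j}J_\nu x_\nu(j)\big)_{j\in\mathbb Z}\Big\|_{E_\nu(\ell^q)}<\infty,$$ where the infimum is over all families of decompositions $x=x_0(j)+x_1(j)$, $x_\nu(j)\in X_\nu$, $j\in\mathbb Z$. The space $(\mathcal X_0',\mathcal X_1')_{\theta,\ell^{q'}}$ is defined in the same way,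 by decompositions in $(X_0\cap X_1)'$, where $X_\nu'$ is mapped to $(X_0\cap X_1)'$ by restriction of functionals to $X_0\cap X_1$ (this map is injective if and only if $X_0\cap X_1$ is dense in $X_\nu$, which is the usual situation; density is not needed below). In particular its elements belong to the image $X_0'+X_1'$, and their pairing with $x\in X_0\cap X_1$ is $\langle x,\varphi_0+\varphi_1\rangle=\varphi_0(x)+\varphi_1(x)$. **Theorem.** Let $(\mathcal X_0,\mathcal X_1)$ be an interpolation couple of structured Banach spaces $\mathcal X_\nu=(X_\nu,J_\nu,E_\nu)$, $\nu=0,1$, where each $E_\nu$ is a Banach function space with the Fatou property and absolutely continuous norm, each $J_\nu:X_\nu\to E_\nu$ is an isometric surjection, and each $X_\nu$ is reflexive. Let $\theta\in(0,1)$, $q\in[1,\infty)$ and $\frac1q+\frac1{q'}=1$. Then $(J_\nu^{-1})':X_\nu'\to E_\nu'$ is well defined and isometric for $\nu=0,1$, and for the duality pairing $\langle\cdot,\cdot\rangle_{X_0\cap X_1,X_0'+X_1'}$ we have $$\big((\mathcal X_0,\mathcal X_1)_{\theta,\ell^q}\big)'=(\mathcal X_0',\mathcal X_1')_{\theta,\ell^{q'}}$$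 with equivalent norms. That is, $X_0\cap X_1\subseteq(\mathcal X_0,\mathcal X_1)_{\theta,\ell^q}$, and $\psi\mapsto\psi|_{X_0\cap X_1}$ is a linear isomorphism, bounded in both directions, of the dual space of $(\mathcal X_0,\mathcal X_1)_{\theta,\ell^q}$ onto $(\mathcal X_0',\mathcal X_1')_{\theta,\ell^{q'}}$. -/

import Mathlib

open MeasureTheory Filter Topology
open scoped ENNReal

noncomputable section

namespace LqInterpolation

/-! ### Banach function spaces -/

/-- A Banach function space over `(Ω, μ)`: a linear subspace of `L⁰(μ)` with a complete norm that
is solid (the ideal property) and saturated. -/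
structure BanachFunctionSpace (𝕜 : Type*) [RCLike 𝕜] {Ω : Type*} [MeasurableSpace Ω]
    (μ : Measure Ω) where
  toSubmodule : Submodule 𝕜 (Ω →ₘ[μ] 𝕜)
  normFun : toSubmodule → ℝ
  normFun_smul : ∀ (c : 𝕜) (f : toSubmodule), normFun (c • f) = ‖c‖ * normFun f
  normFun_add_le : ∀ f g : toSubmodule, normFun (f + g) ≤ normFun f + normFun g
  eq_zero_of_normFun : ∀ f : toSubmodule, normFun f = 0 → f = 0
  complete : ∀ u : ℕ → toSubmodule,
    (∀ ε > 0, ∃ N, ∀ m ≥ N, ∀ n ≥ N, normFun (u m - u n) < ε) →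
      ∃ l : toSubmodule, Tendsto (fun n => normFun (u n - l)) atTop (𝓝 0)
  solid : ∀ (f : toSubmodule) (g : Ω →ₘ[μ] 𝕜),
    (∀ᵐ ω ∂μ, ‖g ω‖ ≤ ‖(f : Ω →ₘ[μ] 𝕜) ω‖) →
      ∃ hg : g ∈ toSubmodule, normFun ⟨g, hg⟩ ≤ normFun f
  saturated : ∀ A : Set Ω, MeasurableSet A → 0 < μ A →
    ∃ B ⊆ A, MeasurableSet B ∧ 0 < μ B ∧
      ∃ f ∈ toSubmodule, f =ᵐ[μ] B.indicator (fun _ => (1 : 𝕜))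

namespace BanachFunctionSpace

variable {𝕜 : Type*} [RCLike 𝕜] {Ω : Type*} [MeasurableSpace Ω] {μ : Measure Ω}

/-- The elements of a Banach function space, as a normed space in its own right. -/
def Elem (E : BanachFunctionSpace 𝕜 μ) : Type _ := E.toSubmodule

instance : CoeSort (BanachFunctionSpace 𝕜 μ) (Type _) := ⟨Elem⟩

instance (E : BanachFunctionSpace 𝕜 μ) : AddCommGroup E :=
  inferInstanceAs (AddCommGroup E.toSubmodule)

instance (E : BanachFunctionSpace 𝕜 μ) : Module 𝕜 E :=
  inferInstanceAs (Module 𝕜 E.toSubmodule)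

/-- The inclusion of a Banach function space into `L⁰(μ)`. -/
def toL0 (E : BanachFunctionSpace 𝕜 μ) : E →ₗ[𝕜] (Ω →ₘ[μ] 𝕜) := E.toSubmodule.subtype

/-- An element of `L⁰(μ)` belonging to the underlying subspace, as an element of `E`. -/
def elem (E : BanachFunctionSpace 𝕜 μ) (f : Ω →ₘ[μ] 𝕜) (hf : f ∈ E.toSubmodule) : E := ⟨f, hf⟩

lemma normFun_zero (E : BanachFunctionSpace 𝕜 μ) : E.normFun 0 = 0 := by
  simpa using E.normFun_smul 0 0

lemma normFun_neg (E : BanachFunctionSpace 𝕜 μ) (f : E.toSubmodule) :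
    E.normFun (-f) = E.normFun f := by
  have h := E.normFun_smul (-1) f
  have e : (-1 : 𝕜) • f = -f := neg_one_smul 𝕜 f
  rwa [e, norm_neg, norm_one, one_mul] at h

instance (E : BanachFunctionSpace 𝕜 μ) : NormedAddCommGroup E :=
  AddGroupNorm.toNormedAddCommGroup
    { toFun := E.normFun
      map_zero' := E.normFun_zero
      add_le' := E.normFun_add_le
      neg' := E.normFun_neg
      eq_zero_of_map_eq_zero' := E.eq_zero_of_normFun }

lemma norm_def (E : BanachFunctionSpace 𝕜 μ) (f : E) : ‖f‖ = E.normFun f := rfl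

instance (E : BanachFunctionSpace 𝕜 μ) : NormedSpace 𝕜 E where
  norm_smul_le c f := (E.normFun_smul c f).le

/-- The Fatou property. -/
def FatouProperty (E : BanachFunctionSpace 𝕜 μ) : Prop :=
  ∀ f : ℕ → E,
    (∀ n, ∀ᵐ ω ∂μ, E.toL0 (f n) ω = ((‖E.toL0 (f n) ω‖ : ℝ) : 𝕜)) →
    (∀ n, ∀ᵐ ω ∂μ, ‖E.toL0 (f n) ω‖ ≤ ‖E.toL0 (f (n + 1)) ω‖) →
    BddAbove (Set.range fun n => ‖f n‖) →
    ∃ g : E, (∀ᵐ ω ∂μ, Tendsto (fun n => E.toL0 (f n) ω) atTop (𝓝 (E.toL0 g ω))) ∧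
      ‖g‖ = ⨆ n, ‖f n‖

/-- Absolute continuity of the norm: if `f ∈ E` and `A n` is a decreasing sequence of measurable
sets whose indicators tend to `0` almost everywhere, then `‖f 1_{A n}‖ → 0`. -/
def AbsolutelyContinuousNorm (E : BanachFunctionSpace 𝕜 μ) : Prop :=
  ∀ (f : E) (A : ℕ → Set Ω), (∀ n, MeasurableSet (A n)) → Antitone A →
    (∀ᵐ ω ∂μ, Tendsto (fun n => (A n).indicator (fun _ => (1 : ℝ)) ω) atTop (𝓝 0)) →
    ∀ h : ℕ → E, (∀ n, E.toL0 (h n) =ᵐ[μ] (A n).indicator (E.toL0 f)) →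
      Tendsto (fun n => ‖h n‖) atTop (𝓝 0)

end BanachFunctionSpace

/-! ### Extended function norms -/

/-- A solid seminorm on `L⁰(μ)` with values in `[0, ∞]`. -/
structure FunctionNorm (𝕜 : Type*) [RCLike 𝕜] {Ω : Type*} [MeasurableSpace Ω]
    (μ : Measure Ω) where
  toFun : (Ω →ₘ[μ] 𝕜) → ℝ≥0∞
  add_le : ∀ f g, toFun (f + g) ≤ toFun f + toFun g
  smul_le : ∀ (c : 𝕜) f, toFun (c • f) ≤ ‖c‖ₑ * toFun f
  mono : ∀ f g : Ω →ₘ[μ] 𝕜, (∀ᵐ ω ∂μ, ‖f ω‖ ≤ ‖g ω‖) → toFun f ≤ toFun g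

section FunctionNorm

variable {𝕜 : Type*} [RCLike 𝕜] {Ω : Type*} [MeasurableSpace Ω] {μ : Measure Ω}

open Classical in
/-- The norm of a Banach function space `E`, extended by `∞` outside `E`. -/
def BanachFunctionSpace.functionNorm (E : BanachFunctionSpace 𝕜 μ) : FunctionNorm 𝕜 μ where
  toFun f := if h : f ∈ E.toSubmodule then ‖E.elem f h‖ₑ else ∞
  add_le f g := by
    by_cases hf : f ∈ E.toSubmodule
    · by_cases hg : g ∈ E.toSubmodule
      · have := E.toSubmodule.add_mem hf hg
        simp only [hf, hg, this, dite_true]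
        exact enorm_add_le (E.elem f hf) (E.elem g hg)
      · simp [hg]
    · simp [hf]
  smul_le c f := by
    by_cases hf : f ∈ E.toSubmodule
    · have := E.toSubmodule.smul_mem c hf
      simp only [hf, this, dite_true]
      exact (enorm_smul c (E.elem f hf)).le
    · by_cases hc : c = 0
      · subst hc
        have e : (0 : 𝕜) • f = 0 := zero_smul 𝕜 f
        simp only [e, E.toSubmodule.zero_mem, dite_true]
        have : E.elem 0 E.toSubmodule.zero_mem = 0 := rfl
        rw [this]; simp
      · simp [hf, hc, ENNReal.mul_top]
  mono f g hfg := by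
    by_cases hg : g ∈ E.toSubmodule
    · obtain ⟨hf, hle⟩ := E.solid ⟨g, hg⟩ f hfg
      simp only [hf, hg, dite_true]
      exact (enorm_le_iff_norm_le (x := E.elem f hf) (y := E.elem g hg)).2 hle
    · simp [hg]

/-- The norm of the Köthe dual `E'`,
`‖g‖_{E'} = sup {∫ |f g| dμ : f ∈ E, ‖f‖ ≤ 1}`, on all of `L⁰(μ)`. -/
def BanachFunctionSpace.koetheNorm (E : BanachFunctionSpace 𝕜 μ) : FunctionNorm 𝕜 μ where
  toFun g := ⨆ (f : E) (_ : ‖f‖ ≤ 1), ∫⁻ ω, ‖E.toL0 f ω * g ω‖ₑ ∂μ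
  add_le g₁ g₂ := by
    refine iSup₂_le fun f hf => ?_
    calc ∫⁻ ω, ‖E.toL0 f ω * (g₁ + g₂) ω‖ₑ ∂μ
        ≤ ∫⁻ ω, (‖E.toL0 f ω * g₁ ω‖ₑ + ‖E.toL0 f ω * g₂ ω‖ₑ) ∂μ := by
          refine lintegral_mono_ae ?_
          filter_upwards [AEEqFun.coeFn_add g₁ g₂] with ω h
          rw [h, Pi.add_apply, mul_add]
          exact enorm_add_le _ _
      _ = ∫⁻ ω, ‖E.toL0 f ω * g₁ ω‖ₑ ∂μ + ∫⁻ ω, ‖E.toL0 f ω * g₂ ω‖ₑ ∂μ :=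
          lintegral_add_left'
            ((E.toL0 f).aestronglyMeasurable.mul g₁.aestronglyMeasurable).enorm _
      _ ≤ _ := add_le_add
          (le_iSup₂ (f := fun (f : E) (_ : ‖f‖ ≤ 1) => ∫⁻ ω, ‖E.toL0 f ω * g₁ ω‖ₑ ∂μ) f hf)
          (le_iSup₂ (f := fun (f : E) (_ : ‖f‖ ≤ 1) => ∫⁻ ω, ‖E.toL0 f ω * g₂ ω‖ₑ ∂μ) f hf)
  smul_le c g := by
    refine iSup₂_le fun f hf => ?_
    calc ∫⁻ ω, ‖E.toL0 f ω * (c • g) ω‖ₑ ∂μ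
        = ∫⁻ ω, ‖c‖ₑ * ‖E.toL0 f ω * g ω‖ₑ ∂μ := by
          refine lintegral_congr_ae ?_
          filter_upwards [AEEqFun.coeFn_smul c g] with ω h
          rw [h, Pi.smul_apply, smul_eq_mul, enorm_mul, enorm_mul, enorm_mul]
          ring
      _ = ‖c‖ₑ * ∫⁻ ω, ‖E.toL0 f ω * g ω‖ₑ ∂μ :=
          lintegral_const_mul' _ _ enorm_ne_top
      _ ≤ _ := by
          gcongr
          exact le_iSup₂ (f := fun (f : E) (_ : ‖f‖ ≤ 1) => ∫⁻ ω, ‖E.toL0 f ω * g ω‖ₑ ∂μ) f hf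
  mono g₁ g₂ h := by
    refine iSup₂_mono fun f _ => lintegral_mono_ae ?_
    filter_upwards [h] with ω hω
    rw [enorm_mul, enorm_mul]
    gcongr
    exact enorm_le_iff_norm_le.2 hω

/-- The pointwise `ℓ^q(ℤ)`-norm of a sequence of functions (a supremum if `q = ∞`). -/
def lqFun (q : ℝ≥0∞) (F : ℤ → Ω →ₘ[μ] 𝕜) (ω : Ω) : ℝ≥0∞ :=
  eLpNorm (fun j : ℤ => F j ω) q Measure.count

/-- The norm of a sequence `F` in `E(ℓ^q(ℤ))`, that is, the norm of
`ω ↦ (∑ j, |F j ω| ^ q) ^ (1 / q)`; it is `∞` if this function is not in `L⁰(μ)`. -/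
def FunctionNorm.mixed (ρ : FunctionNorm 𝕜 μ) (q : ℝ≥0∞) (F : ℤ → Ω →ₘ[μ] 𝕜) : ℝ≥0∞ :=
  ⨅ (h : Ω →ₘ[μ] 𝕜) (_ : ∀ᵐ ω ∂μ, ‖h ω‖ₑ = lqFun q F ω), ρ.toFun h

lemma aemeasurable_lqFun (q : ℝ≥0∞) (F : ℤ → Ω →ₘ[μ] 𝕜) : AEMeasurable (lqFun q F) μ := by
  have hF : ∀ j, AEMeasurable (fun ω => ‖F j ω‖ₑ) μ :=
    fun j => (F j).aestronglyMeasurable.enorm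
  unfold lqFun
  rcases eq_or_ne q 0 with rfl | hq0
  · simp
  rcases eq_or_ne q ∞ with rfl | hq
  · have : (fun ω => eLpNorm (fun j : ℤ => F j ω) ∞ Measure.count) =
        fun ω => ⨆ j : ℤ, ‖F j ω‖ₑ := by
      funext ω
      simp [eLpNorm_exponent_top, eLpNormEssSup_eq_essSup_enorm]
    rw [this]
    exact AEMeasurable.iSup hF
  · simp only [eLpNorm_eq_lintegral_rpow_enorm_toReal hq0 hq, lintegral_count]
    exact (AEMeasurable.tsum fun j => (hF j).pow_const _).pow_const _

/-- A function in `L⁰(μ)` with prescribed modulus. -/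
lemma exists_enorm_eq {u : Ω → ℝ≥0∞} (hu : AEMeasurable u μ) (hfin : ∀ᵐ ω ∂μ, u ω ≠ ∞) :
    ∃ h : Ω →ₘ[μ] 𝕜, ∀ᵐ ω ∂μ, ‖h ω‖ₑ = u ω := by
  have hm : AEStronglyMeasurable (fun ω => (((u ω).toReal : ℝ) : 𝕜)) μ :=
    (RCLike.continuous_ofReal.comp_aestronglyMeasurable hu.ennreal_toReal.aestronglyMeasurable)
  refine ⟨AEEqFun.mk _ hm, ?_⟩
  filter_upwards [AEEqFun.coeFn_mk _ hm, hfin] with ω h1 h2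
  rw [h1, ← ofReal_norm, RCLike.norm_ofReal, abs_of_nonneg ENNReal.toReal_nonneg,
    ENNReal.ofReal_toReal h2]

lemma FunctionNorm.mixed_add_le (ρ : FunctionNorm 𝕜 μ) {q : ℝ≥0∞} (hq : 1 ≤ q)
    (F G : ℤ → Ω →ₘ[μ] 𝕜) : ρ.mixed q (F + G) ≤ ρ.mixed q F + ρ.mixed q G := by
  simp only [FunctionNorm.mixed, ENNReal.iInf_add, ENNReal.add_iInf]
  refine le_iInf₂ fun h₂ hh₂ => le_iInf₂ fun h₁ hh₁ => ?_
  have hle : ∀ᵐ ω ∂μ, lqFun q (F + G) ω ≤ ‖h₁ ω‖ₑ + ‖h₂ ω‖ₑ := by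
    have hadd : ∀ᵐ ω ∂μ, ∀ j, (F j + G j : Ω →ₘ[μ] 𝕜) ω = F j ω + G j ω := by
      rw [ae_all_iff]
      intro j
      filter_upwards [AEEqFun.coeFn_add (F j) (G j)] with ω h
      simpa using h
    filter_upwards [hadd, hh₁, hh₂] with ω h e₁ e₂
    rw [e₁, e₂]
    have : (fun j : ℤ => (F + G) j ω) = (fun j => F j ω) + fun j => G j ω := by
      funext j
      exact h j
    unfold lqFun
    rw [this]
    exact eLpNorm_add_le (measurable_of_countable _).aestronglyMeasurable
      (measurable_of_countable _).aestronglyMeasurable hq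
  obtain ⟨k₁, hk₁⟩ := exists_enorm_eq (𝕜 := 𝕜) (μ := μ) h₁.aestronglyMeasurable.enorm
    (Eventually.of_forall fun _ => enorm_ne_top)
  obtain ⟨h, hh⟩ := exists_enorm_eq (𝕜 := 𝕜) (aemeasurable_lqFun q (F + G))
    (hle.mono fun ω hω => (lt_of_le_of_lt hω
      (ENNReal.add_lt_top.2 ⟨enorm_lt_top, enorm_lt_top⟩)).ne)
  have hmk : AEStronglyMeasurable (fun ω => ((‖h₁ ω‖ : ℝ) : 𝕜)) μ :=
    RCLike.continuous_ofReal.comp_aestronglyMeasurable h₁.aestronglyMeasurable.norm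
  have hmk' : AEStronglyMeasurable (fun ω => ((‖h₂ ω‖ : ℝ) : 𝕜)) μ :=
    RCLike.continuous_ofReal.comp_aestronglyMeasurable h₂.aestronglyMeasurable.norm
  calc _ ≤ ρ.toFun h := iInf₂_le h hh
    _ ≤ ρ.toFun (AEEqFun.mk _ hmk + AEEqFun.mk _ hmk') := by
        refine ρ.mono _ _ ?_
        filter_upwards [hh, hle, AEEqFun.coeFn_add (AEEqFun.mk _ hmk) (AEEqFun.mk _ hmk'),
          AEEqFun.coeFn_mk _ hmk, AEEqFun.coeFn_mk _ hmk'] with ω a b c d e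
        rw [c, Pi.add_apply, d, e, ← RCLike.ofReal_add, RCLike.norm_ofReal,
          abs_of_nonneg (by positivity)]
        rw [← a] at b
        have := ENNReal.toReal_mono (ENNReal.add_lt_top.2 ⟨enorm_lt_top, enorm_lt_top⟩).ne b
        rwa [ENNReal.toReal_add enorm_ne_top enorm_ne_top, toReal_enorm, toReal_enorm,
          toReal_enorm] at this
    _ ≤ ρ.toFun (AEEqFun.mk _ hmk) + ρ.toFun (AEEqFun.mk _ hmk') := ρ.add_le _ _
    _ ≤ ρ.toFun h₁ + ρ.toFun h₂ := by
        refine add_le_add (ρ.mono _ _ ?_) (ρ.mono _ _ ?_)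
        · filter_upwards [AEEqFun.coeFn_mk _ hmk] with ω a
          simp [a]
        · filter_upwards [AEEqFun.coeFn_mk _ hmk'] with ω a
          simp [a]

lemma FunctionNorm.mixed_smul_le (ρ : FunctionNorm 𝕜 μ) (q : ℝ≥0∞) (c : 𝕜)
    (F : ℤ → Ω →ₘ[μ] 𝕜) : ρ.mixed q (c • F) ≤ ‖c‖ₑ * ρ.mixed q F := by
  by_cases hc : c = 0
  · subst hc
    have h0 : ρ.toFun 0 = 0 := by
      have h := ρ.smul_le 0 0
      have e : (0 : 𝕜) • (0 : Ω →ₘ[μ] 𝕜) = 0 := zero_smul 𝕜 (0 : Ω →ₘ[μ] 𝕜)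
      rw [e] at h
      simpa using h
    refine (iInf₂_le (0 : Ω →ₘ[μ] 𝕜) ?_).trans (by simp [h0])
    filter_upwards [AEEqFun.coeFn_zero (β := 𝕜) (μ := μ) (α := Ω)] with ω hω
    have : ∀ j, ((0 : 𝕜) • F) j = 0 := fun j => zero_smul 𝕜 (F j)
    simp only [lqFun, this, hω]
    simp
  · have hc' : ‖c‖ₑ ≠ 0 := by simpa using hc
    simp only [FunctionNorm.mixed, ENNReal.mul_iInf_of_ne hc' enorm_ne_top]
    refine le_iInf₂ fun h hh => (iInf₂_le (c • h) ?_).trans (ρ.smul_le c h)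
    have hsm : ∀ᵐ ω ∂μ, ∀ j, (c • F j : Ω →ₘ[μ] 𝕜) ω = c • F j ω := by
      rw [ae_all_iff]
      intro j
      filter_upwards [AEEqFun.coeFn_smul c (F j)] with ω h
      simpa using h
    filter_upwards [hh, hsm, AEEqFun.coeFn_smul c h] with ω a b d
    have : (fun j : ℤ => (c • F) j ω) = c • fun j => F j ω := by
      funext j
      exact b j
    unfold lqFun at a ⊢
    rw [d, Pi.smul_apply, enorm_smul, a, this, eLpNorm_const_smul]

lemma smul_seq_add (a : ℤ → 𝕜) (F G : ℤ → Ω →ₘ[μ] 𝕜) :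
    (fun j => a j • (F + G) j) = (fun j => a j • F j) + fun j => a j • G j :=
  funext fun j => smul_add (a j) (F j) (G j)

end FunctionNorm

/-! ### Structured spaces and `ℓ^q`-interpolation -/

/-- The data `(X, J, E)` of a structured space, where `E` is given by its extended norm and the
embedding `J : X → E ⊆ L⁰(μ)` is given by its graph. -/
structure StructuredSpace (𝕜 : Type*) [RCLike 𝕜] (X : Type*) [AddCommGroup X] [Module 𝕜 X]
    {Ω : Type*} [MeasurableSpace Ω] (μ : Measure Ω) where
  graph : Submodule 𝕜 (X × (Ω →ₘ[μ] 𝕜))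
  fnorm : FunctionNorm 𝕜 μ

section Structured

variable {𝕜 : Type*} [RCLike 𝕜] {Ω : Type*} [MeasurableSpace Ω] {μ : Measure Ω}
  {X : Type*} [NormedAddCommGroup X] [NormedSpace 𝕜 X]

/-- The structured space `(X, J, E)` for an isometric surjection `J : X → E`. -/
def structured (E : BanachFunctionSpace 𝕜 μ) (J : X ≃ₗᵢ[𝕜] E) : StructuredSpace 𝕜 X μ where
  graph := (E.toL0 ∘ₗ J.toLinearEquiv.toLinearMap).graph
  fnorm := E.functionNorm

/-- The dual structured space `(X', (J⁻¹)', E')`. Here `E'` is the Köthe dual of `E`, and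
`(J⁻¹)' φ = φ ∘ J⁻¹` is identified with the function `g` such that
`φ (J⁻¹ f) = ∫ f g dμ` for all `f ∈ E`. -/
def dualStructured (E : BanachFunctionSpace 𝕜 μ) (J : X ≃ₗᵢ[𝕜] E) :
    StructuredSpace 𝕜 (StrongDual 𝕜 X) μ where
  graph :=
    { carrier := {p | ∀ f : E, Integrable (fun ω => E.toL0 f ω * p.2 ω) μ ∧
        p.1 (J.symm f) = ∫ ω, E.toL0 f ω * p.2 ω ∂μ}
      zero_mem' := by
        intro f
        have h : (fun ω => E.toL0 f ω * (0 : Ω →ₘ[μ] 𝕜) ω) =ᵐ[μ] fun _ => (0 : 𝕜) := by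
          filter_upwards [AEEqFun.coeFn_zero (β := 𝕜) (μ := μ) (α := Ω)] with ω hω
          simp [hω]
        refine ⟨(integrable_congr h).2 (integrable_zero _ _ _), ?_⟩
        simp only [Prod.fst_zero, Prod.snd_zero]
        rw [integral_congr_ae h]
        simp
      add_mem' := by
        intro p r hp hr f
        have h : (fun ω => E.toL0 f ω * (p + r).2 ω) =ᵐ[μ]
            fun ω => E.toL0 f ω * p.2 ω + E.toL0 f ω * r.2 ω := by
          filter_upwards [AEEqFun.coeFn_add p.2 r.2] with ω hω
          rw [Prod.snd_add, hω, Pi.add_apply, mul_add]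
        refine ⟨(integrable_congr h).2 ((hp f).1.add (hr f).1), ?_⟩
        rw [integral_congr_ae h, integral_add (hp f).1 (hr f).1, ← (hp f).2, ← (hr f).2]
        rfl
      smul_mem' := by
        intro c p hp f
        have h : (fun ω => E.toL0 f ω * (c • p).2 ω) =ᵐ[μ]
            fun ω => c * (E.toL0 f ω * p.2 ω) := by
          filter_upwards [AEEqFun.coeFn_smul c p.2] with ω hω
          rw [Prod.smul_snd, hω, Pi.smul_apply, smul_eq_mul]
          ring
        refine ⟨(integrable_congr h).2 ((hp f).1.const_mul c), ?_⟩
        rw [integral_congr_ae h, integral_const_mul, ← (hp f).2]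
        rfl }
  fnorm := E.koetheNorm

end Structured

section Interpolation

variable {𝕜 : Type*} [RCLike 𝕜] {Ω₀ Ω₁ : Type*} [MeasurableSpace Ω₀] [MeasurableSpace Ω₁]
  {μ₀ : Measure Ω₀} {μ₁ : Measure Ω₁}
  {X₀ X₁ V : Type*} [AddCommGroup X₀] [Module 𝕜 X₀] [AddCommGroup X₁] [Module 𝕜 X₁]
  [AddCommGroup V] [Module 𝕜 V]

/-- A family of decompositions `v = x₀ j + x₁ j`, `j ∈ ℤ`, with `x_ν j ∈ X_ν`, together with the
images `y_ν j = J_ν (x_ν j)`. -/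
structure Decomposition (S₀ : StructuredSpace 𝕜 X₀ μ₀) (S₁ : StructuredSpace 𝕜 X₁ μ₁)
    (ι₀ : X₀ →ₗ[𝕜] V) (ι₁ : X₁ →ₗ[𝕜] V) (v : V) where
  x₀ : ℤ → X₀
  x₁ : ℤ → X₁
  y₀ : ℤ → Ω₀ →ₘ[μ₀] 𝕜
  y₁ : ℤ → Ω₁ →ₘ[μ₁] 𝕜
  sum_eq : ∀ j, ι₀ (x₀ j) + ι₁ (x₁ j) = v
  mem₀ : ∀ j, (x₀ j, y₀ j) ∈ S₀.graph
  mem₁ : ∀ j, (x₁ j, y₁ j) ∈ S₁.graph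

variable (S₀ : StructuredSpace 𝕜 X₀ μ₀) (S₁ : StructuredSpace 𝕜 X₁ μ₁)
  (ι₀ : X₀ →ₗ[𝕜] V) (ι₁ : X₁ →ₗ[𝕜] V) (θ : ℝ) (q : ℝ≥0∞)

/-- The norm of `v` in `(𝒳₀, 𝒳₁)_{θ, ℓ^q}`: the infimum over all decompositions
`v = x₀ j + x₁ j`, `j ∈ ℤ`, of
`‖(2 ^ (-θ j) J₀ (x₀ j))_j‖_{E₀(ℓ^q)} + ‖(2 ^ ((1 - θ) j) J₁ (x₁ j))_j‖_{E₁(ℓ^q)}`. -/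
def lqENorm (v : V) : ℝ≥0∞ :=
  ⨅ d : Decomposition S₀ S₁ ι₀ ι₁ v,
    S₀.fnorm.mixed q (fun j => (((2 : ℝ) ^ (-θ * j) : ℝ) : 𝕜) • d.y₀ j) +
      S₁.fnorm.mixed q (fun j => (((2 : ℝ) ^ ((1 - θ) * j) : ℝ) : 𝕜) • d.y₁ j)

lemma lqENorm_add_le (hq : 1 ≤ q) (v w : V) : lqENorm S₀ S₁ ι₀ ι₁ θ q (v + w) ≤
    lqENorm S₀ S₁ ι₀ ι₁ θ q v + lqENorm S₀ S₁ ι₀ ι₁ θ q w := by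
  conv_rhs => unfold lqENorm
  simp only [ENNReal.iInf_add, ENNReal.add_iInf]
  refine le_iInf fun e => le_iInf fun d => ?_
  let s : Decomposition S₀ S₁ ι₀ ι₁ (v + w) :=
    { x₀ := d.x₀ + e.x₀
      x₁ := d.x₁ + e.x₁
      y₀ := d.y₀ + e.y₀
      y₁ := d.y₁ + e.y₁
      sum_eq := fun j => by
        have h := congrArg₂ (· + ·) (d.sum_eq j) (e.sum_eq j)
        simp only [Pi.add_apply, map_add] at h ⊢
        rw [← h]
        abel
      mem₀ := fun j => S₀.graph.add_mem (d.mem₀ j) (e.mem₀ j)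
      mem₁ := fun j => S₁.graph.add_mem (d.mem₁ j) (e.mem₁ j) }
  refine (iInf_le _ s).trans ?_
  have h₀ := S₀.fnorm.mixed_add_le hq (fun j => (((2 : ℝ) ^ (-θ * j) : ℝ) : 𝕜) • d.y₀ j)
    (fun j => (((2 : ℝ) ^ (-θ * j) : ℝ) : 𝕜) • e.y₀ j)
  have h₁ := S₁.fnorm.mixed_add_le hq (fun j => (((2 : ℝ) ^ ((1 - θ) * j) : ℝ) : 𝕜) • d.y₁ j)
    (fun j => (((2 : ℝ) ^ ((1 - θ) * j) : ℝ) : 𝕜) • e.y₁ j)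
  rw [← smul_seq_add] at h₀
  rw [← smul_seq_add] at h₁
  calc _ ≤ _ := add_le_add h₀ h₁
    _ = _ := add_add_add_comm _ _ _ _

lemma lqENorm_zero : lqENorm S₀ S₁ ι₀ ι₁ θ q 0 = 0 := by
  let s : Decomposition S₀ S₁ ι₀ ι₁ (0 : V) :=
    { x₀ := 0
      x₁ := 0
      y₀ := 0
      y₁ := 0
      sum_eq := fun j => by simp
      mem₀ := fun j => S₀.graph.zero_mem
      mem₁ := fun j => S₁.graph.zero_mem }
  refine le_antisymm ((iInf_le _ s).trans ?_) bot_le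
  have z₀ : ∀ a : 𝕜, a • (0 : Ω₀ →ₘ[μ₀] 𝕜) = 0 :=
    fun a => @smul_zero 𝕜 (Ω₀ →ₘ[μ₀] 𝕜) _ _ a
  have z₁ : ∀ a : 𝕜, a • (0 : Ω₁ →ₘ[μ₁] 𝕜) = 0 :=
    fun a => @smul_zero 𝕜 (Ω₁ →ₘ[μ₁] 𝕜) _ _ a
  have e₀ : (fun j : ℤ => (((2 : ℝ) ^ (-θ * j) : ℝ) : 𝕜) • s.y₀ j) =
      (0 : 𝕜) • (0 : ℤ → Ω₀ →ₘ[μ₀] 𝕜) :=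
    funext fun j => (z₀ _).trans (z₀ 0).symm
  have e₁ : (fun j : ℤ => (((2 : ℝ) ^ ((1 - θ) * j) : ℝ) : 𝕜) • s.y₁ j) =
      (0 : 𝕜) • (0 : ℤ → Ω₁ →ₘ[μ₁] 𝕜) :=
    funext fun j => (z₁ _).trans (z₁ 0).symm
  rw [e₀, e₁]
  refine (add_le_add (S₀.fnorm.mixed_smul_le q 0 0) (S₁.fnorm.mixed_smul_le q 0 0)).trans ?_
  simp

lemma lqENorm_smul_le (c : 𝕜) (v : V) : lqENorm S₀ S₁ ι₀ ι₁ θ q (c • v) ≤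
    ‖c‖ₑ * lqENorm S₀ S₁ ι₀ ι₁ θ q v := by
  by_cases hc : c = 0
  · subst hc
    rw [zero_smul, lqENorm_zero]
    exact bot_le
  have hc' : ‖c‖ₑ ≠ 0 := by simpa using hc
  conv_rhs => unfold lqENorm
  rw [ENNReal.mul_iInf_of_ne hc' enorm_ne_top]
  refine le_iInf fun d => ?_
  let s : Decomposition S₀ S₁ ι₀ ι₁ (c • v) :=
    { x₀ := c • d.x₀
      x₁ := c • d.x₁
      y₀ := c • d.y₀
      y₁ := c • d.y₁
      sum_eq := fun j => by
        have h := congrArg (c • ·) (d.sum_eq j)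
        simpa only [Pi.smul_apply, map_smul, smul_add] using h
      mem₀ := fun j => S₀.graph.smul_mem c (d.mem₀ j)
      mem₁ := fun j => S₁.graph.smul_mem c (d.mem₁ j) }
  refine (iInf_le _ s).trans ?_
  have e₀ : (fun j : ℤ => (((2 : ℝ) ^ (-θ * j) : ℝ) : 𝕜) • s.y₀ j) =
      c • fun j : ℤ => (((2 : ℝ) ^ (-θ * j) : ℝ) : 𝕜) • d.y₀ j :=
    funext fun j => smul_comm _ c (d.y₀ j)
  have e₁ : (fun j : ℤ => (((2 : ℝ) ^ ((1 - θ) * j) : ℝ) : 𝕜) • s.y₁ j) =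
      c • fun j : ℤ => (((2 : ℝ) ^ ((1 - θ) * j) : ℝ) : 𝕜) • d.y₁ j :=
    funext fun j => smul_comm _ c (d.y₁ j)
  rw [e₀, e₁, mul_add]
  exact add_le_add (S₀.fnorm.mixed_smul_le q c _) (S₁.fnorm.mixed_smul_le q c _)

/-- The set of all `v` with finite norm in `(𝒳₀, 𝒳₁)_{θ, ℓ^q}`. -/
def lqSubmodule [hq : Fact (1 ≤ q)] : Submodule 𝕜 V where
  carrier := {v | lqENorm S₀ S₁ ι₀ ι₁ θ q v < ∞}
  zero_mem' := by simp [lqENorm_zero]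
  add_mem' := fun hv hw =>
    (lqENorm_add_le S₀ S₁ ι₀ ι₁ θ q hq.out _ _).trans_lt (ENNReal.add_lt_top.2 ⟨hv, hw⟩)
  smul_mem' := fun c _ hv =>
    (lqENorm_smul_le S₀ S₁ ι₀ ι₁ θ q c _).trans_lt (ENNReal.mul_lt_top enorm_lt_top hv)

/-- The `ℓ^q`-interpolation space `(𝒳₀, 𝒳₁)_{θ, ℓ^q}`, normed by `lqENorm` (and not by any norm
that the ambient space `V` may carry). -/
def LqInterp [Fact (1 ≤ q)] : Type _ := lqSubmodule S₀ S₁ ι₀ ι₁ θ q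

namespace LqInterp

variable [hq : Fact (1 ≤ q)]

instance : AddCommGroup (LqInterp S₀ S₁ ι₀ ι₁ θ q) :=
  inferInstanceAs (AddCommGroup (lqSubmodule S₀ S₁ ι₀ ι₁ θ q))

instance : Module 𝕜 (LqInterp S₀ S₁ ι₀ ι₁ θ q) :=
  inferInstanceAs (Module 𝕜 (lqSubmodule S₀ S₁ ι₀ ι₁ θ q))

/-- The inclusion of the interpolation space into the ambient space. -/
def incl : LqInterp S₀ S₁ ι₀ ι₁ θ q →ₗ[𝕜] V := (lqSubmodule S₀ S₁ ι₀ ι₁ θ q).subtype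

variable {S₀ S₁ ι₀ ι₁ θ q} in
lemma lqENorm_incl_ne_top (v : LqInterp S₀ S₁ ι₀ ι₁ θ q) :
    lqENorm S₀ S₁ ι₀ ι₁ θ q (incl S₀ S₁ ι₀ ι₁ θ q v) ≠ ∞ :=
  (show lqENorm S₀ S₁ ι₀ ι₁ θ q (incl S₀ S₁ ι₀ ι₁ θ q v) < ∞ from v.2).ne

instance : SeminormedAddCommGroup (LqInterp S₀ S₁ ι₀ ι₁ θ q) :=
  AddGroupSeminorm.toSeminormedAddCommGroup
    { toFun := fun v => (lqENorm S₀ S₁ ι₀ ι₁ θ q (incl S₀ S₁ ι₀ ι₁ θ q v)).toReal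
      map_zero' := by rw [map_zero, lqENorm_zero]; rfl
      add_le' := fun v w => by
        rw [map_add, ← ENNReal.toReal_add (lqENorm_incl_ne_top v) (lqENorm_incl_ne_top w)]
        exact ENNReal.toReal_mono
          (ENNReal.add_ne_top.2 ⟨lqENorm_incl_ne_top v, lqENorm_incl_ne_top w⟩)
          (lqENorm_add_le S₀ S₁ ι₀ ι₁ θ q hq.out _ _)
      neg' := fun v => by
        have h : ∀ w : V, lqENorm S₀ S₁ ι₀ ι₁ θ q (-w) ≤ lqENorm S₀ S₁ ι₀ ι₁ θ q w := fun w => by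
          have := lqENorm_smul_le S₀ S₁ ι₀ ι₁ θ q (-1) w
          rwa [neg_one_smul, enorm_neg, enorm_one, one_mul] at this
        rw [map_neg]
        congr 1
        refine le_antisymm (h _) ?_
        simpa using h (-(incl S₀ S₁ ι₀ ι₁ θ q v)) }

lemma norm_def (v : LqInterp S₀ S₁ ι₀ ι₁ θ q) :
    ‖v‖ = (lqENorm S₀ S₁ ι₀ ι₁ θ q (incl S₀ S₁ ι₀ ι₁ θ q v)).toReal := rfl

instance : NormedSpace 𝕜 (LqInterp S₀ S₁ ι₀ ι₁ θ q) where
  norm_smul_le c v := by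
    rw [norm_def, norm_def, map_smul, ← toReal_enorm c, ← ENNReal.toReal_mul]
    exact ENNReal.toReal_mono (ENNReal.mul_ne_top enorm_ne_top (lqENorm_incl_ne_top v))
      (lqENorm_smul_le S₀ S₁ ι₀ ι₁ θ q c _)

end LqInterp

end Interpolation

/-! ### The intersection of a couple and the dual couple -/

section Couple

variable {𝕜 : Type*} [RCLike 𝕜] {X₀ X₁ V : Type*}
  [NormedAddCommGroup X₀] [NormedSpace 𝕜 X₀] [NormedAddCommGroup X₁] [NormedSpace 𝕜 X₁]
  [AddCommGroup V] [Module 𝕜 V]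

/-- The intersection `X₀ ∩ X₁` of two spaces embedded in `V`, as the space of pairs `(x₀, x₁)`
that have the same image in `V`; it carries the norm `max ‖x‖_{X₀} ‖x‖_{X₁}`. -/
def inter (ι₀ : X₀ →ₗ[𝕜] V) (ι₁ : X₁ →ₗ[𝕜] V) : Submodule 𝕜 (X₀ × X₁) :=
  LinearMap.eqLocus (ι₀ ∘ₗ LinearMap.fst 𝕜 X₀ X₁) (ι₁ ∘ₗ LinearMap.snd 𝕜 X₀ X₁)

/-- The restriction map `X₀' → (X₀ ∩ X₁)'`. -/
def restrict₀ (ι₀ : X₀ →ₗ[𝕜] V) (ι₁ : X₁ →ₗ[𝕜] V) :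
    StrongDual 𝕜 X₀ →ₗ[𝕜] StrongDual 𝕜 (inter ι₀ ι₁) where
  toFun φ := φ.comp ((ContinuousLinearMap.fst 𝕜 X₀ X₁).comp (inter ι₀ ι₁).subtypeL)
  map_add' _ _ := rfl
  map_smul' _ _ := rfl

/-- The restriction map `X₁' → (X₀ ∩ X₁)'`. -/
def restrict₁ (ι₀ : X₀ →ₗ[𝕜] V) (ι₁ : X₁ →ₗ[𝕜] V) :
    StrongDual 𝕜 X₁ →ₗ[𝕜] StrongDual 𝕜 (inter ι₀ ι₁) where
  toFun φ := φ.comp ((ContinuousLinearMap.snd 𝕜 X₀ X₁).comp (inter ι₀ ι₁).subtypeL)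
  map_add' _ _ := rfl
  map_smul' _ _ := rfl

end Couple

section Dual

variable {𝕜 : Type*} [RCLike 𝕜] {Ω₀ Ω₁ : Type*} [MeasurableSpace Ω₀] [MeasurableSpace Ω₁]
  {μ₀ : Measure Ω₀} {μ₁ : Measure Ω₁} {X₀ X₁ V : Type*}
  [NormedAddCommGroup X₀] [NormedSpace 𝕜 X₀] [NormedAddCommGroup X₁] [NormedSpace 𝕜 X₁]
  [AddCommGroup V] [Module 𝕜 V]

/-- The space `(𝒳₀, 𝒳₁)_{θ, ℓ^q}` for `𝒳_ν = (X_ν, J_ν, E_ν)`. -/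
abbrev InterpSpace {E₀ : BanachFunctionSpace 𝕜 μ₀} {E₁ : BanachFunctionSpace 𝕜 μ₁}
    (J₀ : X₀ ≃ₗᵢ[𝕜] E₀) (J₁ : X₁ ≃ₗᵢ[𝕜] E₁) (ι₀ : X₀ →ₗ[𝕜] V) (ι₁ : X₁ →ₗ[𝕜] V)
    (θ : ℝ) (q : ℝ≥0∞) [Fact (1 ≤ q)] : Type _ :=
  LqInterp (structured E₀ J₀) (structured E₁ J₁) ι₀ ι₁ θ q

/-- The space `(𝒳₀', 𝒳₁')_{θ, ℓ^q}`, formed inside `(X₀ ∩ X₁)'`, for `𝒳_ν = (X_ν, J_ν, E_ν)`. -/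
abbrev DualInterpSpace {E₀ : BanachFunctionSpace 𝕜 μ₀} {E₁ : BanachFunctionSpace 𝕜 μ₁}
    (J₀ : X₀ ≃ₗᵢ[𝕜] E₀) (J₁ : X₁ ≃ₗᵢ[𝕜] E₁) (ι₀ : X₀ →ₗ[𝕜] V) (ι₁ : X₁ →ₗ[𝕜] V)
    (θ : ℝ) (q : ℝ≥0∞) [Fact (1 ≤ q)] : Type _ :=
  LqInterp (V := StrongDual 𝕜 (inter ι₀ ι₁)) (dualStructured E₀ J₀) (dualStructured E₁ J₁)
    (restrict₀ ι₀ ι₁) (restrict₁ ι₀ ι₁) θ q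

/-- The functional on `X₀ ∩ X₁` given by an element of `(𝒳₀', 𝒳₁')_{θ, ℓ^q}`. -/
def DualInterpSpace.functional {E₀ : BanachFunctionSpace 𝕜 μ₀} {E₁ : BanachFunctionSpace 𝕜 μ₁}
    {J₀ : X₀ ≃ₗᵢ[𝕜] E₀} {J₁ : X₁ ≃ₗᵢ[𝕜] E₁} {ι₀ : X₀ →ₗ[𝕜] V} {ι₁ : X₁ →ₗ[𝕜] V}
    {θ : ℝ} {q : ℝ≥0∞} [Fact (1 ≤ q)] (φ : DualInterpSpace J₀ J₁ ι₀ ι₁ θ q) :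
    StrongDual 𝕜 (inter ι₀ ι₁) :=
  LqInterp.incl (V := StrongDual 𝕜 (inter ι₀ ι₁)) (dualStructured E₀ J₀) (dualStructured E₁ J₁)
    (restrict₀ ι₀ ι₁) (restrict₁ ι₀ ι₁) θ q φ

end Dual

end LqInterpolation
end

/-!
The theorem is reduced to sequences of functionals. Put `a = 2 ^ (-θ)` and `b = 2 ^ (1 - θ)`, so
that `|a| < 1 < |b|` and the weights in the interpolation norm are `a ^ j` and `b ^ j`.

*The spaces `E(ℓ^q)`.* A Banach function space `E` with the Fatou property contains a function `w`
that vanishes almost nowhere. If the norm is absolutely continuous, then `A ↦ φ (w 1_A)` is a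
measure for every functional `φ` on `E`, and its density divided by `w` represents `φ`,
isometrically, in the Köthe dual (`dualStructured_graph`). A measurable choice of norming
sequences (`exists_norming`) shows that the norm of `E'(ℓ^{q'})` is the dual norm of `E(ℓ^q)`
(`isDualSequenceNorm_koetheNorm`), while `q < ∞` and absolute continuity make finitely supported
sequences dense in `E(ℓ^q)` (`isSequenceNorm_seqNorm`). The rest of the proof uses only the
properties collected in `IsSequenceNorm` and `IsDualSequenceNorm`.

*From functionals to decompositions* (`exists_dual_decomposition`). The interpolation space is a
quotient of the space of families of decompositions `x = x₀ j + x₁ j`, which is a subspace of a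
weighted space `E₀(ℓ^q) × E₁(ℓ^q)`. By Hahn–Banach and density, a functional `ℓ` on it has the
form `∑ j, (φ₀ j (x₀ j) + φ₁ j (x₁ j))`. Since `ℓ` vanishes on decompositions of `0`, the
functionals `φ₀ j` and `φ₁ j` agree on `X₀ ∩ X₁`, and on `X₀ ∩ X₁` the functional `ℓ` is
`∑ j, φ₀ j = ∑ j, φ₁ j`. Splitting this sum at `-k` gives decompositions `ℓ = ψ₀ k + ψ₁ k` with
`ψ₀ k = ∑ j ≥ -k, φ₀ j` and `ψ₁ k = ∑ j < -k, φ₁ j`. Both sums are convolutions of the weighted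
sequences with a geometric series, so that `ψ` has finite norm in the interpolation space of the
duals.

*From decompositions to functionals* (`exists_functional_of_dual_decomposition`). Conversely,
decompositions `φ = ψ₀ k + ψ₁ k` of a functional `φ` on `X₀ ∩ X₁` give back
`φ₀ j = ψ₀ (-j) - ψ₀ (-j - 1)` and `φ₁ j = ψ₁ (-j - 1) - ψ₁ (-j)`, and these agree on `X₀ ∩ X₁`
since `ψ₀ k + ψ₁ k` does not depend on `k`. Hence `∑ j, (φ₀ j (x₀ j) + φ₁ j (x₁ j))` depends on
`x` only, and by Hölder's inequality it is a bounded functional on the interpolation space.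
Summation by parts turns it into `∑ j, φ (x₀ j - x₀ (j - 1))` (`tsum_pairTerm_eq_tsum`), which is
`φ x` for the decompositions `splitAtZero` of `x ∈ X₀ ∩ X₁`. For the same reason a functional on
the interpolation space that vanishes on `X₀ ∩ X₁` is `0`. Both constructions are combined in
`exists_dual_equiv`.
-/

noncomputable section

namespace LqInterpolation

/-! ### Elements of a Banach function space -/

namespace BanachFunctionSpace

variable {𝕜 : Type*} [RCLike 𝕜] {Ω : Type*} [MeasurableSpace Ω] {μ : Measure Ω}
  {E : BanachFunctionSpace 𝕜 μ}

lemma ext_ae {f g : E} (h : E.toL0 f =ᵐ[μ] E.toL0 g) : f = g := Subtype.ext (AEEqFun.ext h)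

lemma toL0_add_ae (f g : E) : ∀ᵐ ω ∂μ, E.toL0 (f + g) ω = E.toL0 f ω + E.toL0 g ω := by
  rw [map_add]
  exact AEEqFun.coeFn_add _ _

lemma toL0_smul_ae (c : 𝕜) (f : E) : ∀ᵐ ω ∂μ, E.toL0 (c • f) ω = c * E.toL0 f ω := by
  rw [map_smul]
  exact AEEqFun.coeFn_smul _ _

lemma toL0_sub_ae (f g : E) : ∀ᵐ ω ∂μ, E.toL0 (f - g) ω = E.toL0 f ω - E.toL0 g ω := by
  rw [map_sub]
  exact AEEqFun.coeFn_sub _ _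

lemma toL0_zero_ae : ∀ᵐ ω ∂μ, E.toL0 0 ω = 0 := by
  rw [map_zero]
  exact AEEqFun.coeFn_zero

lemma exists_of_norm_le (f : E) {u : Ω → 𝕜} (hu : AEStronglyMeasurable u μ)
    (h : ∀ᵐ ω ∂μ, ‖u ω‖ ≤ ‖E.toL0 f ω‖) : ∃ g : E, E.toL0 g =ᵐ[μ] u ∧ ‖g‖ ≤ ‖f‖ := by
  obtain ⟨hg, hle⟩ := E.solid f (AEEqFun.mk u hu) (by
    filter_upwards [h, AEEqFun.coeFn_mk u hu] with ω h1 h2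
    rw [h2]
    exact h1)
  exact ⟨⟨_, hg⟩, AEEqFun.coeFn_mk u hu, hle⟩

lemma norm_mono {f g : E} (h : ∀ᵐ ω ∂μ, ‖E.toL0 g ω‖ ≤ ‖E.toL0 f ω‖) : ‖g‖ ≤ ‖f‖ := by
  obtain ⟨g', hg', hle⟩ := exists_of_norm_le f (E.toL0 g).aestronglyMeasurable h
  rwa [← ext_ae hg']

/-- Dominated convergence: in a Banach function space with absolutely continuous norm, a dominated
sequence that tends to `0` almost everywhere tends to `0` in norm. -/
lemma AbsolutelyContinuousNorm.tendsto_norm_zero (hA : E.AbsolutelyContinuousNorm) (f : E)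
    (g : ℕ → E) (hle : ∀ n, ∀ᵐ ω ∂μ, ‖E.toL0 (g n) ω‖ ≤ ‖E.toL0 f ω‖)
    (hlim : ∀ᵐ ω ∂μ, Tendsto (fun n => E.toL0 (g n) ω) atTop (𝓝 0)) :
    Tendsto (fun n => ‖g n‖) atTop (𝓝 0) := by
  -- Off `A n = {∃ m ≥ n, ‖g m‖ > ε ‖f‖}` the function `g n` is dominated by `ε f`, and the sets
  -- `A n` decrease to a null set.
  have key : ∀ ε : ℝ, 0 < ε → ∀ᶠ n in atTop, ‖g n‖ ≤ ε * ‖f‖ + ε := by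
    intro ε hε
    let A : ℕ → Set Ω := fun n => {ω | ∃ m ≥ n, ε * ‖E.toL0 f ω‖ < ‖E.toL0 (g m) ω‖}
    have hAm : ∀ n, MeasurableSet (A n) := by
      intro n
      have : A n = ⋃ m, ⋃ (_ : m ≥ n), {ω | ε * ‖E.toL0 f ω‖ < ‖E.toL0 (g m) ω‖} := by
        ext ω; simp [A]
      rw [this]
      refine MeasurableSet.iUnion fun m => MeasurableSet.iUnion fun _ => ?_
      exact measurableSet_lt ((E.toL0 f).stronglyMeasurable.norm.measurable.const_mul ε)
        (E.toL0 (g m)).stronglyMeasurable.norm.measurable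
    have hAanti : Antitone A := fun n n' h ω ⟨m, hm, hlt⟩ => ⟨m, h.trans hm, hlt⟩
    have hind : ∀ n, ∃ h : E, E.toL0 h =ᵐ[μ] (A n).indicator (E.toL0 f) ∧ ‖h‖ ≤ ‖f‖ := fun n =>
      exists_of_norm_le f ((E.toL0 f).aestronglyMeasurable.indicator (hAm n))
        (Eventually.of_forall fun ω => norm_indicator_le_norm_self _ _)
    choose h hh _ using hind
    have hlimA : ∀ᵐ ω ∂μ, Tendsto (fun n => (A n).indicator (fun _ => (1 : ℝ)) ω) atTop (𝓝 0) := by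
      filter_upwards [hlim, ae_all_iff.2 hle] with ω h1 h2
      refine tendsto_const_nhds.congr' ?_
      rcases eq_or_ne (E.toL0 f ω) 0 with h0 | h0
      · refine Eventually.of_forall fun n => ?_
        refine (Set.indicator_of_notMem ?_ _).symm
        rintro ⟨m, _, hlt⟩
        have := h2 m
        rw [h0, norm_zero] at *
        linarith
      · have hpos : 0 < ε * ‖E.toL0 f ω‖ := by positivity
        have := (tendsto_zero_iff_norm_tendsto_zero.1 h1).eventually_lt_const hpos
        obtain ⟨N, hN⟩ := eventually_atTop.1 this
        filter_upwards [eventually_ge_atTop N] with n hn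
        refine (Set.indicator_of_notMem ?_ _).symm
        rintro ⟨m, hm, hlt⟩
        exact absurd (hN m (hn.trans hm)) (not_lt.2 hlt.le)
    have hlimh := hA f A hAm hAanti hlimA h hh
    filter_upwards [hlimh.eventually_lt_const hε] with n hn
    have h1 : ‖g n‖ ≤ ‖((ε : ℝ) : 𝕜) • f + h n‖ := by
      refine norm_mono ?_
      filter_upwards [hh n, hle n, toL0_add_ae (((ε : ℝ) : 𝕜) • f) (h n),
        toL0_smul_ae ((ε : ℝ) : 𝕜) f] with ω a b c d
      rw [c, d, a]
      by_cases hω : ω ∈ A n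
      · rw [Set.indicator_of_mem hω]
        have : ((ε : ℝ) : 𝕜) * E.toL0 f ω + E.toL0 f ω =
            (((ε + 1 : ℝ)) : 𝕜) * E.toL0 f ω := by push_cast; ring
        rw [this, norm_mul, RCLike.norm_ofReal, abs_of_pos (by linarith)]
        nlinarith [norm_nonneg (E.toL0 f ω)]
      · rw [Set.indicator_of_notMem hω, add_zero, norm_mul, RCLike.norm_ofReal, abs_of_pos hε]
        by_contra hcon
        exact hω ⟨n, le_rfl, not_le.1 hcon⟩
    calc ‖g n‖ ≤ _ := h1
      _ ≤ ‖((ε : ℝ) : 𝕜) • f‖ + ‖h n‖ := norm_add_le _ _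
      _ ≤ ε * ‖f‖ + ε := by
        rw [norm_smul, RCLike.norm_ofReal, abs_of_pos hε]
        linarith
  rw [Metric.tendsto_atTop']
  intro δ hδ
  have hε : 0 < δ / (2 * (‖f‖ + 1)) := by positivity
  obtain ⟨N, hN⟩ := eventually_atTop.1 (key _ hε)
  refine ⟨N, fun n hn => ?_⟩
  rw [dist_zero_right, norm_norm]
  refine (hN n hn.le).trans_lt ?_
  rw [← mul_add_one, div_mul_eq_mul_div, div_lt_iff₀ (by positivity)]
  nlinarith [norm_nonneg f]

/-- Countably many supports of elements of `E` are contained in the support of one element. -/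
lemma FatouProperty.exists_support_iUnion (hF : E.FatouProperty) (f : ℕ → E) :
    ∃ w : E, ∀ᵐ ω ∂μ, ∀ n, E.toL0 (f n) ω ≠ 0 → E.toL0 w ω ≠ 0 := by
  -- The sum of `|f n|`, with weights `c n` that make the partial sums bounded in `E`.
  let c : ℕ → ℝ := fun n => (1 / 2) ^ n / (1 + ‖f n‖)
  have hc : ∀ n, 0 < c n := fun n => by positivity
  have hp : ∀ n, ∃ p : E, E.toL0 p =ᵐ[μ] (fun ω => ((c n * ‖E.toL0 (f n) ω‖ : ℝ) : 𝕜)) ∧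
      ‖p‖ ≤ (1 / 2) ^ n := by
    intro n
    obtain ⟨p, h1, h2⟩ := exists_of_norm_le (((c n : ℝ) : 𝕜) • f n)
      (u := fun ω => ((c n * ‖E.toL0 (f n) ω‖ : ℝ) : 𝕜))
      (RCLike.continuous_ofReal.comp_aestronglyMeasurable
        ((E.toL0 (f n)).aestronglyMeasurable.norm.const_mul (c n))) (by
        filter_upwards [toL0_smul_ae ((c n : ℝ) : 𝕜) (f n)] with ω h
        rw [h, norm_mul, RCLike.norm_ofReal, RCLike.norm_ofReal, abs_mul, abs_norm])
    refine ⟨p, h1, h2.trans ?_⟩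
    rw [norm_smul, RCLike.norm_ofReal, abs_of_pos (hc n), div_mul_eq_mul_div,
      div_le_iff₀ (by positivity)]
    have : (0 : ℝ) ≤ (1 / 2) ^ n := by positivity
    nlinarith
  choose p hp1 hp2 using hp
  let s : ℕ → E := fun n => ∑ i ∈ Finset.range n, p i
  have hs : ∀ n, ∀ᵐ ω ∂μ, E.toL0 (s n) ω =
      ((∑ i ∈ Finset.range n, c i * ‖E.toL0 (f i) ω‖ : ℝ) : 𝕜) := by
    intro n
    induction n with
    | zero =>
      filter_upwards [toL0_zero_ae (E := E)] with ω h
      simpa [s] using h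
    | succ n ih =>
      have e : s (n + 1) = s n + p n := Finset.sum_range_succ _ _
      filter_upwards [ih, toL0_add_ae (s n) (p n), hp1 n] with ω h1 h2 h3
      rw [e, h2, h1, h3, Finset.sum_range_succ, RCLike.ofReal_add]
  have hnn : ∀ (ω : Ω) n, 0 ≤ ∑ i ∈ Finset.range n, c i * ‖E.toL0 (f i) ω‖ := fun ω n =>
    Finset.sum_nonneg fun i _ => mul_nonneg (hc i).le (norm_nonneg _)
  have hmono : ∀ ω, Monotone fun n => ∑ i ∈ Finset.range n, c i * ‖E.toL0 (f i) ω‖ := fun ω =>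
    monotone_nat_of_le_succ fun n => by
      rw [Finset.sum_range_succ]
      exact le_add_of_nonneg_right (mul_nonneg (hc n).le (norm_nonneg _))
  obtain ⟨w, hw, -⟩ := hF s
    (fun n => by
      filter_upwards [hs n] with ω h
      rw [h, RCLike.norm_ofReal, abs_of_nonneg (hnn ω n)])
    (fun n => by
      filter_upwards [hs n, hs (n + 1)] with ω h h'
      rw [h, h', RCLike.norm_ofReal, RCLike.norm_ofReal, abs_of_nonneg (hnn ω n),
        abs_of_nonneg (hnn ω (n + 1))]
      exact hmono ω n.le_succ)
    (by
      refine ⟨2, ?_⟩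
      rintro _ ⟨n, rfl⟩
      calc ‖s n‖ ≤ ∑ i ∈ Finset.range n, ‖p i‖ := norm_sum_le _ _
        _ ≤ ∑ i ∈ Finset.range n, (1 / 2 : ℝ) ^ i := Finset.sum_le_sum fun i _ => hp2 i
        _ ≤ 2 := sum_geometric_two_le n)
  refine ⟨w, ?_⟩
  filter_upwards [hw, ae_all_iff.2 hs] with ω h1 h2 n hn h0
  have h3 := h1.norm
  rw [h0, norm_zero] at h3
  have h4 : (0 : ℝ) < c n * ‖E.toL0 (f n) ω‖ := mul_pos (hc n) (norm_pos_iff.2 hn)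
  obtain ⟨m, hm, hm'⟩ := ((h3.eventually_lt_const h4).and (eventually_ge_atTop (n + 1))).exists
  rw [h2 m, RCLike.norm_ofReal, abs_of_nonneg (hnn ω m)] at hm
  have h5 := hmono ω hm'
  simp only [Finset.sum_range_succ] at h5
  have := hnn ω n
  linarith

/-- A Banach function space with the Fatou property over a `σ`-finite measure space contains a
function that vanishes almost nowhere. -/
lemma FatouProperty.exists_weak_unit [SigmaFinite μ] (hF : E.FatouProperty) :
    ∃ w : E, ∀ᵐ ω ∂μ, E.toL0 w ω ≠ 0 := by
  -- A support of maximal measure, for a finite measure `ν` equivalent to `μ`.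
  let ν : Measure Ω := μ.toFinite
  let S : E → Set Ω := fun f => {ω | E.toL0 f ω ≠ 0}
  have hS : ∀ f, MeasurableSet (S f) := fun f =>
    ((E.toL0 f).stronglyMeasurable.measurable (measurableSet_singleton 0)).compl
  have hne : (Set.range fun f => ν (S f)).Nonempty := Set.range_nonempty _
  obtain ⟨u, -, hu, hmem⟩ := exists_seq_tendsto_sSup hne (OrderTop.bddAbove _)
  choose f hf using hmem
  obtain ⟨w, hw⟩ := hF.exists_support_iUnion f
  have hνμ : ν ≪ μ := toFinite_absolutelyContinuous μ
  have hle : ∀ n, ν (S (f n)) ≤ ν (S w) := fun n =>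
    measure_mono_ae (hνμ.ae_le (hw.mono fun ω h => h n))
  have hmax : ∀ g : E, ν (S g) ≤ ν (S w) := by
    intro g
    refine (le_sSup (Set.mem_range_self (f := fun f => ν (S f)) g)).trans
      (le_of_tendsto' hu fun n => ?_)
    rw [← hf n]
    exact hle n
  refine ⟨w, ?_⟩
  by_contra hcon
  have hpos : 0 < μ (S w)ᶜ := by
    rw [pos_iff_ne_zero]
    intro h0
    exact hcon (measure_mono_null (fun ω hω => by simpa [S] using hω) h0)
  obtain ⟨B, hBsub, hBm, hBpos, b, hbmem, hb⟩ := E.saturated _ (hS w).compl hpos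
  have hb' : E.toL0 (E.elem b hbmem) =ᵐ[μ] B.indicator fun _ => (1 : 𝕜) := hb
  have hlt : ν (S w) < ν (S (w + E.elem b hbmem)) := by
    have h1 : ν (S w ∪ B) ≤ ν (S (w + E.elem b hbmem)) := by
      refine measure_mono_ae (hνμ.ae_le ?_)
      filter_upwards [toL0_add_ae w (E.elem b hbmem), hb'] with ω h1 h2 h3
      change E.toL0 (w + E.elem b hbmem) ω ≠ 0
      rw [h1, h2]
      by_cases hωB : ω ∈ B
      · have : E.toL0 w ω = 0 := by simpa [S] using hBsub hωB
        simp [hωB, this]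
      · rw [Set.indicator_of_notMem hωB, add_zero]
        exact h3.resolve_right hωB
    refine lt_of_lt_of_le ?_ h1
    rw [measure_union (Set.disjoint_left.2 fun ω h1 h2 => hBsub h2 h1) hBm]
    refine ENNReal.lt_add_right (measure_ne_top _ _) ?_
    intro h0
    exact hBpos.ne' (absolutelyContinuous_toFinite μ h0)
  exact absurd (hmax _) (not_le.2 hlt)

end BanachFunctionSpace

/-! ### Functionals on a Banach function space -/

/-- The conjugate sign `conj z / |z|` of a scalar (`0` if `z = 0`). -/
def conjSign {𝕜 : Type*} [RCLike 𝕜] (z : 𝕜) : 𝕜 := starRingEnd 𝕜 z / ((‖z‖ : ℝ) : 𝕜)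

section ConjSign

variable {𝕜 : Type*} [RCLike 𝕜]

lemma conjSign_mul_self (z : 𝕜) : conjSign z * z = ((‖z‖ : ℝ) : 𝕜) := by
  rcases eq_or_ne z 0 with rfl | hz
  · simp [conjSign]
  · have : ((‖z‖ : ℝ) : 𝕜) ≠ 0 := by simpa using hz
    rw [conjSign, div_mul_eq_mul_div, RCLike.conj_mul, sq, mul_div_assoc, div_self this, mul_one]

lemma norm_conjSign_le (z : 𝕜) : ‖conjSign z‖ ≤ 1 := by
  rw [conjSign, norm_div, RCLike.norm_conj, RCLike.norm_ofReal, abs_norm]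
  exact div_self_le_one _

lemma measurable_conjSign : Measurable (conjSign : 𝕜 → 𝕜) :=
  RCLike.continuous_conj.measurable.div
    (RCLike.continuous_ofReal.measurable.comp continuous_norm.measurable)

end ConjSign

namespace BanachFunctionSpace

variable {𝕜 : Type*} [RCLike 𝕜] {Ω : Type*} [MeasurableSpace Ω] {μ : Measure Ω}
  {E : BanachFunctionSpace 𝕜 μ}

lemma toL0_sum_ae {ι : Type*} (s : Finset ι) (f : ι → E) :
    ∀ᵐ ω ∂μ, E.toL0 (∑ i ∈ s, f i) ω = ∑ i ∈ s, E.toL0 (f i) ω := by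
  classical
  induction s using Finset.induction_on with
  | empty => simpa using toL0_zero_ae (E := E)
  | insert a s ha ih =>
    rw [Finset.sum_insert ha]
    filter_upwards [ih, toL0_add_ae (f a) (∑ i ∈ s, f i)] with ω h1 h2
    rw [h2, h1, Finset.sum_insert ha]

/-- The set function `A ↦ T (w 1_A)` has a density, for a bounded additive `T`: it is countably
additive since the norm of `E` is absolutely continuous. -/
lemma AbsolutelyContinuousNorm.exists_density [SigmaFinite μ] (hA : E.AbsolutelyContinuousNorm)
    (w : E) (T : E →+ ℝ) (C : ℝ) (hT : ∀ f, |T f| ≤ C * ‖f‖) :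
    ∃ g : Ω → ℝ, Integrable g μ ∧ ∀ A, MeasurableSet A → ∀ f : E,
      E.toL0 f =ᵐ[μ] A.indicator (E.toL0 w) → T f = ∫ ω in A, g ω ∂μ := by
  classical
  have hr : ∀ A, MeasurableSet A → ∃ f : E, E.toL0 f =ᵐ[μ] A.indicator (E.toL0 w) := by
    intro A hAm
    obtain ⟨f, hf, -⟩ := exists_of_norm_le w ((E.toL0 w).aestronglyMeasurable.indicator hAm)
      (Eventually.of_forall fun ω => norm_indicator_le_norm_self _ _)
    exact ⟨f, hf⟩
  choose r hr using hr
  have huniq : ∀ A (hAm : MeasurableSet A) (f : E), E.toL0 f =ᵐ[μ] A.indicator (E.toL0 w) →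
      f = r A hAm := fun A hAm f hf => ext_ae (hf.trans (hr A hAm).symm)
  let ν : SignedMeasure Ω :=
    { measureOf' := fun A => if h : MeasurableSet A then T (r A h) else 0
      empty' := by
        have : r ∅ MeasurableSet.empty = 0 := by
          refine (huniq _ _ 0 ?_).symm
          filter_upwards [toL0_zero_ae (E := E)] with ω h
          simpa using h
        simp [this]
      not_measurable' := fun A hAm => by simp [hAm]
      m_iUnion' := by
        intro B hBm hBd
        have hU : MeasurableSet (⋃ i, B i) := MeasurableSet.iUnion hBm
        simp only [hBm, hU, dite_true]
        have hV : ∀ n : ℕ, MeasurableSet (⋃ i, ⋃ (_ : n ≤ i), B i) := fun n =>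
          MeasurableSet.iUnion fun i => MeasurableSet.iUnion fun _ => hBm i
        -- the tails `w 1_{⋃ i ≥ n, B i}` control the remainders of the series
        have hlim := hA.tendsto_norm_zero w (fun n => r _ (hV n))
          (fun n => by
            filter_upwards [hr _ (hV n)] with ω h
            rw [h]
            exact norm_indicator_le_norm_self _ _)
          (by
            filter_upwards [ae_all_iff.2 fun n => hr _ (hV n)] with ω h
            refine tendsto_const_nhds.congr' ?_
            by_cases hω : ∃ k, ω ∈ B k
            · obtain ⟨k, hk⟩ := hω
              filter_upwards [eventually_gt_atTop k] with n hn
              rw [h n, Set.indicator_of_notMem]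
              simp only [Set.mem_iUnion, not_exists]
              intro i hi hωi
              have hne : i ≠ k := by omega
              exact (Set.disjoint_left.1 (hBd hne)) hωi hk
            · refine Eventually.of_forall fun n => ?_
              dsimp only
              rw [h n, Set.indicator_of_notMem]
              simp only [Set.mem_iUnion, not_exists]
              exact fun i _ hωi => hω ⟨i, hωi⟩)
        have hbound : ∀ N (s : Finset ℕ), Finset.range N ⊆ s →
            ‖r _ hU - ∑ i ∈ s, r _ (hBm i)‖ ≤ ‖r _ (hV N)‖ := by
          intro N s hs
          refine norm_mono ?_
          filter_upwards [toL0_sub_ae (r _ hU) (∑ i ∈ s, r _ (hBm i)), hr _ hU, hr _ (hV N),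
            toL0_sum_ae s fun i => r _ (hBm i), ae_all_iff.2 fun n => hr _ (hBm n)] with
            ω h1 h2 h3 h4 h5
          rw [h1, h2, h3, h4]
          simp only [h5]
          by_cases hω : ∃ k, ω ∈ B k
          · obtain ⟨k, hk⟩ := hω
            have hother : ∀ i, i ≠ k → (B i).indicator (E.toL0 w) ω = 0 := fun i hi =>
              Set.indicator_of_notMem
                (fun hωi => (Set.disjoint_left.1 (hBd hi)) hωi hk) _
            rw [Set.indicator_of_mem (Set.mem_iUnion.2 ⟨k, hk⟩)]
            by_cases hks : k ∈ s
            · rw [Finset.sum_eq_single_of_mem k hks fun i _ hi => hother i hi,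
                Set.indicator_of_mem hk, sub_self, norm_zero]
              exact norm_nonneg _
            · rw [Finset.sum_eq_zero fun i hi => hother i (fun h => hks (h ▸ hi)), sub_zero,
                Set.indicator_of_mem]
              have : N ≤ k := by
                by_contra hlt
                exact hks (hs (Finset.mem_range.2 (not_le.1 hlt)))
              exact Set.mem_iUnion₂.2 ⟨k, this, hk⟩
          · have h0 : ∀ i, (B i).indicator (E.toL0 w) ω = 0 := fun i =>
              Set.indicator_of_notMem (fun hωi => hω ⟨i, hωi⟩) _
            rw [Set.indicator_of_notMem (by simpa using hω), Finset.sum_eq_zero fun i _ => h0 i]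
            simp
        rw [HasSum, SummationFilter.unconditional_filter, Metric.tendsto_atTop]
        intro ε hε
        have hlim' : Tendsto (fun n => C * ‖r _ (hV n)‖) atTop (𝓝 0) := by
          simpa using hlim.const_mul C
        have hC : 0 ≤ C ∨ C < 0 := le_or_gt 0 C
        rcases hC with hC | hC
        · obtain ⟨N, hN⟩ := (hlim'.eventually_lt_const hε).exists
          refine ⟨Finset.range N, fun s hs => ?_⟩
          rw [dist_comm, Real.dist_eq, ← map_sum, ← map_sub]
          exact (hT _).trans_lt ((mul_le_mul_of_nonneg_left (hbound N s hs) hC).trans_lt hN)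
        · refine ⟨∅, fun s _ => ?_⟩
          rw [dist_comm, Real.dist_eq, ← map_sum, ← map_sub]
          refine ((hT _).trans (mul_nonpos_of_nonpos_of_nonneg hC.le (norm_nonneg _))).trans_lt hε }
  have hν : ∀ A (h : MeasurableSet A), ν A = T (r A h) := fun A h => by
    change (if h : MeasurableSet A then T (r A h) else 0) = _
    simp [h]
  have hac : ν ≪ᵥ μ.toENNRealVectorMeasure := by
    refine VectorMeasure.AbsolutelyContinuous.mk fun A hAm h0 => ?_
    rw [Measure.toENNRealVectorMeasure_apply_measurable hAm] at h0
    have : r A hAm = 0 := by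
      refine (huniq _ _ 0 ?_).symm
      have hnot : ∀ᵐ ω ∂μ, ω ∉ A := measure_eq_zero_iff_ae_notMem.1 h0
      filter_upwards [toL0_zero_ae (E := E), hnot] with ω h h'
      rw [h, Set.indicator_of_notMem h']
    rw [hν A hAm, this, map_zero]
  refine ⟨ν.rnDeriv μ, SignedMeasure.integrable_rnDeriv ν μ, fun A hAm f hf => ?_⟩
  rw [huniq A hAm f hf, ← hν A hAm,
    ← withDensityᵥ_apply (SignedMeasure.integrable_rnDeriv ν μ) hAm,
    SignedMeasure.withDensityᵥ_rnDeriv_eq ν μ hac]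

/-- The real and imaginary part of `A ↦ φ (w 1_A)` have densities. -/
lemma AbsolutelyContinuousNorm.exists_density_dual [SigmaFinite μ]
    (hA : E.AbsolutelyContinuousNorm) (w : E) (φ : StrongDual 𝕜 E) :
    ∃ g : Ω → 𝕜, Integrable g μ ∧ ∀ A, MeasurableSet A → ∀ f : E,
      E.toL0 f =ᵐ[μ] A.indicator (E.toL0 w) → φ f = ∫ ω in A, g ω ∂μ := by
  obtain ⟨g₁, hg₁, h₁⟩ := hA.exists_density w
    ((RCLike.re : 𝕜 →+ ℝ).comp φ.toLinearMap.toAddMonoidHom) ‖φ‖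
    (fun f => (RCLike.abs_re_le_norm _).trans (φ.le_opNorm f))
  obtain ⟨g₂, hg₂, h₂⟩ := hA.exists_density w
    ((RCLike.im : 𝕜 →+ ℝ).comp φ.toLinearMap.toAddMonoidHom) ‖φ‖
    (fun f => (RCLike.abs_im_le_norm _).trans (φ.le_opNorm f))
  have i₁ : Integrable (fun ω => ((g₁ ω : ℝ) : 𝕜)) μ := hg₁.ofReal
  have i₂ : Integrable (fun ω => ((g₂ ω : ℝ) : 𝕜) * RCLike.I) μ := hg₂.ofReal.mul_const _
  refine ⟨fun ω => (g₁ ω : 𝕜) + (g₂ ω : 𝕜) * RCLike.I, i₁.add i₂, fun A hAm f hf => ?_⟩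
  rw [integral_add i₁.integrableOn i₂.integrableOn, integral_mul_const, integral_ofReal,
    integral_ofReal, ← h₁ A hAm f hf, ← h₂ A hAm f hf]
  exact (RCLike.re_add_im (φ f)).symm

/-- Every functional `φ` on a Banach function space `E` with the Fatou property and absolutely
continuous norm is integration against some `g` in the Köthe dual of `E`: the density of
`A ↦ φ (w 1_A)`, divided by `w`, for a function `w` in `E` that vanishes almost nowhere. -/
theorem exists_koethe_representation [SigmaFinite μ] (hF : E.FatouProperty)
    (hA : E.AbsolutelyContinuousNorm) (φ : StrongDual 𝕜 E) :
    ∃ g : Ω →ₘ[μ] 𝕜, ∀ f : E, Integrable (fun ω => E.toL0 f ω * g ω) μ ∧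
      φ f = ∫ ω, E.toL0 f ω * g ω ∂μ := by
  obtain ⟨w, hw⟩ := hF.exists_weak_unit
  obtain ⟨g, hg, hφg⟩ := hA.exists_density_dual w φ
  have hwm : Measurable (E.toL0 w) := (E.toL0 w).stronglyMeasurable.measurable
  have hint : ∀ b : Ω → 𝕜, AEStronglyMeasurable b μ → ∀ C : ℝ, (∀ ω, ‖b ω‖ ≤ C) →
      Integrable (fun ω => b ω * g ω) μ := fun b hb C hC =>
    hg.bdd_mul hb (Eventually.of_forall hC)
  have hmem : ∀ b : Ω → 𝕜, AEStronglyMeasurable b μ → ∀ C : ℝ, (∀ ω, ‖b ω‖ ≤ C) →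
      ∃ f : E, E.toL0 f =ᵐ[μ] fun ω => b ω * E.toL0 w ω := by
    intro b hb C hC
    obtain ⟨f, hf, -⟩ := exists_of_norm_le (((C : ℝ) : 𝕜) • w)
      (hb.mul (E.toL0 w).aestronglyMeasurable) (by
        filter_upwards [toL0_smul_ae ((C : ℝ) : 𝕜) w] with ω h
        rw [h, Pi.mul_apply, norm_mul, norm_mul, RCLike.norm_ofReal]
        gcongr
        exact (hC ω).trans (le_abs_self C))
    exact ⟨f, hf⟩
  -- the formula `φ (b w) = ∫ b g` for simple `b`
  have hsimple : ∀ (s : SimpleFunc Ω 𝕜) (f : E),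
      (E.toL0 f =ᵐ[μ] fun ω => s ω * E.toL0 w ω) → φ f = ∫ ω, s ω * g ω ∂μ := by
    intro s
    induction s using SimpleFunc.induction with
    | const c hs =>
      rename_i A
      intro f hf
      obtain ⟨r, hr, -⟩ := exists_of_norm_le w ((E.toL0 w).aestronglyMeasurable.indicator hs)
        (Eventually.of_forall fun ω => norm_indicator_le_norm_self _ _)
      have hfr : f = c • r := by
        refine ext_ae ?_
        filter_upwards [hf, hr, toL0_smul_ae c r] with ω h1 h2 h3
        rw [h1, h3, h2]
        by_cases hω : ω ∈ A <;> simp [hω]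
      have e : (fun ω => (SimpleFunc.piecewise A hs (SimpleFunc.const Ω c)
          (SimpleFunc.const Ω 0)) ω * g ω) = fun ω => c * A.indicator g ω := by
        funext ω
        by_cases hω : ω ∈ A <;> simp [hω]
      rw [hfr, map_smul, hφg A hs r hr, e, integral_const_mul, integral_indicator hs, smul_eq_mul]
    | @add s t _ hs ht =>
      intro f hf
      obtain ⟨C, hC⟩ := s.exists_forall_norm_le
      obtain ⟨D, hD⟩ := t.exists_forall_norm_le
      obtain ⟨f₁, hf₁⟩ := hmem s s.aestronglyMeasurable C hC
      obtain ⟨f₂, hf₂⟩ := hmem t t.aestronglyMeasurable D hD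
      have hsum : f = f₁ + f₂ := by
        refine ext_ae ?_
        filter_upwards [hf, hf₁, hf₂, toL0_add_ae f₁ f₂] with ω h1 h2 h3 h4
        rw [h1, h4, h2, h3, SimpleFunc.coe_add, Pi.add_apply, add_mul]
      rw [hsum, map_add, hs f₁ hf₁, ht f₂ hf₂,
        ← integral_add (hint s s.aestronglyMeasurable C hC) (hint t t.aestronglyMeasurable D hD)]
      simp only [SimpleFunc.coe_add, Pi.add_apply, add_mul]
  have hlimφ : ∀ (u : ℕ → E) (f : E), Tendsto (fun n => ‖u n - f‖) atTop (𝓝 0) →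
      Tendsto (fun n => φ (u n)) atTop (𝓝 (φ f)) := fun u f h =>
    (φ.continuous.tendsto f).comp (tendsto_iff_norm_sub_tendsto_zero.2 h)
  -- the formula for bounded `b`
  have hbdd : ∀ b : Ω → 𝕜, Measurable b → ∀ C : ℝ, (∀ ω, ‖b ω‖ ≤ C) → ∀ f : E,
      (E.toL0 f =ᵐ[μ] fun ω => b ω * E.toL0 w ω) → φ f = ∫ ω, b ω * g ω ∂μ := by
    intro b hb C hC f hf
    have hbs : StronglyMeasurable b := hb.stronglyMeasurable
    by_cases hne : Nonempty Ω
    swap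
    · have := not_nonempty_iff.1 hne
      have h0 : f = 0 := ext_ae (by filter_upwards with ω using (hne ⟨ω⟩).elim)
      rw [h0, map_zero, integral_of_isEmpty]
    have hC0 : 0 ≤ C := (norm_nonneg _).trans (hC hne.some)
    have hs_le : ∀ n ω, ‖hbs.approxBounded C n ω‖ ≤ C := fun n ω =>
      hbs.norm_approxBounded_le hC0 n ω
    have hs_lim : ∀ ω, Tendsto (fun n => hbs.approxBounded C n ω) atTop (𝓝 (b ω)) := fun ω =>
      hbs.tendsto_approxBounded_of_norm_le (hC ω)
    choose u hu using fun n => hmem (hbs.approxBounded C n)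
      (hbs.approxBounded C n).aestronglyMeasurable C (hs_le n)
    have h1 : Tendsto (fun n => φ (u n)) atTop (𝓝 (φ f)) := by
      refine hlimφ u f (hA.tendsto_norm_zero (((2 * C : ℝ) : 𝕜) • w) _ (fun n => ?_) ?_)
      · filter_upwards [hu n, hf, toL0_sub_ae (u n) f, toL0_smul_ae ((2 * C : ℝ) : 𝕜) w] with
          ω h1 h2 h3 h4
        rw [h3, h4, h1, h2, ← sub_mul, norm_mul, norm_mul, RCLike.norm_ofReal,
          abs_of_nonneg (by positivity)]
        gcongr
        refine (norm_sub_le _ _).trans ?_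
        linarith [hs_le n ω, hC ω]
      · filter_upwards [ae_all_iff.2 hu, hf, ae_all_iff.2 fun n => toL0_sub_ae (u n) f] with
          ω h1 h2 h3
        simp only [h3, h1, h2]
        have := ((hs_lim ω).mul_const (E.toL0 w ω)).sub_const (b ω * E.toL0 w ω)
        rwa [sub_self] at this
    have h2 : Tendsto (fun n => φ (u n)) atTop (𝓝 (∫ ω, b ω * g ω ∂μ)) := by
      simp only [fun n => hsimple _ (u n) (hu n)]
      refine tendsto_integral_of_dominated_convergence (fun ω => C * ‖g ω‖)
        (fun n => (hbs.approxBounded C n).aestronglyMeasurable.mul hg.1) (hg.norm.const_mul C)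
        (fun n => Eventually.of_forall fun ω => ?_) (Eventually.of_forall fun ω => ?_)
      · rw [norm_mul]
        gcongr
        exact hs_le n ω
      · exact (hs_lim ω).mul_const _
    exact tendsto_nhds_unique h1 h2
  -- the general case, by truncation of `b = f / w`
  refine ⟨AEEqFun.mk (fun ω => g ω / E.toL0 w ω)
    (hg.1.aemeasurable.div hwm.aemeasurable).aestronglyMeasurable, fun f => ?_⟩
  have hfm : Measurable (E.toL0 f) := (E.toL0 f).stronglyMeasurable.measurable
  let b : Ω → 𝕜 := fun ω => E.toL0 f ω / E.toL0 w ω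
  have hb : Measurable b := hfm.div hwm
  have hcongr : (fun ω => E.toL0 f ω * (AEEqFun.mk (μ := μ) (fun ω => g ω / E.toL0 w ω)
      (hg.1.aemeasurable.div hwm.aemeasurable).aestronglyMeasurable) ω) =ᵐ[μ]
        fun ω => b ω * g ω := by
    filter_upwards [AEEqFun.coeFn_mk (μ := μ) (fun ω => g ω / E.toL0 w ω)
      (hg.1.aemeasurable.div hwm.aemeasurable).aestronglyMeasurable] with ω h
    rw [h]
    simp only [b]
    ring
  rw [integrable_congr hcongr, integral_congr_ae hcongr]
  let B : ℕ → Set Ω := fun n => {ω | ‖b ω‖ ≤ n}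
  have hB : ∀ n, MeasurableSet (B n) := fun n => measurableSet_le hb.norm measurable_const
  have hBmono : Monotone B := fun m n hmn ω hω =>
    le_trans (show ‖b ω‖ ≤ m from hω) (Nat.cast_le.2 hmn)
  have hBU : ⋃ n, B n = Set.univ := Set.eq_univ_of_forall fun ω => by
    obtain ⟨n, hn⟩ := exists_nat_ge ‖b ω‖
    exact Set.mem_iUnion.2 ⟨n, hn⟩
  have hind_le : ∀ n ω, ‖(B n).indicator b ω‖ ≤ n := fun n ω => by
    by_cases hω : ω ∈ B n
    · rw [Set.indicator_of_mem hω]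
      exact hω
    · rw [Set.indicator_of_notMem hω, norm_zero]
      exact n.cast_nonneg
  have hgm : AEMeasurable g μ := hg.1.aemeasurable
  have hfin : ∫⁻ ω, ‖b ω * g ω‖ₑ ∂μ ≤ ‖φ‖ₑ * ‖f‖ₑ := by
    rw [← setLIntegral_univ, ← hBU, setLIntegral_iUnion_of_directed _ hBmono.directed_le]
    refine iSup_le fun n => ?_
    -- A measurable version of `g` makes the conjugate sign of `b g` measurable.
    let c : Ω → 𝕜 := fun ω => conjSign (b ω * hgm.mk g ω)
    have hc : Measurable c := measurable_conjSign.comp (hb.mul hgm.measurable_mk)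
    have hcb : Measurable fun ω => c ω * (B n).indicator b ω := hc.mul (hb.indicator (hB n))
    have hcb_le : ∀ ω, ‖c ω * (B n).indicator b ω‖ ≤ n := fun ω => by
      rw [norm_mul]
      calc _ ≤ 1 * (n : ℝ) := mul_le_mul (norm_conjSign_le _) (hind_le n ω) (norm_nonneg _)
            zero_le_one
        _ = n := one_mul _
    obtain ⟨u, hu⟩ := hmem _ hcb.aestronglyMeasurable n hcb_le
    have hule : ‖u‖ ≤ ‖f‖ := by
      refine norm_mono ?_
      filter_upwards [hu, hw] with ω h1 h2
      rw [h1, norm_mul, norm_mul]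
      have h3 : ‖(B n).indicator b ω‖ ≤ ‖b ω‖ := norm_indicator_le_norm_self _ _
      calc ‖c ω‖ * ‖(B n).indicator b ω‖ * ‖E.toL0 w ω‖ ≤ 1 * ‖b ω‖ * ‖E.toL0 w ω‖ := by
            gcongr
            exact norm_conjSign_le _
        _ = ‖E.toL0 f ω‖ := by
            rw [one_mul, ← norm_mul]
            simp only [b]
            rw [div_mul_cancel₀ _ h2]
    have hval : φ u = ((∫ ω in B n, ‖b ω * g ω‖ ∂μ : ℝ) : 𝕜) := by
      rw [hbdd _ hcb n hcb_le u hu, ← integral_ofReal, ← integral_indicator (hB n)]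
      refine integral_congr_ae ?_
      filter_upwards [hgm.ae_eq_mk] with ω h
      by_cases hω : ω ∈ B n
      · simp only [Set.indicator_of_mem hω]
        rw [mul_assoc, ← conjSign_mul_self, h]
      · simp [Set.indicator_of_notMem hω]
    have hI : Integrable (fun ω => (B n).indicator b ω * g ω) μ :=
      hint _ (hb.indicator (hB n)).aestronglyMeasurable n (hind_le n)
    have hI' : IntegrableOn (fun ω => b ω * g ω) (B n) μ := by
      refine (integrable_indicator_iff (hB n)).1 (hI.congr (Eventually.of_forall fun ω => ?_))
      by_cases hω : ω ∈ B n <;> simp [hω]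
    calc ∫⁻ ω in B n, ‖b ω * g ω‖ₑ ∂μ = ‖φ u‖ₑ := by
          rw [← ofReal_integral_norm_eq_lintegral_enorm hI', hval, ← ofReal_norm,
            RCLike.norm_ofReal, abs_of_nonneg (integral_nonneg fun ω => norm_nonneg _)]
      _ ≤ ‖φ‖ₑ * ‖u‖ₑ := φ.le_opENorm u
      _ ≤ ‖φ‖ₑ * ‖f‖ₑ := by
          gcongr
          exact enorm_le_iff_norm_le.2 hule
  have hI : Integrable (fun ω => b ω * g ω) μ :=
    ⟨hb.aestronglyMeasurable.mul hg.1,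
      hfin.trans_lt (ENNReal.mul_lt_top enorm_lt_top enorm_lt_top)⟩
  refine ⟨hI, ?_⟩
  choose u hu using fun n : ℕ => hmem _ (hb.indicator (hB n)).aestronglyMeasurable n (hind_le n)
  have hev : ∀ ω, ∀ᶠ n in atTop, (B n).indicator b ω = b ω := fun ω => by
    obtain ⟨N, hN⟩ := exists_nat_ge ‖b ω‖
    filter_upwards [eventually_ge_atTop N] with n hn
    exact Set.indicator_of_mem (show ω ∈ B n from hN.trans (Nat.cast_le.2 hn)) _
  have hf : E.toL0 f =ᵐ[μ] fun ω => b ω * E.toL0 w ω := by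
    filter_upwards [hw] with ω h
    exact (div_mul_cancel₀ _ h).symm
  have h1 : Tendsto (fun n => φ (u n)) atTop (𝓝 (φ f)) := by
    refine hlimφ u f (hA.tendsto_norm_zero f _ (fun n => ?_) ?_)
    · filter_upwards [hu n, hf, toL0_sub_ae (u n) f] with ω h1 h2 h3
      rw [h3, h1, h2, ← sub_mul, norm_mul, norm_mul]
      gcongr
      by_cases hω : ω ∈ B n <;> simp [hω]
    · filter_upwards [ae_all_iff.2 hu, hf, ae_all_iff.2 fun n => toL0_sub_ae (u n) f] with
        ω h1 h2 h3
      simp only [h3, h1, h2]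
      refine tendsto_const_nhds.congr' ?_
      filter_upwards [hev ω] with n hn
      rw [hn, sub_self]
  have h2 : Tendsto (fun n => φ (u n)) atTop (𝓝 (∫ ω, b ω * g ω ∂μ)) := by
    simp only [fun n => hbdd _ (hb.indicator (hB n)) n (hind_le n) (u n) (hu n)]
    refine tendsto_integral_of_dominated_convergence (fun ω => ‖b ω * g ω‖)
      (fun n => (hb.indicator (hB n)).aestronglyMeasurable.mul hg.1) hI.norm
      (fun n => Eventually.of_forall fun ω => ?_) (Eventually.of_forall fun ω => ?_)
    · rw [norm_mul, norm_mul]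
      gcongr
      exact norm_indicator_le_norm_self _ _
    · refine tendsto_const_nhds.congr' ?_
      filter_upwards [hev ω] with n hn
      rw [hn]
  exact tendsto_nhds_unique h1 h2

end BanachFunctionSpace

/-! ### The norm of `ℓ^q(ℤ)` -/

section LittleLq

variable {𝕜 : Type*} [RCLike 𝕜] {q : ℝ≥0∞}

lemma eLpNorm_count_eq (hq₀ : q ≠ 0) (hq : q ≠ ∞) (a : ℤ → 𝕜) :
    eLpNorm a q Measure.count = (∑' j, ‖a j‖ₑ ^ q.toReal) ^ (1 / q.toReal) := by
  rw [eLpNorm_eq_lintegral_rpow_enorm_toReal hq₀ hq, lintegral_count]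

lemma eLpNorm_count_top (a : ℤ → 𝕜) : eLpNorm a ∞ Measure.count = ⨆ j, ‖a j‖ₑ := by
  simp [eLpNorm_exponent_top, eLpNormEssSup_eq_essSup_enorm]

lemma eLpNorm_count_mono {a b : ℤ → 𝕜} (h : ∀ j, ‖a j‖ ≤ ‖b j‖) :
    eLpNorm a q Measure.count ≤ eLpNorm b q Measure.count :=
  eLpNorm_mono h

lemma eLpNorm_count_comp_equiv (hq₀ : q ≠ 0) (hq : q ≠ ∞) (a : ℤ → 𝕜) (σ : Equiv.Perm ℤ) :
    eLpNorm (fun j => a (σ j)) q Measure.count = eLpNorm a q Measure.count := by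
  rw [eLpNorm_count_eq hq₀ hq, eLpNorm_count_eq hq₀ hq,
    σ.tsum_eq fun j => ‖a j‖ₑ ^ q.toReal]

lemma eLpNorm_count_single (hq₀ : q ≠ 0) (hq : q ≠ ∞) (a : ℤ → 𝕜) (i : ℤ)
    (ha : ∀ j, j ≠ i → a j = 0) : eLpNorm a q Measure.count = ‖a i‖ₑ := by
  have hpos : 0 < q.toReal := ENNReal.toReal_pos hq₀ hq
  rw [eLpNorm_count_eq hq₀ hq, tsum_eq_single i, ← ENNReal.rpow_mul, mul_one_div_cancel hpos.ne',
    ENNReal.rpow_one]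
  intro j hj
  rw [ha j hj, enorm_zero, ENNReal.zero_rpow_of_pos hpos]

lemma eLpNorm_count_le_tsum (hq₁ : 1 ≤ q) (hq : q ≠ ∞) (a : ℤ → 𝕜) :
    eLpNorm a q Measure.count ≤ ∑' j, ‖a j‖ₑ := by
  have hp : 1 ≤ q.toReal := by
    simpa using ENNReal.toReal_mono hq hq₁
  have hsplit : ∀ x : ℝ≥0∞, x ^ q.toReal = x * x ^ (q.toReal - 1) := fun x => by
    nth_rw 2 [← ENNReal.rpow_one x]
    rw [← ENNReal.rpow_add_of_nonneg _ _ zero_le_one (sub_nonneg.2 hp), add_sub_cancel]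
  rw [eLpNorm_count_eq (zero_lt_one.trans_le hq₁).ne' hq,
    one_div, ENNReal.rpow_inv_le_iff (by linarith), hsplit (∑' j, ‖a j‖ₑ),
    ← ENNReal.tsum_mul_right]
  refine ENNReal.tsum_le_tsum fun j => ?_
  rw [hsplit]
  gcongr
  exact ENNReal.le_tsum j

lemma eLpNorm_count_eq_iSup (hq₀ : q ≠ 0) (a : ℤ → 𝕜) :
    eLpNorm a q Measure.count =
      ⨆ s : Finset ℤ, eLpNorm (fun j => if j ∈ s then a j else 0) q Measure.count := by
  refine le_antisymm ?_ (iSup_le fun s => eLpNorm_count_mono fun j => ?_)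
  swap
  · split_ifs <;> simp
  rcases eq_or_ne q ∞ with rfl | hq
  · simp only [eLpNorm_count_top]
    refine iSup_le fun j => le_iSup_of_le {j} (le_iSup_of_le j ?_)
    simp
  · have hpos : 0 < q.toReal := ENNReal.toReal_pos hq₀ hq
    rw [eLpNorm_count_eq hq₀ hq, ENNReal.tsum_eq_iSup_sum,
      ← ENNReal.orderIsoRpow_apply _ (one_div_pos.2 hpos), OrderIso.map_iSup]
    refine iSup_mono fun s => ?_
    rw [ENNReal.orderIsoRpow_apply, eLpNorm_count_eq hq₀ hq]
    refine ENNReal.rpow_le_rpow ?_ (one_div_pos.2 hpos).le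
    refine le_trans (le_of_eq ?_) (ENNReal.sum_le_tsum s)
    exact Finset.sum_congr rfl fun j hj => by rw [if_pos hj]

lemma tendsto_eLpNorm_count_tail (hq₀ : q ≠ 0) (hq : q ≠ ∞) {a : ℤ → 𝕜}
    (ha : eLpNorm a q Measure.count ≠ ∞) :
    Tendsto (fun s : Finset ℤ => eLpNorm (fun j => if j ∈ s then 0 else a j) q Measure.count)
      atTop (𝓝 0) := by
  have hpos : 0 < q.toReal := ENNReal.toReal_pos hq₀ hq
  rw [eLpNorm_count_eq hq₀ hq] at ha
  have hsum : ∑' j, ‖a j‖ₑ ^ q.toReal ≠ ∞ := fun h => ha (by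
    rw [h, ENNReal.top_rpow_of_pos (one_div_pos.2 hpos)])
  have h := (ENNReal.tendsto_tsum_compl_atTop_zero hsum).ennrpow_const (1 / q.toReal)
  rw [ENNReal.zero_rpow_of_pos (one_div_pos.2 hpos)] at h
  refine h.congr fun s => ?_
  rw [eLpNorm_count_eq hq₀ hq]
  congr 1
  rw [show (∑' b : {x // x ∉ s}, ‖a b‖ₑ ^ q.toReal) =
    ∑' b : ((s : Set ℤ)ᶜ : Set ℤ), ‖a b‖ₑ ^ q.toReal from rfl,
    tsum_subtype ((s : Set ℤ)ᶜ) fun j => ‖a j‖ₑ ^ q.toReal]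
  refine tsum_congr fun j => ?_
  by_cases hj : j ∈ s <;> simp [hj, hpos]

lemma tsum_enorm_mul_le {q' : ℝ≥0∞} [q.HolderConjugate q'] (a b : ℤ → 𝕜) :
    ∑' j, ‖a j * b j‖ₑ ≤ eLpNorm a q Measure.count * eLpNorm b q' Measure.count := by
  have h := eLpNorm_smul_le_mul_eLpNorm (p := q) (q := q') (r := 1) (μ := Measure.count)
    (φ := a) (f := b) (measurable_of_countable _).aestronglyMeasurable
    (measurable_of_countable _).aestronglyMeasurable
  refine le_trans (le_of_eq ?_) h
  rw [eLpNorm_count_eq one_ne_zero ENNReal.one_ne_top]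
  simp

end LittleLq

/-! ### Mixed norms and the Köthe dual -/

section Mixed

variable {𝕜 : Type*} [RCLike 𝕜] {Ω : Type*} [MeasurableSpace Ω] {μ : Measure Ω}

lemma FunctionNorm.toFun_congr (ρ : FunctionNorm 𝕜 μ) {f g : Ω →ₘ[μ] 𝕜}
    (h : ∀ᵐ ω ∂μ, ‖f ω‖ₑ = ‖g ω‖ₑ) : ρ.toFun f = ρ.toFun g :=
  le_antisymm (ρ.mono _ _ (h.mono fun _ hω => enorm_le_iff_norm_le.1 hω.le))
    (ρ.mono _ _ (h.mono fun _ hω => enorm_le_iff_norm_le.1 hω.ge))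

lemma FunctionNorm.mixed_le (ρ : FunctionNorm 𝕜 μ) {q : ℝ≥0∞} {F : ℤ → Ω →ₘ[μ] 𝕜}
    {h : Ω →ₘ[μ] 𝕜} (hF : ∀ᵐ ω ∂μ, lqFun q F ω ≤ ‖h ω‖ₑ) : ρ.mixed q F ≤ ρ.toFun h := by
  obtain ⟨k, hk⟩ := exists_enorm_eq (𝕜 := 𝕜) (aemeasurable_lqFun q F)
    (hF.mono fun ω hω => (hω.trans_lt enorm_lt_top).ne)
  refine (iInf₂_le k hk).trans (ρ.mono _ _ ?_)
  filter_upwards [hF, hk] with ω h1 h2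
  exact enorm_le_iff_norm_le.1 (h2.trans_le h1)

lemma FunctionNorm.exists_of_mixed_ne_top (ρ : FunctionNorm 𝕜 μ) {q : ℝ≥0∞}
    {F : ℤ → Ω →ₘ[μ] 𝕜} (hF : ρ.mixed q F ≠ ∞) :
    ∃ h : Ω →ₘ[μ] 𝕜, (∀ᵐ ω ∂μ, ‖h ω‖ₑ = lqFun q F ω) ∧ ρ.toFun h = ρ.mixed q F := by
  have : ∃ h : Ω →ₘ[μ] 𝕜, ∀ᵐ ω ∂μ, ‖h ω‖ₑ = lqFun q F ω := by
    by_contra hcon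
    refine hF (iInf₂_eq_top.2 fun h hh => (hcon ⟨h, hh⟩).elim)
  obtain ⟨h, hh⟩ := this
  refine ⟨h, hh, le_antisymm (le_iInf₂ fun k hk => le_of_eq ?_) (iInf₂_le h hh)⟩
  refine ρ.toFun_congr ?_
  filter_upwards [hh, hk] with ω h1 h2
  rw [h1, h2]

lemma FunctionNorm.mixed_mono (ρ : FunctionNorm 𝕜 μ) {q q' : ℝ≥0∞} {F G : ℤ → Ω →ₘ[μ] 𝕜}
    (h : ∀ᵐ ω ∂μ, lqFun q F ω ≤ lqFun q' G ω) : ρ.mixed q F ≤ ρ.mixed q' G := by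
  refine le_iInf₂ fun k hk => ρ.mixed_le ?_
  filter_upwards [h, hk] with ω h1 h2
  rw [h2]
  exact h1

namespace BanachFunctionSpace

variable {E : BanachFunctionSpace 𝕜 μ}

open Classical in
lemma functionNorm_toL0 (f : E) : E.functionNorm.toFun (E.toL0 f) = ‖f‖ₑ := by
  have h : E.toL0 f ∈ E.toSubmodule := f.2
  change (if h : E.toL0 f ∈ E.toSubmodule then ‖E.elem (E.toL0 f) h‖ₑ else ∞) = _
  rw [dif_pos h]
  rfl

open Classical in
lemma exists_of_functionNorm_ne_top {h : Ω →ₘ[μ] 𝕜} (hh : E.functionNorm.toFun h ≠ ∞) :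
    ∃ f : E, E.toL0 f = h := by
  by_cases hm : h ∈ E.toSubmodule
  · exact ⟨E.elem h hm, rfl⟩
  · refine (hh ?_).elim
    change (if h : _ then _ else _) = _
    rw [dif_neg hm]

lemma lintegral_mul_le_koetheNorm (f : E) (g : Ω →ₘ[μ] 𝕜) :
    ∫⁻ ω, ‖E.toL0 f ω * g ω‖ₑ ∂μ ≤ E.koetheNorm.toFun g * ‖f‖ₑ := by
  rcases eq_or_ne f 0 with rfl | hf
  · refine le_trans (le_of_eq ?_) (zero_le)
    rw [← lintegral_zero (μ := μ)]
    refine lintegral_congr_ae ?_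
    filter_upwards [toL0_zero_ae (E := E)] with ω h
    rw [h, zero_mul, enorm_zero]
  · let c : 𝕜 := ((‖f‖⁻¹ : ℝ) : 𝕜)
    have hn : ‖f‖ ≠ 0 := norm_ne_zero_iff.2 hf
    have hc : ‖c • f‖ ≤ 1 := by
      rw [norm_smul, RCLike.norm_ofReal, abs_of_nonneg (by positivity), inv_mul_cancel₀ hn]
    have h1 : ∫⁻ ω, ‖E.toL0 (c • f) ω * g ω‖ₑ ∂μ ≤ E.koetheNorm.toFun g :=
      le_iSup₂ (f := fun (f : E) (_ : ‖f‖ ≤ 1) => ∫⁻ ω, ‖E.toL0 f ω * g ω‖ₑ ∂μ) (c • f) hc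
    have hce : ‖f‖ₑ * ‖c‖ₑ = 1 := by
      rw [← enorm_norm f, ← ofReal_norm, ← ofReal_norm, ← ENNReal.ofReal_mul (norm_nonneg _),
        norm_norm, RCLike.norm_ofReal, abs_of_nonneg (by positivity), mul_inv_cancel₀ hn,
        ENNReal.ofReal_one]
    calc ∫⁻ ω, ‖E.toL0 f ω * g ω‖ₑ ∂μ
        = ‖f‖ₑ * (‖c‖ₑ * ∫⁻ ω, ‖E.toL0 f ω * g ω‖ₑ ∂μ) := by rw [← mul_assoc, hce, one_mul]
      _ = ‖f‖ₑ * ∫⁻ ω, ‖E.toL0 (c • f) ω * g ω‖ₑ ∂μ := by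
          rw [← lintegral_const_mul' _ _ enorm_ne_top]
          congr 1
          refine lintegral_congr_ae ?_
          filter_upwards [toL0_smul_ae c f] with ω h
          rw [h, enorm_mul, enorm_mul, enorm_mul, mul_assoc]
      _ ≤ _ := by
          rw [mul_comm]
          gcongr

/-- The representation of functionals by functions in the Köthe dual is isometric: to attain
`∫ |f g|`, multiply `f` by the conjugate sign of `f g`. -/
lemma koetheNorm_eq_enorm {φ : StrongDual 𝕜 E} {g : Ω →ₘ[μ] 𝕜}
    (h : ∀ f : E, Integrable (fun ω => E.toL0 f ω * g ω) μ ∧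
      φ f = ∫ ω, E.toL0 f ω * g ω ∂μ) : E.koetheNorm.toFun g = ‖φ‖ₑ := by
  have hle : E.koetheNorm.toFun g ≤ ‖φ‖ₑ := by
    refine iSup₂_le fun f hf => ?_
    let c : Ω → 𝕜 := fun ω => conjSign (E.toL0 f ω * g ω)
    have hc : Measurable c := measurable_conjSign.comp
      ((E.toL0 f).stronglyMeasurable.measurable.mul g.stronglyMeasurable.measurable)
    obtain ⟨u, hu, hun⟩ := exists_of_norm_le f
      (hc.aestronglyMeasurable.mul (E.toL0 f).aestronglyMeasurable)
      (Eventually.of_forall fun ω => by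
        rw [Pi.mul_apply, norm_mul]
        exact mul_le_of_le_one_left (norm_nonneg _) (norm_conjSign_le _))
    have hval : φ u = ((∫ ω, ‖E.toL0 f ω * g ω‖ ∂μ : ℝ) : 𝕜) := by
      rw [(h u).2, ← integral_ofReal]
      refine integral_congr_ae ?_
      filter_upwards [hu] with ω hω
      rw [hω, Pi.mul_apply, mul_assoc, ← conjSign_mul_self]
    calc ∫⁻ ω, ‖E.toL0 f ω * g ω‖ₑ ∂μ = ‖φ u‖ₑ := by
          rw [← ofReal_integral_norm_eq_lintegral_enorm (h f).1, hval, ← ofReal_norm,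
            RCLike.norm_ofReal, abs_of_nonneg (integral_nonneg fun ω => norm_nonneg _)]
      _ ≤ ‖φ‖ₑ * ‖u‖ₑ := φ.le_opENorm u
      _ ≤ ‖φ‖ₑ * 1 := by
          gcongr
          rw [← enorm_one (G := ℝ)]
          refine enorm_le_iff_norm_le.2 ?_
          rw [norm_one]
          exact hun.trans hf
      _ = ‖φ‖ₑ := mul_one _
  refine le_antisymm hle ?_
  have hfin : E.koetheNorm.toFun g ≠ ∞ := (hle.trans_lt enorm_lt_top).ne
  have : ‖φ‖ ≤ (E.koetheNorm.toFun g).toReal := by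
    refine φ.opNorm_le_bound ENNReal.toReal_nonneg fun f => ?_
    have h1 : ‖φ f‖ₑ ≤ E.koetheNorm.toFun g * ‖f‖ₑ := by
      rw [(h f).2]
      exact (enorm_integral_le_lintegral_enorm _).trans (lintegral_mul_le_koetheNorm f g)
    have h2 := ENNReal.toReal_mono (ENNReal.mul_ne_top hfin enorm_ne_top) h1
    rwa [ENNReal.toReal_mul, toReal_enorm, toReal_enorm] at h2
  rw [← ofReal_norm, ← ENNReal.ofReal_toReal hfin]
  exact ENNReal.ofReal_le_ofReal this

/-- Functions in the Köthe dual are determined by their integrals against `E`: their difference has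
Köthe norm `0`, and `E` contains a function that vanishes almost nowhere. -/
lemma FatouProperty.eq_of_forall_integral_eq [SigmaFinite μ] (hF : E.FatouProperty)
    {g g' : Ω →ₘ[μ] 𝕜}
    (h : ∀ f : E, Integrable (fun ω => E.toL0 f ω * g ω) μ)
    (h' : ∀ f : E, Integrable (fun ω => E.toL0 f ω * g' ω) μ)
    (heq : ∀ f : E, ∫ ω, E.toL0 f ω * g ω ∂μ = ∫ ω, E.toL0 f ω * g' ω ∂μ) : g = g' := by
  obtain ⟨w, hw⟩ := hF.exists_weak_unit
  have hsub : ∀ f : E, (fun ω => E.toL0 f ω * (g - g') ω) =ᵐ[μ]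
      fun ω => E.toL0 f ω * g ω - E.toL0 f ω * g' ω := fun f => by
    filter_upwards [AEEqFun.coeFn_sub g g'] with ω hω
    rw [hω, Pi.sub_apply, mul_sub]
  have h0 : E.koetheNorm.toFun (g - g') = 0 := by
    have hz : ‖(0 : StrongDual 𝕜 E)‖ₑ = 0 := by rw [← ofReal_norm, norm_zero, ENNReal.ofReal_zero]
    rw [← hz]
    refine koetheNorm_eq_enorm fun f => ⟨(integrable_congr (hsub f)).2 ((h f).sub (h' f)), ?_⟩
    rw [integral_congr_ae (hsub f), integral_sub (h f) (h' f), heq f, sub_self]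
    rfl
  have h1 := lintegral_mul_le_koetheNorm w (g - g')
  rw [h0, zero_mul, nonpos_iff_eq_zero] at h1
  replace h1 := (lintegral_eq_zero_iff'
    ((E.toL0 w).aestronglyMeasurable.mul (g - g').aestronglyMeasurable).enorm).1 h1
  refine AEEqFun.ext ?_
  filter_upwards [h1, hw, AEEqFun.coeFn_sub g g'] with ω a b c
  have : E.toL0 w ω * (g - g') ω = 0 := by simpa using a
  rw [c, Pi.sub_apply] at this
  exact sub_eq_zero.1 ((mul_eq_zero.1 this).resolve_left b)

end BanachFunctionSpace

end Mixed

section Structured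

variable {𝕜 : Type*} [RCLike 𝕜] {Ω : Type*} [MeasurableSpace Ω] {μ : Measure Ω}
  {X : Type*} [NormedAddCommGroup X] [NormedSpace 𝕜 X]

/-- `(J⁻¹)'` is a well-defined isometry of `X'` into the Köthe dual `E'`. -/
theorem dualStructured_graph [SigmaFinite μ] {E : BanachFunctionSpace 𝕜 μ}
    (hF : E.FatouProperty) (hA : E.AbsolutelyContinuousNorm) (J : X ≃ₗᵢ[𝕜] E)
    (φ : StrongDual 𝕜 X) : (∃! g, (φ, g) ∈ (dualStructured E J).graph) ∧
      ∀ g, (φ, g) ∈ (dualStructured E J).graph → E.koetheNorm.toFun g = ‖φ‖ₑ := by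
  let φ' : StrongDual 𝕜 E := φ.comp (J.symm.toContinuousLinearEquiv : E →L[𝕜] X)
  have hφ' : ‖φ'‖ = ‖φ‖ := φ.opNorm_comp_linearIsometryEquiv J.symm
  refine ⟨?_, fun g hg => ?_⟩
  · obtain ⟨g, hg⟩ := BanachFunctionSpace.exists_koethe_representation hF hA φ'
    refine ⟨g, hg, fun g' hg' => ?_⟩
    exact hF.eq_of_forall_integral_eq (fun f => (hg' f).1) (fun f => (hg f).1)
      fun f => (hg' f).2.symm.trans (hg f).2
  · rw [BanachFunctionSpace.koetheNorm_eq_enorm (φ := φ') hg, ← ofReal_norm, hφ', ofReal_norm]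

end Structured

/-! ### Sequence norms and norming sequences -/

/-- The properties of the norm of `E(ℓ^q(ℤ))`, `q < ∞`, transported to sequences in a normed
space `X`: an extended seminorm (so, finite on a subspace only) that decreases under
multiplication by bounded sequences, is invariant under permutations of `ℤ`, is controlled by the
`ℓ¹`-norm on multiples of one vector, and for which finitely supported sequences are dense. -/
structure IsSequenceNorm {𝕜 : Type*} [RCLike 𝕜] {X : Type*} [NormedAddCommGroup X]
    [NormedSpace 𝕜 X] (P : (ℤ → X) → ℝ≥0∞) : Prop where
  add_le : ∀ x y, P (x + y) ≤ P x + P y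
  smul_le : ∀ (c : 𝕜) x, P (c • x) ≤ ‖c‖ₑ * P x
  mul_le : ∀ (c : ℤ → 𝕜) x, (∀ j, ‖c j‖ ≤ 1) → P (fun j => c j • x j) ≤ P x
  comp_equiv_le : ∀ x (σ : Equiv.Perm ℤ), P (fun j => x (σ j)) ≤ P x
  const_le : ∀ (c : ℤ → 𝕜) x, P (fun j => c j • x) ≤ (∑' j, ‖c j‖ₑ) * ‖x‖ₑ
  tail : ∀ x, P x ≠ ∞ → ∀ ε : ℝ≥0∞, 0 < ε →
    ∃ s : Finset ℤ, P (fun j => if j ∈ s then 0 else x j) ≤ ε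

/-- `Q` is the norm on sequences of functionals that is dual to `P`: Hölder's inequality holds, and
`Q φ` is the smallest constant in the bound for finite partial sums of `∑ j, φ j (x j)`. -/
structure IsDualSequenceNorm {𝕜 : Type*} [RCLike 𝕜] {X : Type*} [NormedAddCommGroup X]
    [NormedSpace 𝕜 X] (P : (ℤ → X) → ℝ≥0∞) (Q : (ℤ → StrongDual 𝕜 X) → ℝ≥0∞) : Prop where
  holder : ∀ φ x, Q φ ≠ ∞ → P x ≠ ∞ → ∑' j, ‖φ j (x j)‖ₑ ≤ Q φ * P x
  le_of_forall : ∀ φ (C : ℝ≥0∞), (∀ (s : Finset ℤ) x, P x ≠ ∞ →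
    ‖∑ j ∈ s, φ j (x j)‖ₑ ≤ C * P x) → Q φ ≤ C

section Selection

variable {𝕜 : Type*} [RCLike 𝕜] {Ω : Type*} [MeasurableSpace Ω]

/-- Measurable choice of a norming sequence in `ℓ¹`: the coefficients are concentrated at one index
at which `‖G j ω‖` is maximal. -/
lemma exists_norming_one (G : ℤ → Ω → 𝕜) (hG : ∀ j, Measurable (G j)) (s : Finset ℤ) :
    ∃ (a : ℤ → Ω → 𝕜) (r : Ω → ℝ), (∀ j, Measurable (a j)) ∧ Measurable r ∧ (∀ ω, 0 ≤ r ω) ∧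
      (∀ ω, ∑ j ∈ s, a j ω * G j ω = ((r ω : ℝ) : 𝕜)) ∧ (∀ ω, ∑ j ∈ s, ‖a j ω‖ ≤ 1) ∧
      (∀ ω, ∀ j ∈ s, ‖G j ω‖ ≤ r ω) := by
  classical
  induction s using Finset.induction_on with
  | empty =>
    exact ⟨fun _ _ => 0, fun _ => 0, fun _ => measurable_const, measurable_const, by simp, by simp,
      by simp, by simp⟩
  | insert i s hi ih =>
    obtain ⟨a, r, ha, hr, hr0, hsum, hle, hdom⟩ := ih
    let A : Set Ω := {ω | r ω ≤ ‖G i ω‖}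
    have hA : MeasurableSet A := measurableSet_le hr (hG i).norm
    obtain ⟨b, hbi, hbj⟩ : ∃ b : ℤ → Ω → 𝕜, (b i = A.indicator fun ω => conjSign (G i ω)) ∧
        ∀ j, j ≠ i → b j = Aᶜ.indicator (a j) :=
      ⟨fun j => if j = i then A.indicator fun ω => conjSign (G i ω) else Aᶜ.indicator (a j),
        if_pos rfl, fun j hj => if_neg hj⟩
    refine ⟨b, fun ω => max (r ω) ‖G i ω‖, fun j => ?_, hr.max (hG i).norm,
      fun ω => (hr0 ω).trans (le_max_left _ _), fun ω => ?_, fun ω => ?_, fun ω j hj => ?_⟩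
    · rcases eq_or_ne j i with rfl | hj
      · rw [hbi]
        exact (measurable_conjSign.comp (hG j)).indicator hA
      · rw [hbj j hj]
        exact (ha j).indicator hA.compl
    · have hne : ∀ j ∈ s, j ≠ i := fun j hj h => hi (h ▸ hj)
      rw [Finset.sum_insert hi, Finset.sum_congr rfl fun j hj => by rw [hbj j (hne j hj)],
        hbi]
      by_cases hω : ω ∈ A
      · have h' : ω ∉ Aᶜ := fun h => h hω
        simp only [Set.indicator_of_mem hω, Set.indicator_of_notMem h', zero_mul,
          Finset.sum_const_zero, add_zero]
        rw [conjSign_mul_self, max_eq_right hω]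
      · have h' : ω ∈ Aᶜ := hω
        simp only [Set.indicator_of_notMem hω, Set.indicator_of_mem h', zero_mul, zero_add]
        rw [hsum, max_eq_left (not_le.1 hω).le]
    · have hne : ∀ j ∈ s, j ≠ i := fun j hj h => hi (h ▸ hj)
      rw [Finset.sum_insert hi, Finset.sum_congr rfl fun j hj => by rw [hbj j (hne j hj)],
        hbi]
      by_cases hω : ω ∈ A
      · have h' : ω ∉ Aᶜ := fun h => h hω
        simp only [Set.indicator_of_mem hω, Set.indicator_of_notMem h', norm_zero,
          Finset.sum_const_zero, add_zero]
        exact norm_conjSign_le _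
      · have h' : ω ∈ Aᶜ := hω
        simp only [Set.indicator_of_notMem hω, Set.indicator_of_mem h', norm_zero, zero_add]
        exact hle ω
    · rcases Finset.mem_insert.1 hj with rfl | hj
      · exact le_max_right _ _
      · exact (hdom ω j hj).trans (le_max_left _ _)

/-- Measurable choice of a norming sequence: for measurable `G j`, `j ∈ s`, there are measurable
coefficients `a j` with `‖a‖_{ℓ^q} ≤ 1` and `‖G‖_{ℓ^q'} ≤ ∑ j ∈ s, a j * G j`. -/
lemma exists_norming {q q' : ℝ≥0∞} (hq : q ≠ ∞) (hqq' : q.HolderConjugate q')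
    (G : ℤ → Ω → 𝕜) (hG : ∀ j, Measurable (G j)) (s : Finset ℤ) :
    ∃ (a : ℤ → Ω → 𝕜) (r : Ω → ℝ), (∀ j, Measurable (a j)) ∧ (∀ ω, 0 ≤ r ω) ∧
      (∀ ω, ∑ j ∈ s, a j ω * G j ω = ((r ω : ℝ) : 𝕜)) ∧
      (∀ ω, eLpNorm (fun j => if j ∈ s then a j ω else 0) q Measure.count ≤ 1) ∧
      (∀ ω, eLpNorm (fun j => if j ∈ s then G j ω else 0) q' Measure.count ≤
        ENNReal.ofReal (r ω)) := by
  have hq1 : 1 ≤ q := ENNReal.HolderConjugate.one_le q q'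
  have hq0 : q ≠ 0 := (zero_lt_one.trans_le hq1).ne'
  rcases eq_or_ne q' ∞ with rfl | hq'
  · have : q = 1 := by
      have := hqq'.symm.unique (p := ∞) (q := q) (q' := 1)
      exact this
    subst this
    obtain ⟨a, r, ha, -, hr0, hsum, hle, hdom⟩ := exists_norming_one G hG s
    refine ⟨a, r, ha, hr0, hsum, fun ω => ?_, fun ω => ?_⟩
    · rw [eLpNorm_count_eq one_ne_zero ENNReal.one_ne_top, tsum_eq_sum (s := s)]
      · simp only [ENNReal.toReal_one, ENNReal.rpow_one, div_one]
        rw [Finset.sum_congr rfl fun j hj => by rw [if_pos hj, ← ofReal_norm],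
          ← ENNReal.ofReal_sum_of_nonneg fun j _ => norm_nonneg _]
        exact ENNReal.ofReal_le_one.2 (hle ω)
      · intro j hj
        simp [hj]
    · rw [eLpNorm_count_top]
      refine iSup_le fun j => ?_
      split_ifs with hj
      · rw [← ofReal_norm]
        exact ENNReal.ofReal_le_ofReal (hdom ω j hj)
      · simp
  · have hconj : q.toReal.HolderConjugate q'.toReal :=
      ENNReal.HolderConjugate.toReal_of_ne_top hq hq'
    have hq'0 : q' ≠ 0 :=
      (zero_lt_one.trans_le (ENNReal.HolderConjugate.one_le q' q)).ne'
    set p := q.toReal with hp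
    set p' := q'.toReal with hp'
    have hp0 : 0 < p := hconj.pos
    have hp'0 : 0 < p' := hconj.symm.pos
    have hp'1 : 0 < p' - 1 := by linarith [hconj.symm.lt]
    let S : Ω → ℝ := fun ω => ∑ j ∈ s, ‖G j ω‖ ^ p'
    have hS : Measurable S := Finset.measurable_sum _ fun j _ => (hG j).norm.pow_const _
    have hS0 : ∀ ω, 0 ≤ S ω := fun ω => Finset.sum_nonneg fun j _ => by positivity
    have hnorma : ∀ j ω, ‖conjSign (G j ω) * ((‖G j ω‖ ^ (p' - 1) * S ω ^ (-(1 / p)) : ℝ) : 𝕜)‖ ≤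
        ‖G j ω‖ ^ (p' - 1) * S ω ^ (-(1 / p)) := fun j ω => by
      have h0 : 0 ≤ ‖G j ω‖ ^ (p' - 1) * S ω ^ (-(1 / p)) :=
        mul_nonneg (by positivity) (Real.rpow_nonneg (hS0 ω) _)
      rw [norm_mul, RCLike.norm_ofReal, abs_of_nonneg h0]
      exact mul_le_of_le_one_left h0 (norm_conjSign_le _)
    -- The equality case of Hölder's inequality; where `S ω = 0`, the coefficients vanish, since
    -- `0 ^ (-(1 / p)) = 0`.
    refine ⟨fun j ω => conjSign (G j ω) * ((‖G j ω‖ ^ (p' - 1) * S ω ^ (-(1 / p)) : ℝ) : 𝕜),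
      fun ω => S ω * S ω ^ (-(1 / p)), fun j => ?_,
      fun ω => mul_nonneg (hS0 ω) (Real.rpow_nonneg (hS0 ω) _), fun ω => ?_, fun ω => ?_,
      fun ω => ?_⟩
    · exact (measurable_conjSign.comp (hG j)).mul (RCLike.continuous_ofReal.measurable.comp
        (((hG j).norm.pow_const _).mul (hS.pow_const _)))
    · have : ∀ j, conjSign (G j ω) * ((‖G j ω‖ ^ (p' - 1) * S ω ^ (-(1 / p)) : ℝ) : 𝕜) * G j ω =
          ((‖G j ω‖ ^ p' * S ω ^ (-(1 / p)) : ℝ) : 𝕜) := by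
        intro j
        rw [mul_right_comm, conjSign_mul_self, ← RCLike.ofReal_mul, ← mul_assoc]
        congr 2
        rcases eq_or_ne ‖G j ω‖ 0 with h | h
        · rw [h, zero_mul, Real.zero_rpow hp'0.ne']
        · have hpos : 0 < ‖G j ω‖ := (norm_nonneg _).lt_of_ne' h
          nth_rw 1 [← Real.rpow_one ‖G j ω‖]
          rw [← Real.rpow_add hpos]
          congr 1
          ring
      simp only [this]
      rw [← RCLike.ofReal_sum, Finset.sum_mul]
    · rw [eLpNorm_count_eq hq0 hq]
      refine ENNReal.rpow_le_one ?_ (by positivity)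
      rw [tsum_eq_sum (s := s)]
      swap
      · intro j hj
        simp only [hj, if_false, enorm_zero]
        exact ENNReal.zero_rpow_of_pos hp0
      have hterm : ∀ j ∈ s, ‖if j ∈ s then
          conjSign (G j ω) * ((‖G j ω‖ ^ (p' - 1) * S ω ^ (-(1 / p)) : ℝ) : 𝕜) else 0‖ₑ ^ q.toReal ≤
          ENNReal.ofReal (‖G j ω‖ ^ p' * (S ω)⁻¹) := by
        intro j hj
        rw [if_pos hj, ← ofReal_norm, ENNReal.ofReal_rpow_of_nonneg (norm_nonneg _) hp0.le]
        refine ENNReal.ofReal_le_ofReal ?_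
        refine (Real.rpow_le_rpow (norm_nonneg _) (hnorma j ω) hp0.le).trans (le_of_eq ?_)
        rw [Real.mul_rpow (by positivity) (Real.rpow_nonneg (hS0 ω) _), ← Real.rpow_mul
          (norm_nonneg _), ← Real.rpow_mul (hS0 ω), hconj.symm.sub_one_mul_conj]
        congr 1
        rw [neg_mul, one_div_mul_cancel hp0.ne', Real.rpow_neg_one]
      refine (Finset.sum_le_sum hterm).trans ?_
      rw [← ENNReal.ofReal_sum_of_nonneg fun j _ =>
        mul_nonneg (by positivity) (inv_nonneg.2 (hS0 ω)), ← Finset.sum_mul]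
      exact ENNReal.ofReal_le_one.2 (mul_inv_le_one)
    · rw [eLpNorm_count_eq hq'0 hq', tsum_eq_sum (s := s)]
      swap
      · intro j hj
        simp only [hj, if_false, enorm_zero]
        exact ENNReal.zero_rpow_of_pos hp'0
      have hterm : ∀ j ∈ s, ‖if j ∈ s then G j ω else 0‖ₑ ^ q'.toReal =
          ENNReal.ofReal (‖G j ω‖ ^ p') := by
        intro j hj
        rw [if_pos hj, ← ofReal_norm, ENNReal.ofReal_rpow_of_nonneg (norm_nonneg _) hp'0.le]
      rw [Finset.sum_congr rfl hterm, ← ENNReal.ofReal_sum_of_nonneg fun j _ => by positivity,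
        ENNReal.ofReal_rpow_of_nonneg (hS0 ω) (by positivity)]
      refine ENNReal.ofReal_le_ofReal ?_
      change S ω ^ (1 / p') ≤ S ω * S ω ^ (-(1 / p))
      rcases eq_or_ne (S ω) 0 with h | h
      · rw [h, zero_mul, Real.zero_rpow (by positivity)]
      · have hpos : 0 < S ω := (hS0 ω).lt_of_ne' h
        nth_rw 2 [← Real.rpow_one (S ω)]
        rw [← Real.rpow_add hpos]
        refine le_of_eq ?_
        congr 1
        have := hconj.inv_add_inv_eq_one
        rw [one_div, one_div]
        linarith

end Selection

/-! ### The norms of `E(ℓ^q)` and `E'(ℓ^{q'})` -/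

section StructuredNorms

variable {𝕜 : Type*} [RCLike 𝕜] {Ω : Type*} [MeasurableSpace Ω] {μ : Measure Ω}
  {X : Type*} [NormedAddCommGroup X] [NormedSpace 𝕜 X] {E : BanachFunctionSpace 𝕜 μ}

open BanachFunctionSpace

/-- The norm of `(J (x j))_j` in `E(ℓ^q(ℤ))`. -/
def seqNorm (J : X ≃ₗᵢ[𝕜] E) (q : ℝ≥0∞) (x : ℤ → X) : ℝ≥0∞ :=
  E.functionNorm.mixed q fun j => E.toL0 (J (x j))

lemma exists_of_seqNorm_ne_top {J : X ≃ₗᵢ[𝕜] E} {q : ℝ≥0∞} {x : ℤ → X}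
    (hx : seqNorm J q x ≠ ∞) : ∃ f : E,
      (∀ᵐ ω ∂μ, ‖E.toL0 f ω‖ₑ = lqFun q (fun j => E.toL0 (J (x j))) ω) ∧
      ‖f‖ₑ = seqNorm J q x := by
  obtain ⟨h, hh, hval⟩ := E.functionNorm.exists_of_mixed_ne_top hx
  obtain ⟨f, rfl⟩ := exists_of_functionNorm_ne_top (hval.trans_ne hx)
  exact ⟨f, hh, by rw [← functionNorm_toL0, hval]; rfl⟩

lemma seqNorm_le {J : X ≃ₗᵢ[𝕜] E} {q : ℝ≥0∞} {x : ℤ → X} {f : E}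
    (h : ∀ᵐ ω ∂μ, lqFun q (fun j => E.toL0 (J (x j))) ω ≤ ‖E.toL0 f ω‖ₑ) :
    seqNorm J q x ≤ ‖f‖ₑ := by
  rw [← functionNorm_toL0]
  exact E.functionNorm.mixed_le h

/-- Absolute continuity of the norm and `q < ∞` make finitely supported sequences dense. -/
lemma isSequenceNorm_seqNorm (hA : E.AbsolutelyContinuousNorm) (J : X ≃ₗᵢ[𝕜] E) {q : ℝ≥0∞}
    (hq₁ : 1 ≤ q) (hq : q ≠ ∞) : IsSequenceNorm (𝕜 := 𝕜) (seqNorm J q) := by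
  have hq₀ : q ≠ 0 := (zero_lt_one.trans_le hq₁).ne'
  constructor
  · intro x y
    have e : (fun j => E.toL0 (J ((x + y) j))) =
        (fun j => E.toL0 (J (x j))) + fun j => E.toL0 (J (y j)) := by
      funext j
      simp only [Pi.add_apply, map_add]
    unfold seqNorm
    rw [e]
    exact E.functionNorm.mixed_add_le hq₁ _ _
  · intro c x
    have e : (fun j => E.toL0 (J ((c • x) j))) = c • fun j => E.toL0 (J (x j)) := by
      funext j
      simp only [Pi.smul_apply, map_smul]
    unfold seqNorm
    rw [e]
    exact E.functionNorm.mixed_smul_le q c _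
  · intro c x hc
    refine E.functionNorm.mixed_mono ?_
    have hsm : ∀ᵐ ω ∂μ, ∀ j, E.toL0 (J (c j • x j)) ω = c j * E.toL0 (J (x j)) ω :=
      ae_all_iff.2 fun j => by
        rw [map_smul]
        exact toL0_smul_ae (c j) (J (x j))
    filter_upwards [hsm] with ω h
    refine eLpNorm_count_mono fun j => ?_
    rw [h, norm_mul]
    exact mul_le_of_le_one_left (norm_nonneg _) (hc j)
  · intro x σ
    refine E.functionNorm.mixed_mono (Eventually.of_forall fun ω => le_of_eq ?_)
    exact eLpNorm_count_comp_equiv hq₀ hq (fun j => E.toL0 (J (x j)) ω) σ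
  · intro c x
    rcases eq_or_ne (∑' j, ‖c j‖ₑ) ∞ with hc | hc
    · rcases eq_or_ne x 0 with rfl | hx
      · refine (seqNorm_le (f := 0) ?_).trans (by simp)
        filter_upwards [toL0_zero_ae (E := E)] with ω h
        simp only [lqFun, smul_zero, map_zero J, h, enorm_zero]
        exact le_of_eq eLpNorm_zero'
      · rw [hc, ENNReal.top_mul (by simpa using hx)]
        exact le_top
    · have hS : ‖((∑' j, ‖c j‖ₑ).toReal : 𝕜)‖ₑ = ∑' j, ‖c j‖ₑ := by
        rw [← ofReal_norm, RCLike.norm_ofReal, abs_of_nonneg ENNReal.toReal_nonneg,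
          ENNReal.ofReal_toReal hc]
      have hJ : ‖((∑' j, ‖c j‖ₑ).toReal : 𝕜) • J x‖ₑ = (∑' j, ‖c j‖ₑ) * ‖x‖ₑ := by
        rw [enorm_smul, hS, ← ofReal_norm (J x), J.norm_map, ofReal_norm]
      rw [← hJ]
      refine seqNorm_le ?_
      have hsm : ∀ᵐ ω ∂μ, ∀ j, E.toL0 (J (c j • x)) ω = c j * E.toL0 (J x) ω :=
        ae_all_iff.2 fun j => by
          rw [map_smul]
          exact toL0_smul_ae (c j) (J x)
      filter_upwards [hsm, toL0_smul_ae ((∑' j, ‖c j‖ₑ).toReal : 𝕜) (J x)] with ω h1 h2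
      have e : (fun j => E.toL0 (J (c j • x)) ω) = E.toL0 (J x) ω • c := by
        funext j
        rw [h1 j, Pi.smul_apply, smul_eq_mul, mul_comm]
      unfold lqFun
      rw [e, eLpNorm_const_smul, h2, enorm_mul, mul_comm, hS]
      gcongr
      exact eLpNorm_count_le_tsum hq₁ hq c
  · intro x hx ε hε
    obtain ⟨f, hf, -⟩ := exists_of_seqNorm_ne_top hx
    -- Pointwise, the tails tend to `0` along an exhausting sequence of finite sets, and they are
    -- dominated by `f`.
    obtain ⟨s, hs⟩ := exists_seq_tendsto (atTop : Filter (Finset ℤ))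
    have htail : ∀ n, ∃ g : E, ∀ᵐ ω ∂μ, ‖E.toL0 g ω‖ₑ =
        lqFun q (fun j => E.toL0 (J (if j ∈ s n then 0 else x j))) ω ∧
        ‖E.toL0 g ω‖ ≤ ‖E.toL0 f ω‖ := by
      intro n
      have hle : ∀ᵐ ω ∂μ, lqFun q (fun j => E.toL0 (J (if j ∈ s n then 0 else x j))) ω ≤
          ‖E.toL0 f ω‖ₑ := by
        filter_upwards [hf, toL0_zero_ae (E := E)] with ω h h0
        rw [h]
        refine eLpNorm_count_mono fun j => ?_
        dsimp only
        split_ifs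
        · rw [map_zero J, h0, norm_zero]
          exact norm_nonneg _
        · exact le_rfl
      obtain ⟨k, hk⟩ := exists_enorm_eq (𝕜 := 𝕜) (aemeasurable_lqFun (μ := μ) q
        (fun j => E.toL0 (J (if j ∈ s n then 0 else x j))))
        (hle.mono fun ω hω => (hω.trans_lt enorm_lt_top).ne)
      obtain ⟨g, hg, -⟩ := exists_of_norm_le f k.aestronglyMeasurable (by
        filter_upwards [hle, hk] with ω h1 h2
        exact enorm_le_iff_norm_le.1 (h2.trans_le h1))
      refine ⟨g, ?_⟩
      filter_upwards [hle, hk, hg] with ω h1 h2 h3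
      rw [h3]
      exact ⟨h2, enorm_le_iff_norm_le.1 (h2.trans_le h1)⟩
    choose g hg using htail
    have hlim := hA.tendsto_norm_zero f g (fun n => (hg n).mono fun _ h => h.2) (by
      filter_upwards [ae_all_iff.2 hg, hf, toL0_zero_ae (E := E)] with ω h h' h0
      rw [tendsto_zero_iff_enorm_tendsto_zero]
      have hne : eLpNorm (fun j => E.toL0 (J (x j)) ω) q Measure.count ≠ ∞ :=
        (h'.symm.trans_lt enorm_lt_top).ne
      refine ((tendsto_eLpNorm_count_tail hq₀ hq hne).comp hs).congr fun n => ?_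
      rw [(h n).1]
      refine congrArg (fun a => eLpNorm a q Measure.count) (funext fun j => ?_)
      dsimp only
      split_ifs
      · rw [map_zero J, h0]
      · rfl)
    rw [← tendsto_zero_iff_norm_tendsto_zero, tendsto_zero_iff_enorm_tendsto_zero] at hlim
    obtain ⟨n, hn⟩ := (hlim.eventually_le_const hε).exists
    exact ⟨s n, (seqNorm_le ((hg n).mono fun ω h => h.1.ge)).trans hn⟩

/-- The dual of `E(ℓ^q(ℤ))` is `E'(ℓ^q'(ℤ))`: if `R φ` represents `φ`, then the norm of `E'(ℓ^q')`
is dual to the norm of `E(ℓ^q)`. -/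
lemma isDualSequenceNorm_koetheNorm [SigmaFinite μ] (hF : E.FatouProperty) (J : X ≃ₗᵢ[𝕜] E)
    {q q' : ℝ≥0∞} (hq : q ≠ ∞) (hqq' : q.HolderConjugate q')
    (R : StrongDual 𝕜 X → Ω →ₘ[μ] 𝕜) (hR : ∀ φ, (φ, R φ) ∈ (dualStructured E J).graph) :
    IsDualSequenceNorm (seqNorm J q) fun φ => E.koetheNorm.mixed q' fun j => R (φ j) := by
  have hq1' : 1 ≤ q' := ENNReal.HolderConjugate.one_le q' q
  have hq'0 : q' ≠ 0 := (zero_lt_one.trans_le hq1').ne'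
  have hint : ∀ (φ : StrongDual 𝕜 X) (f : E), Integrable (fun ω => E.toL0 f ω * R φ ω) μ :=
    fun φ f => (hR φ f).1
  have hval : ∀ (φ : StrongDual 𝕜 X) (x : X), φ x = ∫ ω, E.toL0 (J x) ω * R φ ω ∂μ := fun φ x => by
    have := (hR φ (J x)).2
    simpa using this
  constructor
  · intro φ x hφ hx
    obtain ⟨f, hf, hfn⟩ := exists_of_seqNorm_ne_top hx
    obtain ⟨k, hk, hkn⟩ := E.koetheNorm.exists_of_mixed_ne_top hφ
    rw [← hfn, ← hkn]
    calc ∑' j, ‖φ j (x j)‖ₑ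
        ≤ ∑' j, ∫⁻ ω, ‖E.toL0 (J (x j)) ω * R (φ j) ω‖ₑ ∂μ := by
          refine ENNReal.tsum_le_tsum fun j => ?_
          rw [hval]
          exact enorm_integral_le_lintegral_enorm _
      _ = ∫⁻ ω, ∑' j, ‖E.toL0 (J (x j)) ω * R (φ j) ω‖ₑ ∂μ :=
          (lintegral_tsum fun j => ((E.toL0 (J (x j))).aestronglyMeasurable.mul
            (R (φ j)).aestronglyMeasurable).enorm).symm
      _ ≤ ∫⁻ ω, ‖E.toL0 f ω * k ω‖ₑ ∂μ := by
          refine lintegral_mono_ae ?_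
          filter_upwards [hf, hk] with ω h1 h2
          rw [enorm_mul, h1, h2]
          exact tsum_enorm_mul_le (q := q) (q' := q') _ _
      _ ≤ _ := lintegral_mul_le_koetheNorm f k
  · intro φ C hC
    let G : ℤ → Ω → 𝕜 := fun j => R (φ j)
    have hG : ∀ j, Measurable (G j) := fun j => (R (φ j)).stronglyMeasurable.measurable
    -- For `s` finite and a norming sequence `a`, the bound on partial sums is applied to the
    -- sequence `|f| a j`, whose norm in `E(ℓ^q)` is at most `‖f‖`.
    have key : ∀ f : E, ∫⁻ ω, ‖E.toL0 f ω‖ₑ * lqFun q' (fun j => R (φ j)) ω ∂μ ≤ C * ‖f‖ₑ := by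
      intro f
      have hcut : ∀ s : Finset ℤ,
          AEMeasurable (fun ω => ‖E.toL0 f ω‖ₑ *
            eLpNorm (fun j => if j ∈ s then G j ω else 0) q' Measure.count) μ := by
        intro s
        have h1 := aemeasurable_lqFun (μ := μ) q' fun j => if j ∈ s then R (φ j) else 0
        refine (E.toL0 f).aestronglyMeasurable.enorm.mul (h1.congr ?_)
        filter_upwards [AEEqFun.coeFn_zero (β := 𝕜) (μ := μ) (α := Ω)] with ω h
        refine congrArg (fun a => eLpNorm a q' Measure.count) (funext fun j => ?_)
        dsimp only
        split_ifs
        · rfl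
        · exact h
      have hsup : ∀ ω, ‖E.toL0 f ω‖ₑ * lqFun q' (fun j => R (φ j)) ω =
          ⨆ s : Finset ℤ, ‖E.toL0 f ω‖ₑ *
            eLpNorm (fun j => if j ∈ s then G j ω else 0) q' Measure.count := fun ω => by
        rw [← ENNReal.mul_iSup, ← eLpNorm_count_eq_iSup hq'0 fun j => G j ω]
        rfl
      have hdir : Directed (· ≤ ·) fun (s : Finset ℤ) (ω : Ω) => ‖E.toL0 f ω‖ₑ *
            eLpNorm (fun j => if j ∈ s then G j ω else 0) q' Measure.count := by
        refine Monotone.directed_le fun s t hst ω => ?_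
        dsimp only
        gcongr
        refine eLpNorm_count_mono fun j => ?_
        by_cases hj : j ∈ s
        · rw [if_pos hj, if_pos (hst hj)]
        · rw [if_neg hj, norm_zero]
          exact norm_nonneg _
      simp only [hsup]
      rw [lintegral_iSup_directed hcut hdir]
      refine iSup_le fun s => ?_
      obtain ⟨a, r, ha, hr0, hsum, ha_le, hG_le⟩ := exists_norming hq hqq' G hG s
      have ha1 : ∀ j ∈ s, ∀ ω, ‖a j ω‖ ≤ 1 := by
        intro j hj ω
        have h1 : ‖a j ω‖ₑ ≤ 1 := by
          refine le_trans ?_ (ha_le ω)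
          have h2 := eLpNorm_count_single (q := q)
            (zero_lt_one.trans_le (ENNReal.HolderConjugate.one_le q q')).ne' hq
            (fun i => if i = j then a j ω else 0) j (fun i hi => if_neg hi)
          rw [if_pos rfl] at h2
          rw [← h2]
          refine eLpNorm_count_mono fun i => ?_
          by_cases hi : i = j
          · rw [if_pos hi, hi, if_pos hj]
          · rw [if_neg hi, norm_zero]
            exact norm_nonneg _
        rw [← enorm_one (G := ℝ)] at h1
        simpa using enorm_le_iff_norm_le.1 h1
      have hmem : ∀ j, ∃ u : E, E.toL0 u =ᵐ[μ]
          fun ω => if j ∈ s then ((‖E.toL0 f ω‖ : ℝ) : 𝕜) * a j ω else 0 := by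
        intro j
        by_cases hj : j ∈ s
        · simp only [hj, if_true]
          obtain ⟨u, hu, -⟩ := exists_of_norm_le f
            ((RCLike.continuous_ofReal.comp_aestronglyMeasurable
              (E.toL0 f).aestronglyMeasurable.norm).mul (ha j).aestronglyMeasurable)
            (Eventually.of_forall fun ω => by
              rw [Pi.mul_apply, norm_mul, RCLike.norm_ofReal, abs_norm]
              exact mul_le_of_le_one_right (norm_nonneg _) (ha1 j hj ω))
          exact ⟨u, hu⟩
        · simp only [hj, if_false]
          exact ⟨0, toL0_zero_ae⟩
      choose u hu using hmem
      have hP : seqNorm J q (fun j => J.symm (u j)) ≤ ‖f‖ₑ := by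
        refine seqNorm_le ?_
        filter_upwards [ae_all_iff.2 hu] with ω h
        have e : (fun j => E.toL0 (J (J.symm (u j))) ω) =
            ((‖E.toL0 f ω‖ : ℝ) : 𝕜) • fun j => if j ∈ s then a j ω else 0 := by
          funext j
          rw [J.apply_symm_apply, h j, Pi.smul_apply, smul_eq_mul]
          split_ifs <;> simp
        unfold lqFun
        rw [e, eLpNorm_const_smul]
        refine (mul_le_mul_right (ha_le ω) _).trans (le_of_eq ?_)
        rw [mul_one, ← ofReal_norm, RCLike.norm_ofReal, abs_norm, ofReal_norm]
      have hsumval : ∑ j ∈ s, φ j (J.symm (u j)) =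
          ∫ ω, ((‖E.toL0 f ω‖ * r ω : ℝ) : 𝕜) ∂μ := by
        have h1 : ∀ j ∈ s, φ j (J.symm (u j)) = ∫ ω, E.toL0 (u j) ω * R (φ j) ω ∂μ :=
          fun j _ => (hR (φ j) (u j)).2
        rw [Finset.sum_congr rfl h1, ← integral_finsetSum s fun j _ => hint (φ j) (u j)]
        refine integral_congr_ae ?_
        filter_upwards [ae_all_iff.2 hu] with ω h
        rw [RCLike.ofReal_mul, ← hsum ω, Finset.mul_sum]
        refine Finset.sum_congr rfl fun j hj => ?_
        rw [h j, if_pos hj, mul_assoc]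
      have hI : Integrable (fun ω => ((‖E.toL0 f ω‖ * r ω : ℝ) : 𝕜)) μ := by
        refine (integrable_finsetSum s fun j _ => hint (φ j) (u j)).congr ?_
        filter_upwards [ae_all_iff.2 hu] with ω h
        rw [RCLike.ofReal_mul, ← hsum ω, Finset.mul_sum]
        refine Finset.sum_congr rfl fun j hj => ?_
        rw [h j, if_pos hj, mul_assoc]
      have hnn : ∀ ω, 0 ≤ ‖E.toL0 f ω‖ * r ω := fun ω => mul_nonneg (norm_nonneg _) (hr0 ω)
      calc ∫⁻ ω, ‖E.toL0 f ω‖ₑ * eLpNorm (fun j => if j ∈ s then G j ω else 0) q' Measure.count ∂μ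
          ≤ ∫⁻ ω, ‖((‖E.toL0 f ω‖ * r ω : ℝ) : 𝕜)‖ₑ ∂μ := by
            refine lintegral_mono fun ω => ?_
            dsimp only
            rw [← ofReal_norm ((‖E.toL0 f ω‖ * r ω : ℝ) : 𝕜), RCLike.norm_ofReal,
              abs_of_nonneg (hnn ω), ENNReal.ofReal_mul (norm_nonneg _), ofReal_norm]
            gcongr
            exact hG_le ω
        _ = ‖∑ j ∈ s, φ j (J.symm (u j))‖ₑ := by
            rw [← ofReal_integral_norm_eq_lintegral_enorm hI, hsumval, integral_ofReal,
              ← ofReal_norm, RCLike.norm_ofReal, abs_of_nonneg (integral_nonneg hnn)]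
            congr 1
            refine integral_congr_ae (Eventually.of_forall fun ω => ?_)
            dsimp only
            rw [RCLike.norm_ofReal, abs_of_nonneg (hnn ω)]
        _ ≤ C * seqNorm J q (fun j => J.symm (u j)) :=
            hC s _ (hP.trans_lt enorm_lt_top).ne
        _ ≤ C * ‖f‖ₑ := by gcongr
    rcases eq_or_ne C ∞ with rfl | hCtop
    · exact le_top
    obtain ⟨w, hw⟩ := hF.exists_weak_unit
    -- A weak unit turns the bound into finiteness almost everywhere.
    have hfin : ∀ᵐ ω ∂μ, lqFun q' (fun j => R (φ j)) ω ≠ ∞ := by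
      have h1 := ae_lt_top' ((E.toL0 w).aestronglyMeasurable.enorm.mul
        (aemeasurable_lqFun q' fun j => R (φ j)))
        ((key w).trans_lt (ENNReal.mul_lt_top hCtop.lt_top enorm_lt_top)).ne
      filter_upwards [h1, hw] with ω h1 h2 h3
      rw [Pi.mul_apply, h3, ENNReal.mul_top (by simpa using h2)] at h1
      exact h1.ne rfl
    obtain ⟨k, hk⟩ := exists_enorm_eq (𝕜 := 𝕜) (aemeasurable_lqFun q' fun j => R (φ j)) hfin
    refine (iInf₂_le k hk).trans (iSup₂_le fun f hf => ?_)
    calc ∫⁻ ω, ‖E.toL0 f ω * k ω‖ₑ ∂μ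
        = ∫⁻ ω, ‖E.toL0 f ω‖ₑ * lqFun q' (fun j => R (φ j)) ω ∂μ := by
          refine lintegral_congr_ae ?_
          filter_upwards [hk] with ω h
          rw [enorm_mul, h]
      _ ≤ C * ‖f‖ₑ := key f
      _ ≤ C * 1 := by
          gcongr
          rw [← enorm_one (G := ℝ)]
          refine enorm_le_iff_norm_le.2 ?_
          rw [norm_one]
          exact hf
      _ = C := mul_one C

end StructuredNorms

/-! ### Extension of functionals on sequence spaces -/

section HahnBanach

variable {𝕜 : Type*} [RCLike 𝕜] {M : Type*} [AddCommGroup M] [Module 𝕜 M]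

/-- Hahn–Banach for an extended seminorm `N`: a functional that is bounded on a subspace of
`{N < ∞}` extends to `M`, with the same bound on `{N < ∞}`. -/
lemma exists_extension_of_le_extended_seminorm (N : M → ℝ≥0∞) (hadd : ∀ x y, N (x + y) ≤ N x + N y)
    (hsmul : ∀ (c : 𝕜) x, N (c • x) ≤ ‖c‖ₑ * N x) (Z : Submodule 𝕜 M) (hZ : ∀ z ∈ Z, N z ≠ ∞)
    (ℓ : Z →ₗ[𝕜] 𝕜) {C : ℝ≥0∞} (hC : C ≠ ∞) (hℓ : ∀ z : Z, ‖ℓ z‖ₑ ≤ C * N z) :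
    ∃ L : M →ₗ[𝕜] 𝕜, (∀ z : Z, L z = ℓ z) ∧ ∀ m, N m ≠ ∞ → ‖L m‖ₑ ≤ C * N m := by
  have hzero : N 0 = 0 := by simpa using hsmul 0 0
  let W : Submodule 𝕜 M :=
    { carrier := {m | N m ≠ ∞}
      zero_mem' := by simp [hzero]
      add_mem' := fun {x y} hx hy =>
        ((hadd x y).trans_lt (ENNReal.add_lt_top.2 ⟨lt_top_iff_ne_top.2 hx,
          lt_top_iff_ne_top.2 hy⟩)).ne
      smul_mem' := fun c x hx =>
        ((hsmul c x).trans_lt (ENNReal.mul_lt_top enorm_lt_top (lt_top_iff_ne_top.2 hx))).ne }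
  have hW : ∀ m : W, N m ≠ ∞ := fun m => m.2
  let _ : SeminormedAddCommGroup W := AddGroupSeminorm.toSeminormedAddCommGroup
    { toFun := fun m => (N m).toReal
      map_zero' := by simp [hzero]
      add_le' := fun x y => by
        rw [← ENNReal.toReal_add (hW x) (hW y)]
        exact ENNReal.toReal_mono (ENNReal.add_ne_top.2 ⟨hW x, hW y⟩) (hadd x y)
      neg' := fun x => by
        have h : ∀ y : M, N (-y) ≤ N y := fun y => by simpa using hsmul (-1) y
        congr 1
        refine le_antisymm (h x) ?_
        simpa using h (-(x : M)) }
  have hnorm : ∀ m : W, ‖m‖ = (N m).toReal := fun _ => rfl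
  let _ : NormedSpace 𝕜 W :=
    { norm_smul_le := fun c x => by
        rw [hnorm, hnorm, ← toReal_enorm c, ← ENNReal.toReal_mul]
        exact ENNReal.toReal_mono (ENNReal.mul_ne_top enorm_ne_top (hW x)) (hsmul c x) }
  have hZW : Z ≤ W := hZ
  let ZW : Submodule 𝕜 W := Z.comap W.subtype
  let g : ZW →ₗ[𝕜] 𝕜 :=
    ℓ ∘ₗ LinearMap.codRestrict Z (W.subtype ∘ₗ ZW.subtype) fun z => z.2
  let f : StrongDual 𝕜 ZW := g.mkContinuous C.toReal fun z => by
    have h := ENNReal.toReal_mono (ENNReal.mul_ne_top hC (hZ _ z.2)) (hℓ ⟨z.1.1, z.2⟩)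
    rw [toReal_enorm, ENNReal.toReal_mul] at h
    exact h
  obtain ⟨F, hF, hFn⟩ := exists_extension_norm_eq ZW f
  obtain ⟨L, hL⟩ := LinearMap.exists_extend F.toLinearMap
  have hL' : ∀ m : W, L m = F m := fun m => LinearMap.congr_fun hL m
  refine ⟨L, fun z => ?_, fun m hm => ?_⟩
  · have h1 := hL' ⟨z.1, hZW z.2⟩
    have h2 := hF ⟨⟨z.1, hZW z.2⟩, z.2⟩
    exact h1.trans h2
  · have h1 : ‖F ⟨m, hm⟩‖ ≤ C.toReal * (N m).toReal :=
      F.le_of_opNorm_le (hFn.trans_le (g.mkContinuous_norm_le ENNReal.toReal_nonneg _)) _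
    rw [← hL' ⟨m, hm⟩] at h1
    rw [← ofReal_norm, ← ENNReal.ofReal_toReal (ENNReal.mul_ne_top hC hm), ENNReal.toReal_mul]
    exact ENNReal.ofReal_le_ofReal h1

end HahnBanach

section OneSpace

variable {𝕜 : Type*} [RCLike 𝕜] {X : Type*} [NormedAddCommGroup X] [NormedSpace 𝕜 X]
  {P : (ℤ → X) → ℝ≥0∞} {Q : (ℤ → StrongDual 𝕜 X) → ℝ≥0∞}

namespace IsSequenceNorm

lemma zero (hP : IsSequenceNorm (𝕜 := 𝕜) P) : P 0 = 0 := by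
  simpa using hP.smul_le 0 0

lemma single_le (hP : IsSequenceNorm (𝕜 := 𝕜) P) (i : ℤ) (x : X) :
    P (Pi.single i x) ≤ ‖x‖ₑ := by
  have h := hP.const_le (Pi.single i 1) x
  rw [tsum_eq_single i fun j hj => by simp [Pi.single_eq_of_ne hj]] at h
  have e : (fun j => (Pi.single i 1 : ℤ → 𝕜) j • x) = Pi.single i x := by
    funext j
    rcases eq_or_ne j i with rfl | hj
    · simp
    · simp [Pi.single_eq_of_ne hj]
  rw [e] at h
  simpa using h

end IsSequenceNorm

lemma hasSum_dual_apply {ι : Type*} {f : ι → StrongDual 𝕜 X} {g : StrongDual 𝕜 X}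
    (h : HasSum f g) (x : X) : HasSum (fun i => f i x) (g x) :=
  h.mapL (ContinuousLinearMap.apply 𝕜 𝕜 x)

namespace IsDualSequenceNorm

lemma enorm_le (hP : IsSequenceNorm (𝕜 := 𝕜) P) (hPQ : IsDualSequenceNorm P Q)
    {φ : ℤ → StrongDual 𝕜 X} (hφ : Q φ ≠ ∞) (j : ℤ) : ‖φ j‖ₑ ≤ Q φ := by
  have h : ‖φ j‖ ≤ (Q φ).toReal := by
    refine (φ j).opNorm_le_bound ENNReal.toReal_nonneg fun x => ?_
    have hx : P (Pi.single j x) ≠ ∞ := ((hP.single_le j x).trans_lt enorm_lt_top).ne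
    have h1 : ‖φ j x‖ₑ ≤ Q φ * ‖x‖ₑ := by
      refine le_trans ?_ ((hPQ.holder φ _ hφ hx).trans (mul_le_mul_right (hP.single_le j x) _))
      refine le_trans (le_of_eq ?_)
        (ENNReal.le_tsum (f := fun i => ‖φ i (Pi.single (M := fun _ : ℤ => X) j x i)‖ₑ) j)
      simp
    have h2 := ENNReal.toReal_mono (ENNReal.mul_ne_top hφ enorm_ne_top) h1
    rwa [ENNReal.toReal_mul, toReal_enorm, toReal_enorm] at h2
  rw [← ofReal_norm, ← ENNReal.ofReal_toReal hφ]
  exact ENNReal.ofReal_le_ofReal h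

/-- A functional on the sequences of finite norm is given by its coordinates, and these form a
sequence of finite dual norm. -/
lemma exists_coordinates (hP : IsSequenceNorm (𝕜 := 𝕜) P) (hPQ : IsDualSequenceNorm P Q)
    (L : (ℤ → X) →ₗ[𝕜] 𝕜) {C : ℝ≥0∞} (hC : C ≠ ∞) (hL : ∀ x, P x ≠ ∞ → ‖L x‖ₑ ≤ C * P x) :
    ∃ φ : ℤ → StrongDual 𝕜 X, Q φ ≤ C ∧ (∀ j x, φ j x = L (Pi.single j x)) ∧
      ∀ x, P x ≠ ∞ → HasSum (fun j => φ j (x j)) (L x) := by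
  let φ : ℤ → StrongDual 𝕜 X := fun j =>
    (L ∘ₗ LinearMap.single 𝕜 (fun _ : ℤ => X) j).mkContinuous C.toReal fun x => by
      have hx : P (Pi.single j x) ≠ ∞ := ((hP.single_le j x).trans_lt enorm_lt_top).ne
      have h1 := (hL _ hx).trans (mul_le_mul_right (hP.single_le j x) C)
      have h2 := ENNReal.toReal_mono (ENNReal.mul_ne_top hC enorm_ne_top) h1
      rwa [ENNReal.toReal_mul, toReal_enorm, toReal_enorm] at h2
  have hφ : ∀ j x, φ j x = L (Pi.single j x) := fun j x => rfl
  have hsum : ∀ (s : Finset ℤ) (x : ℤ → X),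
      ∑ j ∈ s, φ j (x j) = L (fun j => if j ∈ s then x j else 0) := by
    intro s x
    simp only [hφ]
    rw [← map_sum]
    congr 1
    funext j
    rw [Finset.sum_apply]
    simp [Pi.single_apply]
  have hcut : ∀ (s : Finset ℤ) (x : ℤ → X), P (fun j => if j ∈ s then x j else 0) ≤ P x := by
    intro s x
    have h := hP.mul_le (fun j => if j ∈ s then 1 else 0) x fun j => by split_ifs <;> simp
    simpa using h
  refine ⟨φ, hPQ.le_of_forall φ C fun s x hx => ?_, hφ, fun x hx => ?_⟩
  · rw [hsum]
    exact (hL _ ((hcut s x).trans_lt (lt_top_iff_ne_top.2 hx)).ne).trans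
      (mul_le_mul_right (hcut s x) C)
  · rw [HasSum, SummationFilter.unconditional_filter, EMetric.tendsto_atTop]
    intro ε hε
    obtain ⟨δ, hδ, hδε⟩ : ∃ δ : ℝ≥0∞, 0 < δ ∧ C * δ < ε := by
      have h : Tendsto (fun δ : ℝ≥0∞ => C * δ) (𝓝[>] 0) (𝓝 0) := by
        have := ENNReal.Tendsto.const_mul (a := C) (m := id) (f := 𝓝 0) tendsto_id (Or.inr hC)
        rw [mul_zero] at this
        exact this.mono_left nhdsWithin_le_nhds
      obtain ⟨δ, h1, h2⟩ := ((h.eventually_lt_const hε).and self_mem_nhdsWithin).exists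
      exact ⟨δ, h2, h1⟩
    obtain ⟨s₀, hs₀⟩ := hP.tail x hx δ hδ
    refine ⟨s₀, fun s hs => ?_⟩
    have hle : P (fun j => if j ∈ s then 0 else x j) ≤ δ := by
      refine le_trans ?_ hs₀
      have h := hP.mul_le (fun j => if j ∈ s then 0 else 1)
        (fun j => if j ∈ s₀ then 0 else x j) fun j => by split_ifs <;> simp
      refine le_trans (le_of_eq (congrArg P (funext fun j => ?_))) h
      by_cases hj : j ∈ s
      · simp [hj]
      · have : j ∉ s₀ := fun h => hj (hs h)
        simp [hj, this]
    have hle' : P (fun j => if j ∈ s then 0 else x j) ≠ ∞ := by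
      have h := hP.mul_le (fun j => if j ∈ s then 0 else 1) x fun j => by split_ifs <;> simp
      refine ne_top_of_le_ne_top hx (le_trans (le_of_eq (congrArg P (funext fun j => ?_))) h)
      by_cases hj : j ∈ s <;> simp [hj]
    rw [hsum, edist_comm, edist_eq_enorm_sub, ← map_sub]
    have e : (x - fun j => if j ∈ s then x j else 0) = fun j => if j ∈ s then 0 else x j := by
      funext j
      by_cases hj : j ∈ s <;> simp [hj]
    rw [e]
    exact ((hL _ hle').trans (mul_le_mul_right hle C)).trans_lt hδε

/-- Sequences `k ↦ ∑ m, c m • h (σ m k)` of functionals, with `c ∈ ℓ¹` and permutations `σ m`, have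
finite dual norm. -/
lemma tsum_smul_le (hP : IsSequenceNorm (𝕜 := 𝕜) P) (hPQ : IsDualSequenceNorm P Q)
    {h : ℤ → StrongDual 𝕜 X} (hh : Q h ≠ ∞) (c : ℕ → 𝕜) (hc : ∑' m, ‖c m‖ₑ ≠ ∞)
    (σ : ℕ → Equiv.Perm ℤ) :
    (∀ k, Summable fun m => c m • h (σ m k)) ∧
      Q (fun k => ∑' m, c m • h (σ m k)) ≤ (∑' m, ‖c m‖ₑ) * Q h := by
  have hs : ∀ k, Summable fun m => c m • h (σ m k) := by
    intro k
    have hfin : ∑' m, ‖c m • h (σ m k)‖ₑ ≠ ∞ := by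
      refine ne_top_of_le_ne_top (ENNReal.mul_ne_top hc hh) ?_
      rw [← ENNReal.tsum_mul_right]
      refine ENNReal.tsum_le_tsum fun m => ?_
      rw [enorm_smul]
      gcongr
      exact hPQ.enorm_le hP hh _
    have h1 : Summable fun m => ‖c m • h (σ m k)‖ := by
      simpa only [toReal_enorm] using ENNReal.summable_toReal hfin
    exact h1.of_norm
  refine ⟨hs, hPQ.le_of_forall _ _ fun s x hx => ?_⟩
  have happly : ∀ k, ‖(∑' m, c m • h (σ m k)) (x k)‖ₑ ≤ ∑' m, ‖c m‖ₑ * ‖h (σ m k) (x k)‖ₑ := by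
    intro k
    have h1 : HasSum (fun m => (c m • h (σ m k)) (x k)) ((∑' m, c m • h (σ m k)) (x k)) :=
      hasSum_dual_apply (hs k).hasSum (x k)
    rw [← h1.tsum_eq]
    refine enorm_tsum_le_tsum_enorm.trans (le_of_eq (tsum_congr fun m => ?_))
    simp only [smul_apply, enorm_smul]
  calc ‖∑ k ∈ s, (∑' m, c m • h (σ m k)) (x k)‖ₑ
      ≤ ∑ k ∈ s, ‖(∑' m, c m • h (σ m k)) (x k)‖ₑ := enorm_sum_le _ _
    _ ≤ ∑' k, ‖(∑' m, c m • h (σ m k)) (x k)‖ₑ := ENNReal.sum_le_tsum s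
    _ ≤ ∑' k, ∑' m, ‖c m‖ₑ * ‖h (σ m k) (x k)‖ₑ := ENNReal.tsum_le_tsum happly
    _ = ∑' m, ∑' k, ‖c m‖ₑ * ‖h (σ m k) (x k)‖ₑ := ENNReal.tsum_comm
    _ ≤ ∑' m, ‖c m‖ₑ * (Q h * P x) := by
        refine ENNReal.tsum_le_tsum fun m => ?_
        rw [ENNReal.tsum_mul_left]
        gcongr
        have hle := hP.comp_equiv_le x (σ m).symm
        have hne := ne_top_of_le_ne_top hx hle
        have h1 := (σ m).tsum_eq fun j => ‖h j (x ((σ m).symm j))‖ₑ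
        simp only [Equiv.symm_apply_apply] at h1
        rw [h1]
        exact (hPQ.holder h _ hh hne).trans (mul_le_mul_right hle _)
    _ = (∑' m, ‖c m‖ₑ) * Q h * P x := by rw [ENNReal.tsum_mul_right, mul_assoc]

/-- Hölder's inequality for a reflected and shifted sequence of functionals, with weights `a ^ j`
on both sides. -/
lemma tsum_enorm_reflect_le (hP : IsSequenceNorm (𝕜 := 𝕜) P) (hPQ : IsDualSequenceNorm P Q)
    {a : 𝕜} (ha : a ≠ 0) {ψ : ℤ → StrongDual 𝕜 X} {x : ℤ → X}
    (hψ : Q (fun k => a ^ k • ψ k) ≠ ∞) (hx : P (fun j => a ^ j • x j) ≠ ∞) (i : ℤ) :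
    ∑' j, ‖ψ (-j - i) (x j)‖ₑ ≤
      ‖a ^ i‖ₑ * (Q (fun k => a ^ k • ψ k) * P (fun j => a ^ j • x j)) := by
  let σ : Equiv.Perm ℤ := Equiv.subLeft (-i)
  have hσ : ∀ k, σ k = -k - i := fun k => by
    change -i - k = _
    ring
  have hle := hP.comp_equiv_le (fun j => a ^ j • x j) σ
  have hne := ne_top_of_le_ne_top hx hle
  calc ∑' j, ‖ψ (-j - i) (x j)‖ₑ = ∑' k, ‖ψ k (x (σ k))‖ₑ := by
        rw [← σ.tsum_eq]
        refine tsum_congr fun k => ?_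
        rw [hσ]
        congr 3
        ring
    _ = ∑' k, ‖a ^ i‖ₑ * ‖(a ^ k • ψ k) (a ^ σ k • x (σ k))‖ₑ := by
        refine tsum_congr fun k => ?_
        rw [smul_apply, map_smul, smul_smul, smul_eq_mul, ← enorm_mul,
          ← mul_assoc, ← zpow_add₀ ha, ← zpow_add₀ ha, hσ]
        congr 1
        rw [show i + (k + (-k - i)) = 0 by ring, zpow_zero, one_mul]
    _ ≤ _ := by
        rw [ENNReal.tsum_mul_left]
        gcongr
        exact (hPQ.holder _ _ hψ hne).trans (mul_le_mul_right hle _)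

end IsDualSequenceNorm

end OneSpace

/-! ### Decompositions in a couple and its dual couple -/

section TailSums

variable {𝕜 : Type*} [RCLike 𝕜] {X : Type*} [NormedAddCommGroup X] [NormedSpace 𝕜 X]
  {P : (ℤ → X) → ℝ≥0∞} {Q : (ℤ → StrongDual 𝕜 X) → ℝ≥0∞}

/-- The functionals `ψ k = ∑ m, φ (e m - k)`, `m ∈ ℕ`, for `φ j = a ^ j • h j`: with the weights
`a ^ k`, they are a convolution of `h` with the summable sequence `a ^ e m`. -/
lemma IsDualSequenceNorm.exists_hasSum_shift (hP : IsSequenceNorm (𝕜 := 𝕜) P)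
    (hPQ : IsDualSequenceNorm P Q) {a : 𝕜} (ha : a ≠ 0) {h : ℤ → StrongDual 𝕜 X} (hh : Q h ≠ ∞)
    (e : ℕ → ℤ) (he : ∑' m, ‖a ^ e m‖ₑ ≠ ∞) :
    ∃ ψ : ℤ → StrongDual 𝕜 X, Q (fun k => a ^ k • ψ k) ≤ (∑' m, ‖a ^ e m‖ₑ) * Q h ∧
      ∀ k, HasSum (fun m => a ^ (e m - k) • h (e m - k)) (ψ k) := by
  obtain ⟨hs, hQ⟩ := hPQ.tsum_smul_le hP hh (fun m => a ^ e m) he fun m => Equiv.subLeft (e m)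
  refine ⟨fun k => a ^ (-k) • ∑' m, a ^ e m • h (e m - k), ?_, fun k => ?_⟩
  · refine le_trans (le_of_eq (congrArg Q (funext fun k => ?_))) hQ
    rw [smul_smul, ← zpow_add₀ ha, add_neg_cancel, zpow_zero, one_smul]
    rfl
  · refine ((hs k).hasSum.const_smul (a ^ (-k))).congr_fun ?_
    intro m
    rw [smul_smul, ← zpow_add₀ ha, neg_add_eq_sub]
    rfl

lemma sub_eq_zero_apply_of_hasSum {G : Type*} [AddCommGroup G] [TopologicalSpace G]
    [IsTopologicalAddGroup G] [T2Space G] {f : ℕ → G} {s t : G} (ht : HasSum f t)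
    (hs : HasSum (fun m => f (m + 1)) s) : t - s = f 0 := by
  have h := ((hasSum_nat_add_iff 1).1 hs).unique ht
  rw [← h, Finset.sum_range_one, add_sub_cancel_left]

end TailSums

section Couple

variable {𝕜 : Type*} [RCLike 𝕜] {X₀ X₁ V : Type*}
  [NormedAddCommGroup X₀] [NormedSpace 𝕜 X₀] [NormedAddCommGroup X₁] [NormedSpace 𝕜 X₁]
  [AddCommGroup V] [Module 𝕜 V]

/-- The norm of a pair of sequences, with the weights `a ^ j` and `b ^ j`. -/
def coupleNorm {Y₀ Y₁ : Type*} [SMul 𝕜 Y₀] [SMul 𝕜 Y₁] (P₀ : (ℤ → Y₀) → ℝ≥0∞)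
    (P₁ : (ℤ → Y₁) → ℝ≥0∞) (a b : 𝕜) (x : (ℤ → Y₀) × (ℤ → Y₁)) : ℝ≥0∞ :=
  P₀ (fun j => a ^ j • x.1 j) + P₁ (fun j => b ^ j • x.2 j)

variable {P₀ : (ℤ → X₀) → ℝ≥0∞} {P₁ : (ℤ → X₁) → ℝ≥0∞}
  {Q₀ : (ℤ → StrongDual 𝕜 X₀) → ℝ≥0∞} {Q₁ : (ℤ → StrongDual 𝕜 X₁) → ℝ≥0∞}

lemma coupleNorm_add_le (hP₀ : IsSequenceNorm (𝕜 := 𝕜) P₀) (hP₁ : IsSequenceNorm (𝕜 := 𝕜) P₁)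
    (a b : 𝕜) (x y : (ℤ → X₀) × (ℤ → X₁)) :
    coupleNorm P₀ P₁ a b (x + y) ≤ coupleNorm P₀ P₁ a b x + coupleNorm P₀ P₁ a b y := by
  have h₀ := hP₀.add_le (fun j => a ^ j • x.1 j) (fun j => a ^ j • y.1 j)
  have h₁ := hP₁.add_le (fun j => b ^ j • x.2 j) (fun j => b ^ j • y.2 j)
  have e₀ : (fun j => a ^ j • (x + y).1 j) = (fun j => a ^ j • x.1 j) + fun j => a ^ j • y.1 j :=
    funext fun j => smul_add _ _ _
  have e₁ : (fun j => b ^ j • (x + y).2 j) = (fun j => b ^ j • x.2 j) + fun j => b ^ j • y.2 j :=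
    funext fun j => smul_add _ _ _
  unfold coupleNorm
  rw [e₀, e₁, add_add_add_comm]
  exact add_le_add h₀ h₁

lemma coupleNorm_smul_le (hP₀ : IsSequenceNorm (𝕜 := 𝕜) P₀) (hP₁ : IsSequenceNorm (𝕜 := 𝕜) P₁)
    (a b c : 𝕜) (x : (ℤ → X₀) × (ℤ → X₁)) :
    coupleNorm P₀ P₁ a b (c • x) ≤ ‖c‖ₑ * coupleNorm P₀ P₁ a b x := by
  have h₀ := hP₀.smul_le c (fun j => a ^ j • x.1 j)
  have h₁ := hP₁.smul_le c (fun j => b ^ j • x.2 j)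
  have e₀ : (fun j => a ^ j • (c • x).1 j) = c • fun j => a ^ j • x.1 j :=
    funext fun j => smul_comm _ _ _
  have e₁ : (fun j => b ^ j • (c • x).2 j) = c • fun j => b ^ j • x.2 j :=
    funext fun j => smul_comm _ _ _
  unfold coupleNorm
  rw [e₀, e₁, mul_add]
  exact add_le_add h₀ h₁

/-- The pairs of sequences `x` of finite norm such that `x₀ j + x₁ j` does not depend on `j`. -/
def decompositions (ι₀ : X₀ →ₗ[𝕜] V) (ι₁ : X₁ →ₗ[𝕜] V) (hP₀ : IsSequenceNorm (𝕜 := 𝕜) P₀)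
    (hP₁ : IsSequenceNorm (𝕜 := 𝕜) P₁) (a b : 𝕜) : Submodule 𝕜 ((ℤ → X₀) × (ℤ → X₁)) where
  carrier := {x | coupleNorm P₀ P₁ a b x ≠ ∞ ∧
    ∀ j, ι₀ (x.1 j) + ι₁ (x.2 j) = ι₀ (x.1 0) + ι₁ (x.2 0)}
  zero_mem' := by
    refine ⟨?_, fun j => rfl⟩
    have h := coupleNorm_smul_le hP₀ hP₁ a b 0 0
    rw [smul_zero, enorm_zero, zero_mul] at h
    exact (h.trans_lt ENNReal.zero_lt_top).ne
  add_mem' := by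
    rintro x y ⟨hx, hx'⟩ ⟨hy, hy'⟩
    refine ⟨ne_top_of_le_ne_top (ENNReal.add_ne_top.2 ⟨hx, hy⟩)
      (coupleNorm_add_le hP₀ hP₁ a b x y), fun j => ?_⟩
    have h := congrArg₂ (· + ·) (hx' j) (hy' j)
    simp only [Prod.fst_add, Prod.snd_add, Pi.add_apply, map_add] at h ⊢
    rw [add_add_add_comm, h, add_add_add_comm]
  smul_mem' := by
    rintro c x ⟨hx, hx'⟩
    refine ⟨ne_top_of_le_ne_top (ENNReal.mul_ne_top enorm_ne_top hx)
      (coupleNorm_smul_le hP₀ hP₁ a b c x), fun j => ?_⟩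
    have h := congrArg (c • ·) (hx' j)
    simpa only [Prod.smul_fst, Prod.smul_snd, Pi.smul_apply, map_smul, smul_add] using h

variable {ι₀ : X₀ →ₗ[𝕜] V} {ι₁ : X₁ →ₗ[𝕜] V} {hP₀ : IsSequenceNorm (𝕜 := 𝕜) P₀}
  {hP₁ : IsSequenceNorm (𝕜 := 𝕜) P₁} {a b : 𝕜}

/-- The vector `x₀ j + x₁ j` that a family of decompositions decomposes. -/
def decompositionSum (ι₀ : X₀ →ₗ[𝕜] V) (ι₁ : X₁ →ₗ[𝕜] V) (hP₀ : IsSequenceNorm (𝕜 := 𝕜) P₀)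
    (hP₁ : IsSequenceNorm (𝕜 := 𝕜) P₁) (a b : 𝕜) :
    decompositions ι₀ ι₁ hP₀ hP₁ a b →ₗ[𝕜] V :=
  (ι₀ ∘ₗ LinearMap.proj 0 ∘ₗ LinearMap.fst 𝕜 _ _ +
    ι₁ ∘ₗ LinearMap.proj 0 ∘ₗ LinearMap.snd 𝕜 _ _) ∘ₗ
      (decompositions ι₀ ι₁ hP₀ hP₁ a b).subtype

lemma decompositionSum_eq (z : decompositions ι₀ ι₁ hP₀ hP₁ a b) (j : ℤ) :
    ι₀ (z.1.1 j) + ι₁ (z.1.2 j) = decompositionSum ι₀ ι₁ hP₀ hP₁ a b z :=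
  z.2.2 j

/-- The decompositions `p = p + 0` for `j ≥ 0` and `p = 0 + p` for `j < 0` of `p ∈ X₀ ∩ X₁`. -/
def splitAtZero (p : inter ι₀ ι₁) : (ℤ → X₀) × (ℤ → X₁) :=
  (fun j => if 0 ≤ j then p.1.1 else 0, fun j => if 0 ≤ j then 0 else p.1.2)

lemma tsum_enorm_zpow_ne_top (ha : ‖a‖ₑ < 1) : ∑' m : ℕ, ‖a ^ (m : ℤ)‖ₑ ≠ ∞ := by
  simp only [zpow_natCast, enorm_pow]
  rw [ENNReal.tsum_geometric]
  exact ENNReal.inv_ne_top.2 (tsub_pos_of_lt ha).ne'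

lemma tsum_enorm_zpow_neg_ne_top (hb : ‖b⁻¹‖ₑ < 1) : ∑' m : ℕ, ‖b ^ (-1 - m : ℤ)‖ₑ ≠ ∞ := by
  have : ∀ m : ℕ, ‖b ^ (-1 - m : ℤ)‖ₑ = ‖b⁻¹‖ₑ * ‖b⁻¹‖ₑ ^ m := fun m => by
    rw [show (-1 - m : ℤ) = -((m + 1 : ℕ) : ℤ) by push_cast; ring, zpow_neg, ← inv_zpow,
      zpow_natCast, enorm_pow, pow_succ']
  simp only [this]
  rw [ENNReal.tsum_mul_left, ENNReal.tsum_geometric]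
  exact ENNReal.mul_ne_top enorm_ne_top (ENNReal.inv_ne_top.2 (tsub_pos_of_lt hb).ne')

lemma tsum_int_eq (f : ℤ → ℝ≥0∞) : ∑' j, f j = ∑' n : ℕ, f n + ∑' n : ℕ, f (-1 - n) := by
  have h : ∀ n : ℕ, (-1 - n : ℤ) = -(n + 1) := fun n => by ring
  simp only [h]
  exact (HasSum.of_nat_of_neg_add_one ENNReal.summable.hasSum ENNReal.summable.hasSum).tsum_eq

lemma coupleNorm_splitAtZero_le (hP₀ : IsSequenceNorm (𝕜 := 𝕜) P₀)
    (hP₁ : IsSequenceNorm (𝕜 := 𝕜) P₁) (p : inter ι₀ ι₁) :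
    coupleNorm P₀ P₁ a b (splitAtZero p) ≤
      (∑' m : ℕ, ‖a ^ (m : ℤ)‖ₑ + ∑' m : ℕ, ‖b ^ (-1 - m : ℤ)‖ₑ) * ‖p‖ₑ := by
  have hneg : ∀ n : ℕ, ¬ (0 : ℤ) ≤ -1 - n := fun n => by omega
  have h₀ := hP₀.const_le (fun j => if 0 ≤ j then a ^ j else 0) p.1.1
  have h₁ := hP₁.const_le (fun j => if 0 ≤ j then 0 else b ^ j) p.1.2
  rw [tsum_int_eq] at h₀ h₁
  simp only [hneg, if_false, Int.natCast_nonneg, if_true, enorm_zero, tsum_zero, add_zero,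
    zero_add, ite_smul, zero_smul] at h₀ h₁
  have hp₀ : ‖p.1.1‖ₑ ≤ ‖p‖ₑ := enorm_le_iff_norm_le.2 (norm_fst_le p.1)
  have hp₁ : ‖p.1.2‖ₑ ≤ ‖p‖ₑ := enorm_le_iff_norm_le.2 (norm_snd_le p.1)
  unfold coupleNorm splitAtZero
  simp only [smul_ite, smul_zero]
  rw [add_mul]
  exact add_le_add (h₀.trans (mul_le_mul_right hp₀ _)) (h₁.trans (mul_le_mul_right hp₁ _))

lemma splitAtZero_mem (hP₀ : IsSequenceNorm (𝕜 := 𝕜) P₀) (hP₁ : IsSequenceNorm (𝕜 := 𝕜) P₁)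
    (ha : ‖a‖ₑ < 1) (hb : ‖b⁻¹‖ₑ < 1) (p : inter ι₀ ι₁) :
    splitAtZero p ∈ decompositions ι₀ ι₁ hP₀ hP₁ a b := by
  refine ⟨ne_top_of_le_ne_top (ENNReal.mul_ne_top (ENNReal.add_ne_top.2
    ⟨tsum_enorm_zpow_ne_top ha, tsum_enorm_zpow_neg_ne_top hb⟩) enorm_ne_top)
    (coupleNorm_splitAtZero_le hP₀ hP₁ p), fun j => ?_⟩
  have hp : ι₀ p.1.1 = ι₁ p.1.2 := p.2
  by_cases hj : 0 ≤ j <;> simp [splitAtZero, hj, hp]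

/-- The `j`-th term `φ₀ j (x₀ j) + φ₁ j (x₁ j)` in the pairing of `ψ` with `x`, for the differences
`φ₀ j = ψ₀ (-j) - ψ₀ (-j - 1)` and `φ₁ j = ψ₁ (-j - 1) - ψ₁ (-j)`. -/
def pairTerm (ψ : (ℤ → StrongDual 𝕜 X₀) × (ℤ → StrongDual 𝕜 X₁)) (x : (ℤ → X₀) × (ℤ → X₁))
    (j : ℤ) : 𝕜 :=
  (ψ.1 (-j) (x.1 j) - ψ.1 (-j - 1) (x.1 j)) + (ψ.2 (-j - 1) (x.2 j) - ψ.2 (-j) (x.2 j))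

lemma summable_of_tsum_enorm_ne_top {f : ℤ → 𝕜} (h : ∑' j, ‖f j‖ₑ ≠ ∞) : Summable f := by
  have h1 : Summable fun m => ‖f m‖ := by
    simpa only [toReal_enorm] using ENNReal.summable_toReal h
  exact h1.of_norm

/-- Hölder's inequality for the terms in the pairing of `ψ` with `x`. -/
lemma tsum_enorm_pairing_le (hP₀ : IsSequenceNorm (𝕜 := 𝕜) P₀)
    (hP₁ : IsSequenceNorm (𝕜 := 𝕜) P₁) (hQ₀ : IsDualSequenceNorm P₀ Q₀)
    (hQ₁ : IsDualSequenceNorm P₁ Q₁) (ha : a ≠ 0) (hb : b ≠ 0)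
    {ψ : (ℤ → StrongDual 𝕜 X₀) × (ℤ → StrongDual 𝕜 X₁)} {x : (ℤ → X₀) × (ℤ → X₁)}
    (hψ : coupleNorm Q₀ Q₁ a b ψ ≠ ∞) (hx : coupleNorm P₀ P₁ a b x ≠ ∞) (i : ℤ) :
    ∑' j, ‖ψ.1 (-j - i) (x.1 j)‖ₑ ≤
        ‖a ^ i‖ₑ * (coupleNorm Q₀ Q₁ a b ψ * coupleNorm P₀ P₁ a b x) ∧
      ∑' j, ‖ψ.2 (-j - i) (x.2 j)‖ₑ ≤
        ‖b ^ i‖ₑ * (coupleNorm Q₀ Q₁ a b ψ * coupleNorm P₀ P₁ a b x) := by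
  obtain ⟨hψ₀, hψ₁⟩ := ENNReal.add_ne_top.1 hψ
  obtain ⟨hx₀, hx₁⟩ := ENNReal.add_ne_top.1 hx
  refine ⟨(hQ₀.tsum_enorm_reflect_le hP₀ ha hψ₀ hx₀ i).trans ?_,
    (hQ₁.tsum_enorm_reflect_le hP₁ hb hψ₁ hx₁ i).trans ?_⟩
  · exact mul_le_mul_right (mul_le_mul' le_self_add le_self_add) _
  · exact mul_le_mul_right (mul_le_mul' le_add_self le_add_self) _

lemma summable_pairing (hP₀ : IsSequenceNorm (𝕜 := 𝕜) P₀)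
    (hP₁ : IsSequenceNorm (𝕜 := 𝕜) P₁) (hQ₀ : IsDualSequenceNorm P₀ Q₀)
    (hQ₁ : IsDualSequenceNorm P₁ Q₁) (ha : a ≠ 0) (hb : b ≠ 0)
    {ψ : (ℤ → StrongDual 𝕜 X₀) × (ℤ → StrongDual 𝕜 X₁)} {x : (ℤ → X₀) × (ℤ → X₁)}
    (hψ : coupleNorm Q₀ Q₁ a b ψ ≠ ∞) (hx : coupleNorm P₀ P₁ a b x ≠ ∞) (i : ℤ) :
    (Summable fun j => ψ.1 (-j - i) (x.1 j)) ∧ Summable fun j => ψ.2 (-j - i) (x.2 j) := by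
  obtain ⟨h₀, h₁⟩ := tsum_enorm_pairing_le hP₀ hP₁ hQ₀ hQ₁ ha hb hψ hx i
  exact ⟨summable_of_tsum_enorm_ne_top (ne_top_of_le_ne_top
      (ENNReal.mul_ne_top enorm_ne_top (ENNReal.mul_ne_top hψ hx)) h₀),
    summable_of_tsum_enorm_ne_top (ne_top_of_le_ne_top
      (ENNReal.mul_ne_top enorm_ne_top (ENNReal.mul_ne_top hψ hx)) h₁)⟩

lemma summable_pairTerm (hP₀ : IsSequenceNorm (𝕜 := 𝕜) P₀)
    (hP₁ : IsSequenceNorm (𝕜 := 𝕜) P₁) (hQ₀ : IsDualSequenceNorm P₀ Q₀)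
    (hQ₁ : IsDualSequenceNorm P₁ Q₁) (ha : a ≠ 0) (hb : b ≠ 0)
    {ψ : (ℤ → StrongDual 𝕜 X₀) × (ℤ → StrongDual 𝕜 X₁)} {x : (ℤ → X₀) × (ℤ → X₁)}
    (hψ : coupleNorm Q₀ Q₁ a b ψ ≠ ∞) (hx : coupleNorm P₀ P₁ a b x ≠ ∞) :
    Summable (pairTerm ψ x) := by
  obtain ⟨s₀, s₁⟩ := summable_pairing hP₀ hP₁ hQ₀ hQ₁ ha hb hψ hx 0
  obtain ⟨t₀, t₁⟩ := summable_pairing hP₀ hP₁ hQ₀ hQ₁ ha hb hψ hx 1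
  simp only [sub_zero] at s₀ s₁
  exact (s₀.sub t₀).add (t₁.sub s₁)

lemma enorm_tsum_pairTerm_le (hP₀ : IsSequenceNorm (𝕜 := 𝕜) P₀)
    (hP₁ : IsSequenceNorm (𝕜 := 𝕜) P₁) (hQ₀ : IsDualSequenceNorm P₀ Q₀)
    (hQ₁ : IsDualSequenceNorm P₁ Q₁) (ha : a ≠ 0) (hb : b ≠ 0)
    {ψ : (ℤ → StrongDual 𝕜 X₀) × (ℤ → StrongDual 𝕜 X₁)} {x : (ℤ → X₀) × (ℤ → X₁)}
    (hψ : coupleNorm Q₀ Q₁ a b ψ ≠ ∞) (hx : coupleNorm P₀ P₁ a b x ≠ ∞) :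
    ‖∑' j, pairTerm ψ x j‖ₑ ≤
      (2 + ‖a‖ₑ + ‖b‖ₑ) * coupleNorm Q₀ Q₁ a b ψ * coupleNorm P₀ P₁ a b x := by
  obtain ⟨s₀, s₁⟩ := tsum_enorm_pairing_le hP₀ hP₁ hQ₀ hQ₁ ha hb hψ hx 0
  obtain ⟨t₀, t₁⟩ := tsum_enorm_pairing_le hP₀ hP₁ hQ₀ hQ₁ ha hb hψ hx 1
  simp only [sub_zero, zpow_zero, zpow_one, enorm_one, one_mul] at s₀ s₁ t₀ t₁
  calc ‖∑' j, pairTerm ψ x j‖ₑ ≤ ∑' j, ‖pairTerm ψ x j‖ₑ := enorm_tsum_le_tsum_enorm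
    _ ≤ ∑' j, ((‖ψ.1 (-j) (x.1 j)‖ₑ + ‖ψ.1 (-j - 1) (x.1 j)‖ₑ) +
        (‖ψ.2 (-j - 1) (x.2 j)‖ₑ + ‖ψ.2 (-j) (x.2 j)‖ₑ)) :=
        ENNReal.tsum_le_tsum fun j =>
          (enorm_add_le _ _).trans (add_le_add enorm_sub_le enorm_sub_le)
    _ = (∑' j, ‖ψ.1 (-j) (x.1 j)‖ₑ + ∑' j, ‖ψ.1 (-j - 1) (x.1 j)‖ₑ) +
        (∑' j, ‖ψ.2 (-j - 1) (x.2 j)‖ₑ + ∑' j, ‖ψ.2 (-j) (x.2 j)‖ₑ) := by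
        rw [ENNReal.tsum_add, ENNReal.tsum_add, ENNReal.tsum_add]
    _ ≤ _ := add_le_add (add_le_add s₀ t₀) (add_le_add t₁ s₁)
    _ = _ := by ring

/-- Summation by parts turns the pairing of `ψ` with `x` into the pairing of `ψ` with the
differences of `x`. -/
lemma tsum_pairTerm_eq (hP₀ : IsSequenceNorm (𝕜 := 𝕜) P₀)
    (hP₁ : IsSequenceNorm (𝕜 := 𝕜) P₁) (hQ₀ : IsDualSequenceNorm P₀ Q₀)
    (hQ₁ : IsDualSequenceNorm P₁ Q₁) (ha : a ≠ 0) (hb : b ≠ 0)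
    {ψ : (ℤ → StrongDual 𝕜 X₀) × (ℤ → StrongDual 𝕜 X₁)} {x : (ℤ → X₀) × (ℤ → X₁)}
    (hψ : coupleNorm Q₀ Q₁ a b ψ ≠ ∞) (hx : coupleNorm P₀ P₁ a b x ≠ ∞) :
    ∑' j, pairTerm ψ x j = ∑' j, (ψ.1 (-j) (x.1 j - x.1 (j - 1)) +
      ψ.2 (-j) (x.2 (j - 1) - x.2 j)) := by
  obtain ⟨s₀, s₁⟩ := summable_pairing hP₀ hP₁ hQ₀ hQ₁ ha hb hψ hx 0
  obtain ⟨t₀, t₁⟩ := summable_pairing hP₀ hP₁ hQ₀ hQ₁ ha hb hψ hx 1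
  simp only [sub_zero] at s₀ s₁
  have u₀ : HasSum (fun j => ψ.1 (-j) (x.1 (j - 1))) (∑' j, ψ.1 (-j - 1) (x.1 j)) := by
    have h := (Equiv.subRight (1 : ℤ)).hasSum_iff.2 t₀.hasSum
    refine h.congr_fun fun j => ?_
    simp
  have u₁ : HasSum (fun j => ψ.2 (-j) (x.2 (j - 1))) (∑' j, ψ.2 (-j - 1) (x.2 j)) := by
    have h := (Equiv.subRight (1 : ℤ)).hasSum_iff.2 t₁.hasSum
    refine h.congr_fun fun j => ?_
    simp
  have h1 : HasSum (pairTerm ψ x) _ :=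
    (s₀.hasSum.sub t₀.hasSum).add (t₁.hasSum.sub s₁.hasSum)
  have h2 := (s₀.hasSum.sub u₀).add (u₁.sub s₁.hasSum)
  rw [h1.tsum_eq, ← h2.tsum_eq]
  exact tsum_congr fun j => by rw [map_sub, map_sub]

/-- If `ψ` consists of decompositions of a functional `φ` on `X₀ ∩ X₁`, then its pairing with a
family of decompositions `z` is the sum of the values of `φ` at
`x₀ j - x₀ (j - 1) = x₁ (j - 1) - x₁ j`. -/
lemma tsum_pairTerm_eq_tsum (hQ₀ : IsDualSequenceNorm P₀ Q₀)
    (hQ₁ : IsDualSequenceNorm P₁ Q₁) (ha : a ≠ 0) (hb : b ≠ 0)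
    {ψ : (ℤ → StrongDual 𝕜 X₀) × (ℤ → StrongDual 𝕜 X₁)}
    (hψ : coupleNorm Q₀ Q₁ a b ψ ≠ ∞) (z : decompositions ι₀ ι₁ hP₀ hP₁ a b)
    {φ : inter ι₀ ι₁ → 𝕜} (hφ : ∀ k (p : inter ι₀ ι₁), ψ.1 k p.1.1 + ψ.2 k p.1.2 = φ p) :
    ∃ u : ℤ → inter ι₀ ι₁, (∀ j, (u j).1.1 = z.1.1 j - z.1.1 (j - 1)) ∧
      (∀ j, (u j).1.2 = z.1.2 (j - 1) - z.1.2 j) ∧ ∑' j, pairTerm ψ z.1 j = ∑' j, φ (u j) := by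
  have hmem : ∀ j, (z.1.1 j - z.1.1 (j - 1), z.1.2 (j - 1) - z.1.2 j) ∈ inter ι₀ ι₁ := fun j => by
    have h := (decompositionSum_eq z j).trans (decompositionSum_eq z (j - 1)).symm
    change ι₀ (z.1.1 j - z.1.1 (j - 1)) = ι₁ (z.1.2 (j - 1) - z.1.2 j)
    rw [map_sub, map_sub, sub_eq_sub_iff_add_eq_add, h, add_comm]
  refine ⟨fun j => ⟨_, hmem j⟩, fun j => rfl, fun j => rfl, ?_⟩
  rw [tsum_pairTerm_eq hP₀ hP₁ hQ₀ hQ₁ ha hb hψ z.2.1]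
  exact tsum_congr fun j => hφ (-j) ⟨_, hmem j⟩

/-- From a functional on an interpolation space to decompositions of its restriction to
`X₀ ∩ X₁`: by Hahn–Banach, a functional `ℓ` on families of decompositions is given by sequences
`φ₀`, `φ₁` of functionals, which agree on `X₀ ∩ X₁` if `ℓ` vanishes on decompositions of `0`, and
`ψ₀ k = ∑ m ≥ 0, φ₀ (m - k)` and `ψ₁ k = ∑ m ≥ 0, φ₁ (-1 - m - k)` add up to `ℓ` on `X₀ ∩ X₁`. -/
theorem exists_dual_decomposition (hQ₀ : IsDualSequenceNorm P₀ Q₀)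
    (hQ₁ : IsDualSequenceNorm P₁ Q₁) (ha : a ≠ 0) (hb : b ≠ 0) (ha' : ‖a‖ₑ < 1)
    (hb' : ‖b⁻¹‖ₑ < 1) (ℓ : decompositions ι₀ ι₁ hP₀ hP₁ a b →ₗ[𝕜] 𝕜) {C : ℝ≥0∞} (hC : C ≠ ∞)
    (hℓ : ∀ z, ‖ℓ z‖ₑ ≤ C * coupleNorm P₀ P₁ a b z.1)
    (hℓ₀ : ∀ z, decompositionSum ι₀ ι₁ hP₀ hP₁ a b z = 0 → ℓ z = 0) :
    ∃ ψ : (ℤ → StrongDual 𝕜 X₀) × (ℤ → StrongDual 𝕜 X₁),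
      coupleNorm Q₀ Q₁ a b ψ ≤
        (∑' m : ℕ, ‖a ^ (m : ℤ)‖ₑ + ∑' m : ℕ, ‖b ^ (-1 - m : ℤ)‖ₑ) * C ∧
      (∀ z, HasSum (pairTerm ψ z.1) (ℓ z)) ∧
      ∀ k (p : inter ι₀ ι₁), ψ.1 k p.1.1 + ψ.2 k p.1.2 =
        ℓ ⟨splitAtZero p, splitAtZero_mem hP₀ hP₁ ha' hb' p⟩ := by
  obtain ⟨L, hLℓ, hL⟩ := exists_extension_of_le_extended_seminorm (coupleNorm P₀ P₁ a b)
    (coupleNorm_add_le hP₀ hP₁ a b) (coupleNorm_smul_le hP₀ hP₁ a b)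
    (decompositions ι₀ ι₁ hP₀ hP₁ a b) (fun z hz => hz.1) ℓ hC hℓ
  have hcancel : ∀ {c : 𝕜}, c ≠ 0 → ∀ j : ℤ, c ^ j * c ^ (-j) = 1 := fun hc j => by
    rw [← zpow_add₀ hc, add_neg_cancel, zpow_zero]
  -- the two halves of `L`, with the weights removed
  let L₀ : (ℤ → X₀) →ₗ[𝕜] 𝕜 := L ∘ₗ LinearMap.inl 𝕜 _ _ ∘ₗ
    LinearMap.pi fun j => a ^ (-j) • LinearMap.proj j
  let L₁ : (ℤ → X₁) →ₗ[𝕜] 𝕜 := L ∘ₗ LinearMap.inr 𝕜 _ _ ∘ₗ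
    LinearMap.pi fun j => b ^ (-j) • LinearMap.proj j
  have hL₀_apply : ∀ x, L₀ x = L (fun j => a ^ (-j) • x j, 0) := fun x => rfl
  have hL₁_apply : ∀ x, L₁ x = L (0, fun j => b ^ (-j) • x j) := fun x => rfl
  have hN₀ : ∀ x : ℤ → X₀, coupleNorm P₀ P₁ a b (fun j => a ^ (-j) • x j, 0) = P₀ x := by
    intro x
    unfold coupleNorm
    simp only [smul_smul, hcancel ha, one_smul, Pi.zero_apply, smul_zero]
    exact (congrArg _ hP₁.zero).trans (add_zero _)
  have hN₁ : ∀ x : ℤ → X₁, coupleNorm P₀ P₁ a b (0, fun j => b ^ (-j) • x j) = P₁ x := by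
    intro x
    unfold coupleNorm
    simp only [smul_smul, hcancel hb, one_smul, Pi.zero_apply, smul_zero]
    exact (congrArg (· + P₁ x) hP₀.zero).trans (zero_add _)
  obtain ⟨h₀, hh₀, hL₀s, hL₀⟩ := hQ₀.exists_coordinates hP₀ L₀ hC fun x hx => by
    rw [hL₀_apply, ← hN₀ x]
    exact hL _ (by rwa [hN₀])
  obtain ⟨h₁, hh₁, hL₁s, hL₁⟩ := hQ₁.exists_coordinates hP₁ L₁ hC fun x hx => by
    rw [hL₁_apply, ← hN₁ x]
    exact hL _ (by rwa [hN₁])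
  -- the coordinates of `L`, with their weights
  have hφ₀ : ∀ j x, (a ^ j • h₀ j) x = L (Pi.single j x, 0) := by
    intro j x
    rw [smul_apply, ← map_smul, hL₀s, hL₀_apply]
    congr 2
    funext i
    rcases eq_or_ne i j with rfl | hi
    · rw [Pi.single_eq_same, Pi.single_eq_same, smul_smul, mul_comm, hcancel ha, one_smul]
    · rw [Pi.single_eq_of_ne hi, Pi.single_eq_of_ne hi, smul_zero]
  have hφ₁ : ∀ j x, (b ^ j • h₁ j) x = L (0, Pi.single j x) := by
    intro j x
    rw [smul_apply, ← map_smul, hL₁s, hL₁_apply]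
    congr 2
    funext i
    rcases eq_or_ne i j with rfl | hi
    · rw [Pi.single_eq_same, Pi.single_eq_same, smul_smul, mul_comm, hcancel hb, one_smul]
    · rw [Pi.single_eq_of_ne hi, Pi.single_eq_of_ne hi, smul_zero]
  have hLsum : ∀ z : decompositions ι₀ ι₁ hP₀ hP₁ a b,
      HasSum (fun j => (a ^ j • h₀ j) (z.1.1 j) + (b ^ j • h₁ j) (z.1.2 j)) (ℓ z) := by
    intro z
    obtain ⟨hz₀, hz₁⟩ := ENNReal.add_ne_top.1 z.2.1
    have e : ℓ z = L₀ (fun j => a ^ j • z.1.1 j) + L₁ (fun j => b ^ j • z.1.2 j) := by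
      rw [← hLℓ, hL₀_apply, hL₁_apply, ← map_add]
      congr 1
      refine Prod.ext (funext fun j => ?_) (funext fun j => ?_)
      · simp only [Prod.fst_add, Pi.add_apply, Pi.zero_apply, add_zero]
        rw [smul_smul, mul_comm, hcancel ha, one_smul]
      · simp only [Prod.snd_add, Pi.add_apply, Pi.zero_apply, zero_add]
        rw [smul_smul, mul_comm, hcancel hb, one_smul]
    rw [e]
    refine ((hL₀ _ hz₀).add (hL₁ _ hz₁)).congr_fun fun j => ?_
    rw [smul_apply, smul_apply, map_smul, map_smul]
  -- They agree on `X₀ ∩ X₁`, since `p + (-p)` in the `j`-th place is a decomposition of `0`.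
  have hagree : ∀ j (p : inter ι₀ ι₁), (a ^ j • h₀ j) p.1.1 = (b ^ j • h₁ j) p.1.2 := by
    intro j p
    have hp : ι₀ p.1.1 = ι₁ p.1.2 := p.2
    have hfin : coupleNorm P₀ P₁ a b (Pi.single j p.1.1, Pi.single j (-p.1.2)) ≠ ∞ := by
      have e₀ : (fun i => a ^ i • (Pi.single j p.1.1 : ℤ → X₀) i) =
          Pi.single j (a ^ j • p.1.1) := by
        funext i
        rcases eq_or_ne i j with rfl | hi
        · simp
        · simp [Pi.single_eq_of_ne hi]
      have e₁ : (fun i => b ^ i • (Pi.single j (-p.1.2) : ℤ → X₁) i) =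
          Pi.single j (b ^ j • (-p.1.2)) := by
        funext i
        rcases eq_or_ne i j with rfl | hi
        · simp
        · simp [Pi.single_eq_of_ne hi]
      unfold coupleNorm
      rw [e₀, e₁]
      exact ENNReal.add_ne_top.2 ⟨((hP₀.single_le _ _).trans_lt enorm_lt_top).ne,
        ((hP₁.single_le _ _).trans_lt enorm_lt_top).ne⟩
    have hsum : ∀ i : ℤ, ι₀ ((Pi.single j p.1.1 : ℤ → X₀) i) +
        ι₁ ((Pi.single j (-p.1.2) : ℤ → X₁) i) = 0 := by
      intro i
      rcases eq_or_ne i j with rfl | hi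
      · rw [Pi.single_eq_same, Pi.single_eq_same, map_neg, hp, add_neg_cancel]
      · rw [Pi.single_eq_of_ne hi, Pi.single_eq_of_ne hi, map_zero, map_zero, add_zero]
    have hz : L (Pi.single j p.1.1, Pi.single j (-p.1.2)) = 0 :=
      (hLℓ ⟨_, hfin, fun i => (hsum i).trans (hsum 0).symm⟩).trans (hℓ₀ _ (hsum 0))
    have e : ((Pi.single j p.1.1, Pi.single j (-p.1.2)) : (ℤ → X₀) × (ℤ → X₁)) =
        (Pi.single j p.1.1, 0) + (0, Pi.single j (-p.1.2)) := by simp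
    rw [e, map_add, ← hφ₀, ← hφ₁, map_neg] at hz
    exact add_neg_eq_zero.1 hz
  obtain ⟨ψ₀, hψ₀, hs₀⟩ := hQ₀.exists_hasSum_shift hP₀ ha (ne_top_of_le_ne_top hC hh₀)
    (fun m => (m : ℤ)) (tsum_enorm_zpow_ne_top ha')
  obtain ⟨ψ₁, hψ₁, hs₁⟩ := hQ₁.exists_hasSum_shift hP₁ hb (ne_top_of_le_ne_top hC hh₁)
    (fun m => (-1 - m : ℤ)) (tsum_enorm_zpow_neg_ne_top hb')
  -- The differences of `ψ` recover the coordinates of `L`.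
  have hdiff₀ : ∀ j, ψ₀ (-j) - ψ₀ (-j - 1) = a ^ j • h₀ j := by
    intro j
    have h1 : HasSum (fun m : ℕ => a ^ (((m + 1 : ℕ) : ℤ) - -j) • h₀ (((m + 1 : ℕ) : ℤ) - -j))
        (ψ₀ (-j - 1)) := by
      refine (hs₀ (-j - 1)).congr_fun fun m => ?_
      rw [show (((m + 1 : ℕ) : ℤ) - -j) = m - (-j - 1) by push_cast; ring]
    have h2 := sub_eq_zero_apply_of_hasSum
      (f := fun m : ℕ => a ^ ((m : ℤ) - -j) • h₀ ((m : ℤ) - -j)) (hs₀ (-j)) h1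
    rw [h2, show (((0 : ℕ) : ℤ) - -j) = j by simp]
  have hdiff₁ : ∀ j, ψ₁ (-j - 1) - ψ₁ (-j) = b ^ j • h₁ j := by
    intro j
    have h1 : HasSum (fun m : ℕ => b ^ (-1 - ((m + 1 : ℕ) : ℤ) - (-j - 1)) •
        h₁ (-1 - ((m + 1 : ℕ) : ℤ) - (-j - 1))) (ψ₁ (-j)) := by
      refine (hs₁ (-j)).congr_fun fun m => ?_
      rw [show (-1 - ((m + 1 : ℕ) : ℤ) - (-j - 1)) = -1 - m - -j by push_cast; ring]
    have h2 := sub_eq_zero_apply_of_hasSum (f := fun m : ℕ =>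
      b ^ (-1 - (m : ℤ) - (-j - 1)) • h₁ (-1 - (m : ℤ) - (-j - 1))) (hs₁ (-j - 1)) h1
    rw [h2, show (-1 - ((0 : ℕ) : ℤ) - (-j - 1)) = j by push_cast; ring]
  refine ⟨(ψ₀, ψ₁), ?_, fun z => ?_, fun k p => ?_⟩
  · rw [add_mul]
    exact add_le_add (hψ₀.trans (mul_le_mul_right hh₀ _)) (hψ₁.trans (mul_le_mul_right hh₁ _))
  · refine (hLsum z).congr_fun fun j => ?_
    rw [← hdiff₀, ← hdiff₁]
    rfl
  · -- The sums for `ψ₀ k` and `ψ₁ k` run over `j ≥ -k` and over `j < -k`.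
    have hc : HasSum (fun j => (a ^ j • h₀ j) p.1.1)
        (ℓ ⟨splitAtZero p, splitAtZero_mem hP₀ hP₁ ha' hb' p⟩) := by
      refine (hLsum ⟨splitAtZero p, splitAtZero_mem hP₀ hP₁ ha' hb' p⟩).congr_fun fun j => ?_
      by_cases hj : 0 ≤ j
      · simp only [splitAtZero, hj, if_true, map_zero, add_zero]
      · simp only [splitAtZero, hj, if_false, map_zero, zero_add]
        exact hagree j p
    have hc' := (Equiv.subRight k).hasSum_iff.2 hc
    refine HasSum.unique ?_ hc'
    refine HasSum.of_nat_of_neg_add_one ?_ ?_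
    · exact hasSum_dual_apply (hs₀ k) p.1.1
    · refine (hasSum_dual_apply (hs₁ k) p.1.2).congr_fun fun n => ?_
      rw [← hagree]
      simp only [Function.comp_apply, Equiv.subRight_apply]
      rw [show (-((n : ℤ) + 1) - k) = -1 - n - k by ring]

/-- From decompositions of a functional on `X₀ ∩ X₁` to a functional on an interpolation space: the
pairing with `ψ` is a functional on families of decompositions that vanishes on decompositions
of `0` and extends `φ`. -/
theorem exists_functional_of_dual_decomposition (hQ₀ : IsDualSequenceNorm P₀ Q₀)
    (hQ₁ : IsDualSequenceNorm P₁ Q₁) (ha : a ≠ 0) (hb : b ≠ 0) (ha' : ‖a‖ₑ < 1)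
    (hb' : ‖b⁻¹‖ₑ < 1) {ψ : (ℤ → StrongDual 𝕜 X₀) × (ℤ → StrongDual 𝕜 X₁)}
    (hψ : coupleNorm Q₀ Q₁ a b ψ ≠ ∞)
    {φ : inter ι₀ ι₁ → 𝕜} (hφ : ∀ k (p : inter ι₀ ι₁), ψ.1 k p.1.1 + ψ.2 k p.1.2 = φ p) :
    ∃ ℓ : decompositions ι₀ ι₁ hP₀ hP₁ a b →ₗ[𝕜] 𝕜,
      (∀ z, ‖ℓ z‖ₑ ≤ (2 + ‖a‖ₑ + ‖b‖ₑ) * coupleNorm Q₀ Q₁ a b ψ * coupleNorm P₀ P₁ a b z.1) ∧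
      (∀ z, decompositionSum ι₀ ι₁ hP₀ hP₁ a b z = 0 → ℓ z = 0) ∧
      ∀ p, ℓ ⟨splitAtZero p, splitAtZero_mem hP₀ hP₁ ha' hb' p⟩ = φ p := by
  have hsum := fun z : decompositions ι₀ ι₁ hP₀ hP₁ a b =>
    (summable_pairTerm hP₀ hP₁ hQ₀ hQ₁ ha hb hψ z.2.1)
  let ℓ : decompositions ι₀ ι₁ hP₀ hP₁ a b →ₗ[𝕜] 𝕜 :=
    { toFun := fun z => ∑' j, pairTerm ψ z.1 j
      map_add' := fun z w => by
        rw [← (hsum z).tsum_add (hsum w)]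
        refine tsum_congr fun j => ?_
        simp only [pairTerm, Submodule.coe_add, Prod.fst_add, Prod.snd_add, Pi.add_apply, map_add]
        ring
      map_smul' := fun c z => by
        rw [RingHom.id_apply, smul_eq_mul, ← tsum_mul_left]
        refine tsum_congr fun j => ?_
        simp only [pairTerm, Submodule.coe_smul, Prod.smul_fst, Prod.smul_snd, Pi.smul_apply,
          map_smul, smul_eq_mul]
        ring }
  -- On a decomposition of `0` each term is a difference of two values of `φ` at the same point,
  -- and for `splitAtZero p` the only nonzero difference is the one at `0`, which is `p`.
  refine ⟨ℓ, fun z => enorm_tsum_pairTerm_le hP₀ hP₁ hQ₀ hQ₁ ha hb hψ z.2.1, fun z hz => ?_,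
    fun p => ?_⟩
  · change ∑' j, pairTerm ψ z.1 j = 0
    refine (tsum_congr fun j => ?_).trans tsum_zero
    have hj := (decompositionSum_eq z j).trans hz
    let p : inter ι₀ ι₁ := ⟨(z.1.1 j, -z.1.2 j), by
      change ι₀ (z.1.1 j) = ι₁ (-z.1.2 j)
      rw [map_neg]
      exact eq_neg_of_add_eq_zero_left hj⟩
    have h1 := hφ (-j) p
    have h2 := hφ (-j - 1) p
    simp only [p, map_neg] at h1 h2
    unfold pairTerm
    linear_combination h1 - h2
  · obtain ⟨u, hu₀, hu₁, hu⟩ := tsum_pairTerm_eq_tsum hQ₀ hQ₁ ha hb hψ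
      ⟨splitAtZero p, splitAtZero_mem hP₀ hP₁ ha' hb' p⟩ hφ
    refine hu.trans ?_
    have hφ0 : φ 0 = 0 := by simpa using (hφ 0 0).symm
    rw [tsum_eq_single 0]
    · congr 1
      refine Subtype.ext (Prod.ext ?_ ?_)
      · rw [hu₀]
        simp [splitAtZero]
      · rw [hu₁]
        simp [splitAtZero]
    · intro j hj
      rw [← hφ0]
      congr 1
      refine Subtype.ext (Prod.ext ?_ ?_)
      · rw [hu₀]
        rcases lt_or_gt_of_ne hj with h | h
        · have h1 : ¬ 0 ≤ j := by omega
          have h2 : ¬ 0 ≤ j - 1 := by omega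
          simp only [splitAtZero, h1, h2, if_false, sub_self]
          rfl
        · have h1 : 0 ≤ j := by omega
          have h2 : 0 ≤ j - 1 := by omega
          simp only [splitAtZero, h1, h2, if_true, sub_self]
          rfl
      · rw [hu₁]
        rcases lt_or_gt_of_ne hj with h | h
        · have h1 : ¬ 0 ≤ j := by omega
          have h2 : ¬ 0 ≤ j - 1 := by omega
          simp only [splitAtZero, h1, h2, if_false, sub_self]
          rfl
        · have h1 : 0 ≤ j := by omega
          have h2 : 0 ≤ j - 1 := by omega
          simp only [splitAtZero, h1, h2, if_true, sub_self]
          rfl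

end Couple

/-! ### The duality theorem -/

lemma norm_le_of_enorm_le {F G : Type*} [SeminormedAddCommGroup F] [SeminormedAddCommGroup G]
    {C : ℝ≥0∞} (hC : C ≠ ∞) {x : F} {y : G} (h : ‖x‖ₑ ≤ C * ‖y‖ₑ) : ‖x‖ ≤ C.toReal * ‖y‖ := by
  have h1 := ENNReal.toReal_mono (ENNReal.mul_ne_top hC enorm_ne_top) h
  rwa [ENNReal.toReal_mul, toReal_enorm, toReal_enorm] at h1

section Couple

variable {𝕜 : Type*} [RCLike 𝕜] {X₀ X₁ V : Type*}
  [NormedAddCommGroup X₀] [NormedSpace 𝕜 X₀] [NormedAddCommGroup X₁] [NormedSpace 𝕜 X₁]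
  [AddCommGroup V] [Module 𝕜 V] {P₀ : (ℤ → X₀) → ℝ≥0∞} {P₁ : (ℤ → X₁) → ℝ≥0∞}
  {Q₀ : (ℤ → StrongDual 𝕜 X₀) → ℝ≥0∞} {Q₁ : (ℤ → StrongDual 𝕜 X₁) → ℝ≥0∞}
  {ι₀ : X₀ →ₗ[𝕜] V} {ι₁ : X₁ →ₗ[𝕜] V} {a b : 𝕜}

/-- The duality theorem for the interpolation method of a pair of sequence norms `P₀`, `P₁` with
dual sequence norms `Q₀`, `Q₁`. The interpolation space `W` and the interpolation space `W'` of
the duals are given by their inclusions `i` into `V` and `i'` into `(X₀ ∩ X₁)'`. -/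
theorem exists_dual_equiv {W W' : Type*} [SeminormedAddCommGroup W] [NormedSpace 𝕜 W]
    [SeminormedAddCommGroup W'] [NormedSpace 𝕜 W'] (hP₀ : IsSequenceNorm (𝕜 := 𝕜) P₀)
    (hP₁ : IsSequenceNorm (𝕜 := 𝕜) P₁) (hQ₀ : IsDualSequenceNorm P₀ Q₀)
    (hQ₁ : IsDualSequenceNorm P₁ Q₁) (ha : a ≠ 0) (hb : b ≠ 0) (ha' : ‖a‖ₑ < 1)
    (hb' : ‖b⁻¹‖ₑ < 1) (i : W →ₗ[𝕜] V) (i' : W' →ₗ[𝕜] StrongDual 𝕜 (inter ι₀ ι₁))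
    (hi : Function.Injective i) (hi' : Function.Injective i')
    (hW : ∀ w, ‖w‖ₑ = ⨅ (z : (ℤ → X₀) × (ℤ → X₁)) (_ : ∀ j, ι₀ (z.1 j) + ι₁ (z.2 j) = i w),
      coupleNorm P₀ P₁ a b z)
    (hWr : ∀ v (z : (ℤ → X₀) × (ℤ → X₁)), (∀ j, ι₀ (z.1 j) + ι₁ (z.2 j) = v) →
      coupleNorm P₀ P₁ a b z ≠ ∞ → ∃ w, i w = v)
    (hW' : ∀ w, ‖w‖ₑ = ⨅ (ψ : (ℤ → StrongDual 𝕜 X₀) × (ℤ → StrongDual 𝕜 X₁))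
      (_ : ∀ k, restrict₀ ι₀ ι₁ (ψ.1 k) + restrict₁ ι₀ ι₁ (ψ.2 k) = i' w),
        coupleNorm Q₀ Q₁ a b ψ)
    (hWr' : ∀ φ (ψ : (ℤ → StrongDual 𝕜 X₀) × (ℤ → StrongDual 𝕜 X₁)),
      (∀ k, restrict₀ ι₀ ι₁ (ψ.1 k) + restrict₁ ι₀ ι₁ (ψ.2 k) = φ) →
        coupleNorm Q₀ Q₁ a b ψ ≠ ∞ → ∃ w, i' w = φ) :
    (∀ p : inter ι₀ ι₁, ∃ w, i w = ι₀ p.1.1) ∧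
      ∃ Φ : StrongDual 𝕜 W ≃L[𝕜] W', ∀ (ψ : StrongDual 𝕜 W) (p : inter ι₀ ι₁) (w : W),
        i w = ι₀ p.1.1 → i' (Φ ψ) p = ψ w := by
  -- `W` is a quotient of the space of families of decompositions
  choose f hf using fun z : decompositions ι₀ ι₁ hP₀ hP₁ a b =>
    hWr _ z.1 (decompositionSum_eq z) z.2.1
  let π : decompositions ι₀ ι₁ hP₀ hP₁ a b →ₗ[𝕜] W :=
    { toFun := f
      map_add' := fun x y => hi (by rw [hf, map_add, map_add, hf, hf])
      map_smul' := fun c x => hi (by rw [hf, map_smul, RingHom.id_apply, map_smul, hf]) }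
  have hπ : ∀ z, i (π z) = decompositionSum ι₀ ι₁ hP₀ hP₁ a b z := hf
  have hπn : ∀ z, ‖π z‖ₑ ≤ coupleNorm P₀ P₁ a b z.1 := fun z => by
    rw [hW]
    exact iInf₂_le z.1 fun j => (decompositionSum_eq z j).trans (hπ z).symm
  have hlift : ∀ w (z : (ℤ → X₀) × (ℤ → X₁)), (∀ j, ι₀ (z.1 j) + ι₁ (z.2 j) = i w) →
      coupleNorm P₀ P₁ a b z ≠ ∞ → ∃ y, π y = w ∧ y.1 = z := fun w z hz hzn => by
    refine ⟨⟨z, hzn, fun j => (hz j).trans (hz 0).symm⟩, hi ?_, rfl⟩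
    exact (hπ _).trans (hz 0)
  have hπs : Function.Surjective π := fun w => by
    have hlt := enorm_lt_top (x := w)
    simp only [hW, iInf_lt_iff] at hlt
    obtain ⟨z, hz, hzn⟩ := hlt
    obtain ⟨y, hy, -⟩ := hlift w z hz hzn.ne
    exact ⟨y, hy⟩
  -- the inclusion of `X₀ ∩ X₁` into `W`
  set D : ℝ≥0∞ := ∑' m : ℕ, ‖a ^ (m : ℤ)‖ₑ + ∑' m : ℕ, ‖b ^ (-1 - m : ℤ)‖ₑ with hD_def
  have hD : D ≠ ∞ :=
    ENNReal.add_ne_top.2 ⟨tsum_enorm_zpow_ne_top ha', tsum_enorm_zpow_neg_ne_top hb'⟩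
  let s : inter ι₀ ι₁ → decompositions ι₀ ι₁ hP₀ hP₁ a b :=
    fun p => ⟨splitAtZero p, splitAtZero_mem hP₀ hP₁ ha' hb' p⟩
  have hs : ∀ p, i (π (s p)) = ι₀ p.1.1 := fun p => by
    rw [hπ, ← decompositionSum_eq (s p) 0]
    simp [s, splitAtZero]
  let e : inter ι₀ ι₁ →L[𝕜] W := LinearMap.mkContinuous
    { toFun := fun p => π (s p)
      map_add' := fun p r => hi (by
        rw [hs, map_add, hs, hs, ← map_add]
        rfl)
      map_smul' := fun c p => hi (by
        rw [hs, RingHom.id_apply, map_smul, hs, ← map_smul]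
        rfl) } D.toReal
    fun p => norm_le_of_enorm_le hD ((hπn (s p)).trans (coupleNorm_splitAtZero_le hP₀ hP₁ p))
  have he : ∀ p, e p = π (s p) := fun p => rfl
  have hrestr : ∀ Ψ : StrongDual 𝕜 W, ∃ ψ : (ℤ → StrongDual 𝕜 X₀) × (ℤ → StrongDual 𝕜 X₁),
      coupleNorm Q₀ Q₁ a b ψ ≤ D * ‖Ψ‖ₑ ∧ (∀ z, HasSum (pairTerm ψ z.1) (Ψ (π z))) ∧
      ∀ k (p : inter ι₀ ι₁), ψ.1 k p.1.1 + ψ.2 k p.1.2 = Ψ (e p) := fun Ψ => by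
    refine exists_dual_decomposition hQ₀ hQ₁ ha hb ha' hb' (Ψ.toLinearMap ∘ₗ π) enorm_ne_top
      (fun z => ?_) fun z hz => ?_
    · exact (Ψ.le_opENorm _).trans (mul_le_mul_right (hπn z) _)
    · have : π z = 0 := hi (by rw [hπ, hz, map_zero])
      rw [LinearMap.comp_apply, this, map_zero]
  have hmap : ∀ Ψ : StrongDual 𝕜 W, ∃ w, i' w = Ψ.comp e ∧ ‖w‖ₑ ≤ D * ‖Ψ‖ₑ := fun Ψ => by
    obtain ⟨ψ, hψ, -, hψe⟩ := hrestr Ψ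
    have h : ∀ k, restrict₀ ι₀ ι₁ (ψ.1 k) + restrict₁ ι₀ ι₁ (ψ.2 k) = Ψ.comp e :=
      fun k => ContinuousLinearMap.ext fun p => hψe k p
    obtain ⟨w, hw⟩ := hWr' _ ψ h (ne_top_of_le_ne_top (ENNReal.mul_ne_top hD enorm_ne_top) hψ)
    refine ⟨w, hw, le_trans ?_ hψ⟩
    rw [hW']
    exact iInf₂_le ψ fun k => (h k).trans hw.symm
  -- Pairing a decomposition of `Ψ|_{X₀ ∩ X₁}` with `z` recovers `Ψ`, without any density.
  have hinj : ∀ Ψ : StrongDual 𝕜 W, (∀ p, Ψ (e p) = 0) → Ψ = 0 := fun Ψ hΨ => by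
    obtain ⟨ψ, hψ, hsum, hψe⟩ := hrestr Ψ
    ext w
    obtain ⟨z, rfl⟩ := hπs w
    obtain ⟨u, -, -, hu⟩ := tsum_pairTerm_eq_tsum hQ₀ hQ₁ ha hb
      (ne_top_of_le_ne_top (ENNReal.mul_ne_top hD enorm_ne_top) hψ) z hψe
    rw [← (hsum z).tsum_eq, hu]
    simp [hΨ]
  set K : ℝ≥0∞ := 2 + ‖a‖ₑ + ‖b‖ₑ with hK_def
  have hK : K ≠ ∞ := by simp [hK_def]
  have hK0 : K ≠ 0 := by simp [hK_def]
  -- Every decomposition of an element of `W'` gives a functional on `W`, with a bound. By `hinj`,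
  -- the functional is the same for all decompositions, and so the bounds may be minimized.
  have hext : ∀ w (ψ : (ℤ → StrongDual 𝕜 X₀) × (ℤ → StrongDual 𝕜 X₁)),
      (∀ k, restrict₀ ι₀ ι₁ (ψ.1 k) + restrict₁ ι₀ ι₁ (ψ.2 k) = i' w) →
      coupleNorm Q₀ Q₁ a b ψ ≠ ∞ →
      ∃ Ψ : StrongDual 𝕜 W, ‖Ψ‖ₑ ≤ K * coupleNorm Q₀ Q₁ a b ψ ∧ ∀ p, Ψ (e p) = i' w p := by
    intro w ψ hψ hψn
    obtain ⟨ℓ, hℓ, hℓ₀, hℓs⟩ := exists_functional_of_dual_decomposition (hP₀ := hP₀) (hP₁ := hP₁)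
      hQ₀ hQ₁ ha hb ha' hb' hψn (φ := fun p => i' w p) fun k p => by
        rw [← hψ k]
        rfl
    obtain ⟨g, hg⟩ := π.exists_rightInverse_of_surjective (LinearMap.range_eq_top.2 hπs)
    have hgπ : ∀ z, ℓ (g (π z)) = ℓ z := fun z => by
      rw [← sub_eq_zero, ← map_sub]
      refine hℓ₀ _ ?_
      have : π (g (π z)) = π z := LinearMap.congr_fun hg (π z)
      rw [← hπ, map_sub, this, sub_self, map_zero]
    have hM : K * coupleNorm Q₀ Q₁ a b ψ ≠ ∞ := ENNReal.mul_ne_top hK hψn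
    -- The case of constant `0` is separate, since `0 * ∞ = 0`.
    have hbound : ∀ x, ‖ℓ (g x)‖ₑ ≤ K * coupleNorm Q₀ Q₁ a b ψ * ‖x‖ₑ := fun x => by
      rw [hW]
      by_cases hM0 : K * coupleNorm Q₀ Q₁ a b ψ = 0
      · obtain ⟨z, rfl⟩ := hπs x
        rw [hgπ]
        refine (hℓ z).trans ?_
        rw [hM0, zero_mul, zero_mul]
      · simp only [ENNReal.mul_iInf_of_ne hM0 hM]
        refine le_iInf₂ fun z hz => ?_
        by_cases hzn : coupleNorm P₀ P₁ a b z = ∞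
        · rw [hzn, ENNReal.mul_top hM0]
          exact le_top
        · obtain ⟨y, rfl, rfl⟩ := hlift x z hz hzn
          rw [hgπ]
          exact hℓ y
    refine ⟨(ℓ ∘ₗ g).mkContinuous (K * coupleNorm Q₀ Q₁ a b ψ).toReal
      fun x => norm_le_of_enorm_le hM (hbound x), ?_, fun p => ?_⟩
    · rw [← ofReal_norm]
      exact ENNReal.ofReal_le_of_le_toReal
        (LinearMap.mkContinuous_norm_le _ ENNReal.toReal_nonneg _)
    · exact (hgπ (s p)).trans (hℓs p)
  choose T hT hTn using hmap
  let Tₗ : StrongDual 𝕜 W →ₗ[𝕜] W' :=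
    { toFun := T
      map_add' := fun x y => hi' (by rw [hT, map_add, hT, hT]; rfl)
      map_smul' := fun c x => hi' (by rw [hT, RingHom.id_apply, map_smul, hT]; rfl) }
  have hTe : ∀ Ψ p, i' (Tₗ Ψ) p = Ψ (e p) := fun Ψ p => by
    change i' (T Ψ) p = _
    rw [hT]
    rfl
  have hTinj : Function.Injective Tₗ := by
    rw [← LinearMap.ker_eq_bot, LinearMap.ker_eq_bot']
    intro Ψ hΨ
    refine hinj Ψ fun p => ?_
    rw [← hTe, hΨ, map_zero]
    rfl
  have hTeq : ∀ Ψ w, (∀ p, Ψ (e p) = i' w p) → Tₗ Ψ = w := fun Ψ w h =>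
    hi' (ContinuousLinearMap.ext fun p => (hTe Ψ p).trans (h p))
  have hTsurj : Function.Surjective Tₗ := fun w => by
    have hlt := enorm_lt_top (x := w)
    simp only [hW', iInf_lt_iff] at hlt
    obtain ⟨ψ, hψ, hψn⟩ := hlt
    obtain ⟨Ψ, -, hΨ⟩ := hext w ψ hψ hψn.ne
    exact ⟨Ψ, hTeq Ψ w hΨ⟩
  have hTinv : ∀ Ψ, ‖Ψ‖ₑ ≤ K * ‖Tₗ Ψ‖ₑ := fun Ψ => by
    rw [hW']
    simp only [ENNReal.mul_iInf_of_ne hK0 hK]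
    refine le_iInf₂ fun ψ hψ => ?_
    by_cases hψn : coupleNorm Q₀ Q₁ a b ψ = ∞
    · rw [hψn, ENNReal.mul_top hK0]
      exact le_top
    · obtain ⟨Ψ', hΨ', hΨe⟩ := hext _ ψ hψ hψn
      rwa [show Ψ' = Ψ from hTinj (hTeq Ψ' _ hΨe)] at hΨ'
  let Φ := LinearEquiv.ofBijective Tₗ ⟨hTinj, hTsurj⟩
  have hΦ : ∀ Ψ, Φ Ψ = Tₗ Ψ := fun Ψ => rfl
  refine ⟨fun p => ⟨_, hs p⟩, Φ.toContinuousLinearEquivOfBounds D.toReal K.toReal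
      (fun Ψ => norm_le_of_enorm_le hD (hTn Ψ)) (fun w => ?_), fun Ψ p w hw => ?_⟩
  · refine norm_le_of_enorm_le hK ((hTinv _).trans (le_of_eq ?_))
    rw [← hΦ, LinearEquiv.apply_symm_apply]
  · refine (hTe Ψ p).trans ?_
    rw [he, hi ((hs p).trans hw.symm)]

end Couple

section Structured

variable {𝕜 : Type*} [RCLike 𝕜] {Ω₀ Ω₁ : Type*} [MeasurableSpace Ω₀] [MeasurableSpace Ω₁]
  {μ₀ : Measure Ω₀} {μ₁ : Measure Ω₁}

/-- A graph over all of `X` is the graph of a linear map. -/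
lemma StructuredSpace.exists_graph_eq {X : Type*} [AddCommGroup X] [Module 𝕜 X]
    (S : StructuredSpace 𝕜 X μ₀) (h : ∀ x, ∃! y, (x, y) ∈ S.graph) :
    ∃ R : X →ₗ[𝕜] (Ω₀ →ₘ[μ₀] 𝕜), ∀ x y, (x, y) ∈ S.graph ↔ R x = y := by
  choose r hr hu using h
  refine ⟨{ toFun := r
            map_add' := fun x y => (hu _ _ (S.graph.add_mem (hr x) (hr y))).symm
            map_smul' := fun c x => (hu _ _ (S.graph.smul_mem c (hr x))).symm }, fun x y =>
    ⟨fun hy => (hu x y hy).symm, ?_⟩⟩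
  rintro rfl
  exact hr x

lemma ofReal_rpow_mul_intCast (t : ℝ) (j : ℤ) :
    (((2 : ℝ) ^ (t * j) : ℝ) : 𝕜) = (((2 : ℝ) ^ t : ℝ) : 𝕜) ^ j := by
  rw [Real.rpow_mul zero_le_two, Real.rpow_intCast, RCLike.ofReal_zpow]

variable {X₀ X₁ V : Type*} [AddCommGroup X₀] [Module 𝕜 X₀] [AddCommGroup X₁] [Module 𝕜 X₁]
  [AddCommGroup V] [Module 𝕜 V]

lemma lqENorm_eq_iInf_coupleNorm {S₀ : StructuredSpace 𝕜 X₀ μ₀} {S₁ : StructuredSpace 𝕜 X₁ μ₁}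
    {R₀ : X₀ →ₗ[𝕜] (Ω₀ →ₘ[μ₀] 𝕜)} {R₁ : X₁ →ₗ[𝕜] (Ω₁ →ₘ[μ₁] 𝕜)}
    (h₀ : ∀ x y, (x, y) ∈ S₀.graph ↔ R₀ x = y) (h₁ : ∀ x y, (x, y) ∈ S₁.graph ↔ R₁ x = y)
    (ι₀ : X₀ →ₗ[𝕜] V) (ι₁ : X₁ →ₗ[𝕜] V) (θ : ℝ) (q : ℝ≥0∞) (v : V) :
    lqENorm S₀ S₁ ι₀ ι₁ θ q v =
      ⨅ (z : (ℤ → X₀) × (ℤ → X₁)) (_ : ∀ j, ι₀ (z.1 j) + ι₁ (z.2 j) = v),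
        coupleNorm (fun x => S₀.fnorm.mixed q fun j => R₀ (x j))
          (fun x => S₁.fnorm.mixed q fun j => R₁ (x j)) (((2 : ℝ) ^ (-θ) : ℝ) : 𝕜)
          (((2 : ℝ) ^ (1 - θ) : ℝ) : 𝕜) z := by
  have key : ∀ d : Decomposition S₀ S₁ ι₀ ι₁ v,
      S₀.fnorm.mixed q (fun j => (((2 : ℝ) ^ (-θ * j) : ℝ) : 𝕜) • d.y₀ j) +
        S₁.fnorm.mixed q (fun j => (((2 : ℝ) ^ ((1 - θ) * j) : ℝ) : 𝕜) • d.y₁ j) =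
      coupleNorm (fun x => S₀.fnorm.mixed q fun j => R₀ (x j))
          (fun x => S₁.fnorm.mixed q fun j => R₁ (x j)) (((2 : ℝ) ^ (-θ) : ℝ) : 𝕜)
          (((2 : ℝ) ^ (1 - θ) : ℝ) : 𝕜) (d.x₀, d.x₁) := fun d => by
    unfold coupleNorm
    congr 2
    · funext j
      rw [map_smul, (h₀ _ _).1 (d.mem₀ j), ofReal_rpow_mul_intCast]
    · funext j
      rw [map_smul, (h₁ _ _).1 (d.mem₁ j), ofReal_rpow_mul_intCast]
  refine le_antisymm (le_iInf₂ fun z hz => ?_) (le_iInf fun d => ?_)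
  · exact (iInf_le _ (⟨z.1, z.2, fun j => R₀ (z.1 j), fun j => R₁ (z.2 j), hz,
      fun j => (h₀ _ _).2 rfl, fun j => (h₁ _ _).2 rfl⟩ :
        Decomposition S₀ S₁ ι₀ ι₁ v)).trans (key _).le
  · rw [key]
    exact iInf₂_le (d.x₀, d.x₁) d.sum_eq

lemma LqInterp.enorm_eq (S₀ : StructuredSpace 𝕜 X₀ μ₀) (S₁ : StructuredSpace 𝕜 X₁ μ₁)
    (ι₀ : X₀ →ₗ[𝕜] V) (ι₁ : X₁ →ₗ[𝕜] V) (θ : ℝ) (q : ℝ≥0∞) [Fact (1 ≤ q)]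
    (v : LqInterp S₀ S₁ ι₀ ι₁ θ q) :
    ‖v‖ₑ = lqENorm S₀ S₁ ι₀ ι₁ θ q (LqInterp.incl S₀ S₁ ι₀ ι₁ θ q v) := by
  rw [← ofReal_norm, LqInterp.norm_def, ENNReal.ofReal_toReal (LqInterp.lqENorm_incl_ne_top v)]

lemma LqInterp.incl_injective (S₀ : StructuredSpace 𝕜 X₀ μ₀) (S₁ : StructuredSpace 𝕜 X₁ μ₁)
    (ι₀ : X₀ →ₗ[𝕜] V) (ι₁ : X₁ →ₗ[𝕜] V) (θ : ℝ) (q : ℝ≥0∞) [Fact (1 ≤ q)] :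
    Function.Injective (LqInterp.incl S₀ S₁ ι₀ ι₁ θ q) :=
  Subtype.val_injective

end Structured

end LqInterpolation
end

open LqInterpolation in
theorem mainTheorem6 {𝕜 : Type*} [RCLike 𝕜]
    {Ω₀ Ω₁ : Type*} [MeasurableSpace Ω₀] [MeasurableSpace Ω₁]
    (μ₀ : Measure Ω₀) (μ₁ : Measure Ω₁) [SigmaFinite μ₀] [SigmaFinite μ₁]
    {X₀ X₁ V : Type*}
    [NormedAddCommGroup X₀] [NormedSpace 𝕜 X₀] [CompleteSpace X₀]
    [NormedAddCommGroup X₁] [NormedSpace 𝕜 X₁] [CompleteSpace X₁]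
    -- the interpolation couple: `X₀` and `X₁` embed continuously into a Hausdorff space `V`
    [AddCommGroup V] [Module 𝕜 V] [TopologicalSpace V] [IsTopologicalAddGroup V]
    [ContinuousSMul 𝕜 V] [T2Space V]
    (ι₀ : X₀ →ₗ[𝕜] V) (ι₁ : X₁ →ₗ[𝕜] V)
    (hι₀ : Continuous ι₀) (hι₁ : Continuous ι₁)
    (hι₀' : Function.Injective ι₀) (hι₁' : Function.Injective ι₁)
    (E₀ : BanachFunctionSpace 𝕜 μ₀) (E₁ : BanachFunctionSpace 𝕜 μ₁)
    (hF₀ : E₀.FatouProperty) (hF₁ : E₁.FatouProperty)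
    (hA₀ : E₀.AbsolutelyContinuousNorm) (hA₁ : E₁.AbsolutelyContinuousNorm)
    (J₀ : X₀ ≃ₗᵢ[𝕜] E₀) (J₁ : X₁ ≃ₗᵢ[𝕜] E₁)
    -- reflexivity of `X₀` and `X₁`
    (hR₀ : Function.Surjective (NormedSpace.inclusionInDoubleDual 𝕜 X₀))
    (hR₁ : Function.Surjective (NormedSpace.inclusionInDoubleDual 𝕜 X₁))
    (θ : ℝ) (hθ₀ : 0 < θ) (hθ₁ : θ < 1)
    (q q' : ℝ≥0∞) [Fact (1 ≤ q)] [Fact (1 ≤ q')] (hq : q ≠ ∞) (hqq' : q.HolderConjugate q') :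
    -- `(J_ν⁻¹)'` is a well-defined isometry of `X_ν'` into the Köthe dual `E_ν'`
    (∀ φ : StrongDual 𝕜 X₀, (∃! g, (φ, g) ∈ (dualStructured E₀ J₀).graph) ∧
      ∀ g, (φ, g) ∈ (dualStructured E₀ J₀).graph → E₀.koetheNorm.toFun g = ‖φ‖ₑ) ∧
    (∀ φ : StrongDual 𝕜 X₁, (∃! g, (φ, g) ∈ (dualStructured E₁ J₁).graph) ∧
      ∀ g, (φ, g) ∈ (dualStructured E₁ J₁).graph → E₁.koetheNorm.toFun g = ‖φ‖ₑ) ∧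
    -- `X₀ ∩ X₁` is contained in the interpolation space
    (∀ x : inter ι₀ ι₁, ∃ v : InterpSpace J₀ J₁ ι₀ ι₁ θ q,
      LqInterp.incl _ _ _ _ _ _ v = ι₀ x.1.1) ∧
    -- restriction of functionals to `X₀ ∩ X₁` is an isomorphism of the dual of the
    -- interpolation space onto the interpolation space of the duals
    ∃ Φ : StrongDual 𝕜 (InterpSpace J₀ J₁ ι₀ ι₁ θ q) ≃L[𝕜] DualInterpSpace J₀ J₁ ι₀ ι₁ θ q',
      ∀ (ψ : StrongDual 𝕜 (InterpSpace J₀ J₁ ι₀ ι₁ θ q)) (x : inter ι₀ ι₁)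
        (v : InterpSpace J₀ J₁ ι₀ ι₁ θ q),
        LqInterp.incl _ _ _ _ _ _ v = ι₀ x.1.1 →
          DualInterpSpace.functional (Φ ψ) x = ψ v := by
  have hG₀ := dualStructured_graph hF₀ hA₀ J₀
  have hG₁ := dualStructured_graph hF₁ hA₁ J₁
  refine ⟨hG₀, hG₁, ?_⟩
  obtain ⟨R₀, hR₀'⟩ := (dualStructured E₀ J₀).exists_graph_eq fun φ => (hG₀ φ).1
  obtain ⟨R₁, hR₁'⟩ := (dualStructured E₁ J₁).exists_graph_eq fun φ => (hG₁ φ).1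
  have hq₁ : 1 ≤ q := Fact.out
  have hS₀ : ∀ x y, (x, y) ∈ (structured E₀ J₀).graph ↔
      (E₀.toL0 ∘ₗ J₀.toLinearEquiv.toLinearMap) x = y :=
    fun x y => eq_comm
  have hS₁ : ∀ x y, (x, y) ∈ (structured E₁ J₁).graph ↔
      (E₁.toL0 ∘ₗ J₁.toLinearEquiv.toLinearMap) x = y :=
    fun x y => eq_comm
  have hN := fun v => lqENorm_eq_iInf_coupleNorm hS₀ hS₁ ι₀ ι₁ θ q v
  have hN' := fun v => lqENorm_eq_iInf_coupleNorm
    (V := StrongDual 𝕜 (inter ι₀ ι₁)) hR₀' hR₁' (restrict₀ ι₀ ι₁) (restrict₁ ι₀ ι₁)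
    θ q' v
  have hpos : ∀ t : ℝ, (0 : ℝ) < 2 ^ t := fun t => Real.rpow_pos_of_pos two_pos t
  have hlt : ∀ {t : ℝ}, t < 0 → ‖(((2 : ℝ) ^ t : ℝ) : 𝕜)‖ₑ < 1 := fun {t} ht => by
    rw [← ofReal_norm, RCLike.norm_ofReal, abs_of_pos (hpos t), ENNReal.ofReal_lt_one]
    exact Real.rpow_lt_one_of_one_lt_of_neg one_lt_two ht
  refine exists_dual_equiv
    (isSequenceNorm_seqNorm hA₀ J₀ hq₁ hq) (isSequenceNorm_seqNorm hA₁ J₁ hq₁ hq)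
    (isDualSequenceNorm_koetheNorm hF₀ J₀ hq hqq' R₀ fun φ => (hR₀' _ _).2 rfl)
    (isDualSequenceNorm_koetheNorm hF₁ J₁ hq hqq' R₁ fun φ => (hR₁' _ _).2 rfl)
    (a := (((2 : ℝ) ^ (-θ) : ℝ) : 𝕜)) (b := (((2 : ℝ) ^ (1 - θ) : ℝ) : 𝕜))
    (RCLike.ofReal_ne_zero.2 (hpos _).ne') (RCLike.ofReal_ne_zero.2 (hpos _).ne')
    (hlt (by linarith)) ?_
    (LqInterp.incl (structured E₀ J₀) (structured E₁ J₁) ι₀ ι₁ θ q)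
    (LqInterp.incl (V := StrongDual 𝕜 (inter ι₀ ι₁)) (dualStructured E₀ J₀) (dualStructured E₁ J₁)
      (restrict₀ ι₀ ι₁) (restrict₁ ι₀ ι₁) θ q')
    (LqInterp.incl_injective _ _ _ _ _ _) (LqInterp.incl_injective _ _ _ _ _ _)
    (fun w => ?_) (fun v z hz hzn => ?_) (fun w => ?_)
    (fun φ ψ hψ hψn => ?_)
  · rw [← RCLike.ofReal_inv, ← Real.rpow_neg zero_le_two]
    exact hlt (by linarith)
  · exact (LqInterp.enorm_eq _ _ _ _ _ _ w).trans (hN _)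
  · exact ⟨⟨v, lt_of_le_of_lt ((hN v).le.trans (iInf₂_le z hz)) (lt_top_iff_ne_top.2 hzn)⟩, rfl⟩
  · exact (LqInterp.enorm_eq _ _ _ _ _ _ w).trans (hN' _)
  · exact ⟨⟨φ, lt_of_le_of_lt ((hN' φ).le.trans (iInf₂_le ψ hψ)) (lt_top_iff_ne_top.2 hψn)⟩, rfl⟩
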